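/- Let $n\ge 3$ be an integer and $k>0$ a real number. Identify $\mathbb R^2$ with $\mathbb C$, with inner product $\langle a,b\rangle=\mathrm{Re}(\bar a b)$. Let $\mathcal D_2(n)$ be the dihedral group of order $2n$, consisting of the maps $x\mapsto e^{2\pi i l/n}x$ and $x\mapsto e^{2\pi i l/n}\bar x$ ($0\le l<n$), with positive roots $\alpha_l=-i e^{i\pi l/n}$, $1\le l\le n$, associated reflections $\sigma_{\alpha}(x)=x-2\langle \alpha,x\rangle\alpha$, and constant multiplicity $k$. For $\xi\in\mathbb R^2$ let $$T_\xi f(x)=\partial_\xi f(x)+k\sum_{l=1}^n\langle\alpha_l,\xi\rangle\,\frac{f(x)-f(\sigma_{\alpha_l}x)}{\langle\alpha_l,x\rangle}$$ be the Dunkl operators (the quotient being extended by continuity to $\langle\alpha_l,x\rangle=0$), let $E_k(\cdot,y)$ be the Dunkl kernel, i.e. the real-analytic solution on $\mathbb R^2$ of $T_\xi f=\langle\xi,y\rangle f$ for all $\xi$, with $f(0)=1$, and let $$D_k(x,y)=\frac1{2n}\sum_{g\in\mathcal D_2(n)}E_k(gx,y)$$ be the generalized Bessel function. Write $(a)_j=a(a+1)\cdots(a+j-1)$,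 $B(u,v)=\Gamma(u)\Gamma(v)/\Gamma(u+v)$, $b_s^{\theta,n}=\cos(\theta+2\pi s/n)$ for $1\le s\le n$, and let $$\Phi_2^{(n)}(\beta_1,\dots,\beta_n;\gamma;z_1,\dots,z_n)=\sum_{m_1,\dots,m_n\ge0}\frac{(\beta_1)_{m_1}\cdots(\beta_n)_{m_n}}{(\gamma)_{m_1+\cdots+m_n}}\frac{z_1^{m_1}}{m_1!}\cdots\frac{z_n^{m_n}}{m_n!}$$ be the confluent Horn function. Put $c_{n,k}=n\,B(k+\tfrac12,\tfrac12)\,\Gamma(nk)$. Then $D_k(0,y)=1$ for all $y\in\mathbb R^2$, and for all $x=\rho e^{i\phi}$, $y=re^{i\theta}$ with $\rho,r\ge0$ and $\phi,\theta\in[0,\pi/n]$, $$D_k(x,y)=\frac{c_{n,k}}{n\,B(k+\frac12,\frac12)\,\Gamma(nk)}\sum_{j\ge0}\frac{(k)_j(k)_j}{(2k)_j\,(nk)_{nj}\,j!}\Bigl(-4\bigl(\tfrac{\rho r}{2}\bigr)^n\sin(n\theta)\sin(n\phi)\Bigr)^j\,\Phi_2^{(n)}\bigl(k+j,\dots,k+j;\,nk+nj;\,\rho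 r\,b_1^{\theta-\phi,n},\dots,\rho r\,b_n^{\theta-\phi,n}\bigr),$$ where the series over $j$ and the multiple series defining each $\Phi_2^{(n)}$ converge absolutely. (Thus the factor in front of the sum, which is fixed by the normalization $D_k(0,y)=1$, equals $1$.) -/

import Mathlib

noncomputable section

namespace DihedralBessel

/-- The positive roots `-i e^{iπl/n}`, `1 ≤ l ≤ n`, of the dihedral root system `I₂(n)` in `ℂ = ℝ²`.
They are unit vectors; here `l = s + 1`. -/
def posRoot (n : ℕ) (s : Fin n) : ℂ :=
  -Complex.I * Complex.exp (Complex.I * ((Real.pi * ((s : ℕ) + 1) / n : ℝ) : ℂ))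

/-- The orthogonal reflection in the line orthogonal to the unit vector `a`. -/
def reflect (a x : ℂ) : ℂ := x - (2 * inner ℝ a x : ℝ) • a

/-- The difference quotient `(f x - f (σ_a x)) / ⟨a, x⟩` for a unit vector `a`. On the mirror
`⟨a, x⟩ = 0` it takes its limit value `2 ∂_a f (x)` (for `f` of class `C¹`). -/
def diffQuot (a : ℂ) (f : ℂ → ℝ) (x : ℂ) : ℝ :=
  if inner ℝ a x = (0 : ℝ) then 2 * fderiv ℝ f x a
  else (f x - f (reflect a x)) / inner ℝ a x

/-- The Dunkl operator `T_ξ` of the dihedral root system `I₂(n)` with constant multiplicity `k`. -/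
def dunklOp (n : ℕ) (k : ℝ) (ξ : ℂ) (f : ℂ → ℝ) (x : ℂ) : ℝ :=
  fderiv ℝ f x ξ + k * ∑ s : Fin n, inner ℝ (posRoot n s) ξ * diffQuot (posRoot n s) f x

/-- `f` is a real-analytic solution on `ℝ²` of the joint eigenvalue problem
`T_ξ f = ⟨ξ, y⟩ f` for all `ξ`, normalized by `f 0 = 1`. -/
structure IsDunklEigenfunction (n : ℕ) (k : ℝ) (y : ℂ) (f : ℂ → ℝ) : Prop where
  analytic : AnalyticOnNhd ℝ f Set.univ
  eigen : ∀ ξ x : ℂ, dunklOp n k ξ f x = inner ℝ ξ y * f x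
  normalized : f 0 = 1

/-- The Dunkl kernel `E_k(x, y)`: for each `y`, the (unique, if `k ≥ 0`) normalized analytic joint
eigenfunction of the Dunkl operators. -/
def dunklKernel (n : ℕ) (k : ℝ) (x y : ℂ) : ℝ :=
  Classical.epsilon (IsDunklEigenfunction n k y) x

/-- The generalized Bessel function `D_k(x, y)`: the mean of `E_k(g x, y)` over the `2n` elements
`g` of the dihedral group, which are the rotations `x ↦ e^{2πil/n} x` and the reflections
`x ↦ e^{2πil/n} x̄`, `0 ≤ l < n`. -/
def genBessel (n : ℕ) (k : ℝ) (x y : ℂ) : ℝ :=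
  (1 / (2 * n : ℝ)) * ∑ l ∈ Finset.range n,
    (dunklKernel n k (Complex.exp (Complex.I * ((2 * Real.pi * l / n : ℝ) : ℂ)) * x) y +
      dunklKernel n k
        (Complex.exp (Complex.I * ((2 * Real.pi * l / n : ℝ) : ℂ)) * (starRingEnd ℂ) x) y)

/-- The Pochhammer symbol `(a)_j = a (a + 1) ⋯ (a + j - 1)`. -/
def poch (a : ℝ) (j : ℕ) : ℝ := (ascPochhammer ℝ j).eval a

/-- The term of index `m = (m_1, …, m_n)` of the confluent Horn series `Φ₂^{(n)}(β; γ; z)`. -/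
def hornTerm {n : ℕ} (β : Fin n → ℝ) (γ : ℝ) (z : Fin n → ℝ) (m : Fin n → ℕ) : ℝ :=
  (∏ s, poch (β s) (m s)) / poch γ (∑ s, m s) * ∏ s, z s ^ m s / ((m s).factorial : ℝ)

/-- The confluent Horn function `Φ₂^{(n)}(β_1, …, β_n; γ; z_1, …, z_n)`. -/
def hornPhi {n : ℕ} (β : Fin n → ℝ) (γ : ℝ) (z : Fin n → ℝ) : ℝ :=
  ∑' m : Fin n → ℕ, hornTerm β γ z m

/-- `b_s^{θ,n} = cos (θ + 2πs/n)` for `s = 1, …, n`; the index `s : Fin n` stands for `s + 1`. -/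
def bcos (n : ℕ) (θ : ℝ) (s : Fin n) : ℝ :=
  Real.cos (θ + 2 * Real.pi * ((s : ℕ) + 1) / n)

/-- The normalizing constant `c_{n,k}`: the value forced by `D_k(0, y) = 1` in the expansions of
`D_k` that carry the factor `c_{n,k} / (n B(k + 1/2, 1/2) Γ(nk))`. -/
def normConst (n : ℕ) (k : ℝ) : ℝ :=
  n * ProbabilityTheory.beta (k + 1 / 2) (1 / 2) * Real.Gamma (n * k)

end DihedralBessel

end

/-!
On functions `x ^ r * g (x ^ n, conj x ^ n)` the complex Dunkl operators reduce to first-order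
operators in two variables, whose kernels are spanned by Heisenberg polynomials. This makes every
homogeneous component of the Dunkl kernel explicit. The eigenfunction is unique by a maximum
principle: for `ξ = x` the difference terms of `T_ξ f` are `k * (f x - f (σ x))`, nonnegative at a
maximum of `f` on a sphere.

Averaging over the group keeps only the degrees divisible by `n`, up to powers of `|x|² * |y|²`, so
`D_k` becomes a double series in products of Gegenbauer polynomials of `x ^ n` and `y ^ n`. The
product formula for Gegenbauer polynomials turns it into a single series of powers of
`(x ^ n - conj x ^ n) * (y ^ n - conj y ^ n)`, which is the source of the factor
`sin (n * θ) * sin (n * φ)`. Under the inverse Joukowski substitution `u = 2 * q / (1 + q ^ 2)` the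
radial Bessel factors are a Lagrange expansion, while `∏ s, (1 - u * b_s)` becomes
`(1 + q ^ 2) ^ (-n)` times a product of two linear factors in `q ^ n`; comparing the two sides
identifies the generating function of `D_k` with that of the confluent Horn functions `Φ₂`, degree
by degree.
-/

noncomputable section

namespace DihedralBessel

open PowerSeries Finset ComplexConjugate Filter Topology

section FormalSeries

variable {K : Type*} [Field K]

/-- The rising factorial `(a)_j = a (a + 1) ⋯ (a + j - 1)` in a field; `poch` is the real case. -/
def rising (a : K) (j : ℕ) : K := (ascPochhammer K j).eval a

@[simp] lemma rising_zero (a : K) : rising a 0 = 1 := by simp [rising]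

lemma rising_succ (a : K) (j : ℕ) : rising a (j + 1) = rising a j * (a + j) := by
  simp [rising, ascPochhammer_succ_eval]

lemma rising_add (a : K) (i j : ℕ) : rising a (i + j) = rising a i * rising (a + i) j := by
  induction j with
  | zero => simp
  | succ j ih => rw [← add_assoc, rising_succ, ih, rising_succ]; push_cast; ring

lemma rising_succ_left (a : K) (j : ℕ) : rising a (j + 1) = a * rising (a + 1) j := by
  rw [add_comm, rising_add, rising_succ]
  simp

/-- The formal sum `∑ i, X ^ i * g i`. The factor `X ^ i` makes it locally finite without any
condition on the `g i`. -/
def xPowSum (g : ℕ → K⟦X⟧) : K⟦X⟧ :=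
  PowerSeries.mk fun N => ∑ i ∈ range (N + 1), coeff (N - i) (g i)

lemma coeff_xPowSum (g : ℕ → K⟦X⟧) (N : ℕ) :
    coeff N (xPowSum g) = ∑ i ∈ range (N + 1), coeff (N - i) (g i) := coeff_mk _ _

lemma X_pow_dvd_xPowSum_sub (g : ℕ → K⟦X⟧) (M : ℕ) :
    (X : K⟦X⟧) ^ M ∣ xPowSum g - ∑ i ∈ range M, X ^ i * g i := by
  rw [X_pow_dvd_iff]
  intro N hN
  rw [map_sub, coeff_xPowSum, map_sum, sub_eq_zero,
    ← sum_subset (range_subset_range.2 hN : range (N + 1) ⊆ range M)]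
  · refine sum_congr rfl fun i hi => ?_
    rw [coeff_X_pow_mul', if_pos (Nat.lt_succ_iff.1 (mem_range.1 hi))]
  · intro i _ hi
    rw [coeff_X_pow_mul', if_neg fun h => hi (mem_range.2 (Nat.lt_succ_iff.2 h))]

lemma eq_of_forall_X_pow_dvd_sub {f g : K⟦X⟧} (h : ∀ M, (X : K⟦X⟧) ^ M ∣ f - g) : f = g := by
  ext N
  simpa [sub_eq_zero] using X_pow_dvd_iff.1 (h (N + 1)) N N.lt_succ_self

lemma eq_xPowSum_of_forall_X_pow_dvd_sub {f : K⟦X⟧} {g : ℕ → K⟦X⟧}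
    (h : ∀ M, (X : K⟦X⟧) ^ M ∣ f - ∑ i ∈ range M, X ^ i * g i) : f = xPowSum g :=
  eq_of_forall_X_pow_dvd_sub fun M => by
    simpa using dvd_sub (h M) (X_pow_dvd_xPowSum_sub g M)

lemma mul_xPowSum (h : K⟦X⟧) (g : ℕ → K⟦X⟧) : h * xPowSum g = xPowSum fun i => h * g i := by
  refine eq_xPowSum_of_forall_X_pow_dvd_sub fun M => ?_
  simpa only [mul_sub, mul_sum, mul_left_comm h] using (X_pow_dvd_xPowSum_sub g M).mul_left h

lemma subst_xPowSum (v : K⟦X⟧) (g : ℕ → K⟦X⟧) :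
    (xPowSum g).subst (X * v) = xPowSum fun i => v ^ i * (g i).subst (X * v) := by
  have hs : HasSubst (X * v : K⟦X⟧) := HasSubst.of_constantCoeff_zero' (by simp)
  refine eq_xPowSum_of_forall_X_pow_dvd_sub fun M => ?_
  have h := map_dvd (substAlgHom (R := K) hs) (X_pow_dvd_xPowSum_sub g M)
  simp only [map_sub, map_sum, map_mul, map_pow, substAlgHom_X, coe_substAlgHom hs, mul_pow,
    mul_assoc] at h
  exact dvd_of_mul_right_dvd h

lemma xPowSum_xPowSum (h : ℕ → ℕ → K⟦X⟧) :
    xPowSum (fun i => xPowSum (h i)) = xPowSum fun m => ∑ p ∈ antidiagonal m, h p.1 p.2 := by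
  ext N
  simp only [coeff_xPowSum, map_sum]
  rw [sum_sigma', sum_sigma']
  refine sum_bij' (fun p _ => ⟨p.1 + p.2, (p.1, p.2)⟩) (fun p _ => ⟨p.2.1, p.2.2⟩) ?_ ?_ ?_ ?_ ?_
  · rintro ⟨i, j⟩ hp
    simp only [mem_sigma, mem_range, HasAntidiagonal.mem_antidiagonal, and_true] at hp ⊢
    omega
  · rintro ⟨m, ⟨i, j⟩⟩ hp
    simp only [mem_sigma, mem_range, HasAntidiagonal.mem_antidiagonal] at hp ⊢
    omega
  · exact fun _ _ => rfl
  · rintro ⟨m, ⟨i, j⟩⟩ hp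
    obtain ⟨_, rfl⟩ : m < N + 1 ∧ i + j = m := by simpa using hp
    rfl
  · intro p _; simp [Nat.sub_sub]

lemma xPowSum_C (c : ℕ → K) : (xPowSum fun i => C (c i)) = PowerSeries.mk c := by
  ext N
  rw [coeff_xPowSum, coeff_mk, sum_range_succ, sum_eq_zero]
  · simp
  · intro i hi
    rw [coeff_C, if_neg (Nat.sub_ne_zero_of_lt (mem_range.1 hi))]

lemma hasSubst_of_constantCoeff_eq_zero {f : K⟦X⟧} (hf : constantCoeff f = 0) : HasSubst f :=
  HasSubst.of_constantCoeff_zero' hf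

lemma subst_C_eq (c : K) (f : K⟦X⟧) : (C c : K⟦X⟧).subst f = C c := subst_C _

lemma subst_C_mul_X (c : K) {f : K⟦X⟧} (hf : constantCoeff f = 0) :
    (C c * X : K⟦X⟧).subst f = C c * f := by
  have hs := hasSubst_of_constantCoeff_eq_zero hf
  rw [subst_mul hs, subst_X hs, subst_C_eq]

lemma subst_X_mul_eq_xPowSum (f v : K⟦X⟧) :
    f.subst (X * v) = xPowSum fun i => C (coeff i f) * v ^ i := by
  have hf : f = xPowSum fun i => C (coeff i f) := by rw [xPowSum_C]; ext; simp
  conv_lhs => rw [hf, subst_xPowSum]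
  simp only [subst_C_eq, mul_comm]

lemma subst_injective {u : K⟦X⟧} (hu : constantCoeff u = 0) (hu1 : coeff 1 u ≠ 0) :
    Function.Injective (PowerSeries.subst u : K⟦X⟧ → K⟦X⟧) := by
  intro f g h
  have hs := hasSubst_of_constantCoeff_eq_zero hu
  have hU : IsUnit (coeff 1 u) := isUnit_iff_ne_zero.2 hu1
  have hv := HasSubst.substInvOfIsUnit u hU
  have h' := congrArg (PowerSeries.subst (substInvOfIsUnit u hU)) h
  rwa [subst_comp_subst_apply hs hv, subst_comp_subst_apply hs hv,
    subst_substInvOfIsUnit_right u hu hU, X_subst, X_subst] at h'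

end FormalSeries

section BinomialPower

variable {K : Type*} [Field K]

/-- The power `(1 - f) ^ (-a)` of a power series `1 - f`, where `f` has no constant term and `a` is
an arbitrary element of the field: the substitution of `f` in the binomial series. -/
def binomialPow (a : K) (f : K⟦X⟧) : K⟦X⟧ :=
  (PowerSeries.mk fun m => rising a m / m.factorial).subst f

lemma binomialPow_X (a : K) :
    binomialPow a X = PowerSeries.mk fun m => rising a m / m.factorial := X_subst _

lemma binomialPow_X_mul (a : K) (v : K⟦X⟧) :
    binomialPow a (X * v) = xPowSum fun i => C (rising a i / i.factorial) * v ^ i := by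
  simp only [binomialPow, subst_X_mul_eq_xPowSum, coeff_mk]

lemma coeff_binomialPow_C_mul_X (a c : K) (m : ℕ) :
    coeff m (binomialPow a (C c * X)) = rising a m / m.factorial * c ^ m := by
  rw [mul_comm, binomialPow_X_mul]
  simp_rw [← map_pow, ← map_mul]
  rw [xPowSum_C, coeff_mk]

@[simp] lemma constantCoeff_binomialPow (a : K) {f : K⟦X⟧} (hf : constantCoeff f = 0) :
    constantCoeff (binomialPow a f) = 1 := by
  obtain ⟨v, rfl⟩ := X_dvd_iff.2 hf
  rw [binomialPow_X_mul, ← coeff_zero_eq_constantCoeff_apply, coeff_xPowSum]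
  simp

lemma subst_binomialPow (a : K) {f g : K⟦X⟧} (hf : constantCoeff f = 0)
    (hg : constantCoeff g = 0) : (binomialPow a f).subst g = binomialPow a (f.subst g) :=
  subst_comp_subst_apply (hasSubst_of_constantCoeff_eq_zero hf)
    (hasSubst_of_constantCoeff_eq_zero hg) _

lemma rescale_C (r c : K) : rescale r (C c : K⟦X⟧) = C c := by
  ext N
  rw [coeff_rescale, coeff_C]
  split_ifs with h <;> simp [h]

lemma rescale_binomialPow (r a c : K) :
    rescale r (binomialPow a (C c * X)) = binomialPow a (C (r * c) * X) := by
  ext N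
  rw [coeff_rescale, coeff_binomialPow_C_mul_X, coeff_binomialPow_C_mul_X, mul_pow]
  ring

variable [CharZero K]

lemma one_sub_mul_derivative_binomialPow_X (a : K) :
    (1 - X) * d⁄dX K (binomialPow a X) = C a * binomialPow a X := by
  have hderiv (m : ℕ) :
      coeff m (d⁄dX K (binomialPow a X)) = rising a m * (a + m) / m.factorial := by
    rw [coeff_derivative, binomialPow_X, coeff_mk, rising_succ, Nat.factorial_succ]
    have := Nat.cast_add_one_ne_zero (R := K) m
    have := Nat.cast_ne_zero (R := K).2 m.factorial_ne_zero
    push_cast; field_simp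
  ext m
  rw [sub_mul, one_mul, map_sub, hderiv, coeff_C_mul, binomialPow_X, coeff_mk, ← binomialPow_X]
  cases m with
  | zero => simp
  | succ m =>
    rw [coeff_succ_X_mul, hderiv, rising_succ, Nat.factorial_succ]
    have := Nat.cast_add_one_ne_zero (R := K) m
    have := Nat.cast_ne_zero (R := K).2 m.factorial_ne_zero
    push_cast; field_simp; ring

lemma one_sub_mul_derivative_binomialPow (a : K) {f : K⟦X⟧} (hf : constantCoeff f = 0) :
    (1 - f) * d⁄dX K (binomialPow a f) = C a * d⁄dX K f * binomialPow a f := by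
  have hs := hasSubst_of_constantCoeff_eq_zero hf
  have h := congrArg (substAlgHom (R := K) hs) (one_sub_mul_derivative_binomialPow_X a)
  simp only [map_mul, map_sub, map_one, substAlgHom_X, coe_substAlgHom hs, subst_C_eq,
    binomialPow_X] at h
  rw [binomialPow, derivative_subst hs, ← mul_assoc, h]
  ring

lemma eq_zero_of_derivative_eq_mul {g y : K⟦X⟧} (hy : constantCoeff y = 0)
    (h : d⁄dX K y = g * y) : y = 0 := by
  ext N
  induction N using Nat.strong_induction_on with
  | _ N ih =>
    cases N with
    | zero => simpa using hy
    | succ N =>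
      have hN := congrArg (coeff N) h
      rw [coeff_derivative, coeff_mul, sum_eq_zero] at hN
      · simpa [Nat.cast_add_one_ne_zero (R := K) N] using hN
      · intro p hp
        have : p.2 < N + 1 := Nat.antidiagonal.snd_lt hp
        rw [ih p.2 this, map_zero, mul_zero]

lemma eq_binomialPow_of_one_sub_mul_derivative {a : K} {f y : K⟦X⟧} (hf : constantCoeff f = 0)
    (hy : constantCoeff y = 1) (h : (1 - f) * d⁄dX K y = C a * d⁄dX K f * y) :
    y = binomialPow a f := by
  have hinv : (1 - f)⁻¹ * (1 - f) = 1 := PowerSeries.inv_mul_cancel _ (by simp [hf])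
  have hode := one_sub_mul_derivative_binomialPow a hf
  rw [← sub_eq_zero]
  refine eq_zero_of_derivative_eq_mul (g := (1 - f)⁻¹ * (C a * d⁄dX K f)) (by simp [hy, hf]) ?_
  rw [map_sub]
  linear_combination (-(d⁄dX K y - d⁄dX K (binomialPow a f))) * hinv + (1 - f)⁻¹ * (h - hode)

lemma binomialPow_mul_binomialPow (a : K) {f g h : K⟦X⟧} (hf : constantCoeff f = 0)
    (hg : constantCoeff g = 0) (hh : (1 - f) * (1 - g) = 1 - h) :
    binomialPow a f * binomialPow a g = binomialPow a h := by
  obtain rfl : h = 1 - (1 - f) * (1 - g) := by rw [hh]; ring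
  refine eq_binomialPow_of_one_sub_mul_derivative (by simp [hf, hg]) (by simp [hf, hg]) ?_
  have h1 := one_sub_mul_derivative_binomialPow a hf
  have h2 := one_sub_mul_derivative_binomialPow a hg
  simp only [Derivation.leibniz, map_sub, derivative_one, smul_eq_mul]
  linear_combination (1 - g) * binomialPow a g * h1 + (1 - f) * binomialPow a f * h2

lemma binomialPow_add (a b : K) {f : K⟦X⟧} (hf : constantCoeff f = 0) :
    binomialPow (a + b) f = binomialPow a f * binomialPow b f := by
  refine (eq_binomialPow_of_one_sub_mul_derivative hf (by simp [hf]) ?_).symm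
  have h1 := one_sub_mul_derivative_binomialPow a hf
  have h2 := one_sub_mul_derivative_binomialPow b hf
  simp only [Derivation.leibniz, smul_eq_mul, map_add]
  linear_combination binomialPow b f * h1 + binomialPow a f * h2

lemma binomialPow_zero_left {f : K⟦X⟧} (hf : constantCoeff f = 0) : binomialPow 0 f = 1 :=
  (eq_binomialPow_of_one_sub_mul_derivative hf (by simp) (by simp)).symm

lemma binomialPow_neg_one {f : K⟦X⟧} (hf : constantCoeff f = 0) : binomialPow (-1) f = 1 - f :=
  (eq_binomialPow_of_one_sub_mul_derivative hf (by simp [hf]) (by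
    simp only [map_sub, Derivation.map_one_eq_zero, zero_sub, mul_neg, map_neg, map_one, neg_mul,
      one_mul]
    ring)).symm

lemma binomialPow_one_mul {f : K⟦X⟧} (hf : constantCoeff f = 0) :
    binomialPow 1 f * (1 - f) = 1 := by
  rw [← binomialPow_neg_one hf, ← binomialPow_add _ _ hf, add_neg_cancel, binomialPow_zero_left hf]

lemma binomialPow_add_one_mul (a : K) {f : K⟦X⟧} (hf : constantCoeff f = 0) :
    binomialPow (a + 1) f * (1 - f) = binomialPow a f := by
  rw [binomialPow_add _ _ hf, mul_assoc, binomialPow_one_mul hf, mul_one]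

lemma binomialPow_pow (a : K) {f : K⟦X⟧} (hf : constantCoeff f = 0) (m : ℕ) :
    binomialPow a f ^ m = binomialPow (m * a) f := by
  induction m with
  | zero => simp [binomialPow_zero_left hf]
  | succ m ih =>
    rw [pow_succ, ih, ← binomialPow_add _ _ hf, Nat.cast_succ, add_one_mul]

lemma binomialPow_one_pow {f : K⟦X⟧} (hf : constantCoeff f = 0) (m : ℕ) :
    binomialPow 1 f ^ m = binomialPow (m : K) f := by
  rw [binomialPow_pow 1 hf, mul_one]

lemma binomialPow_add_natCast_mul_pow (a : K) {f : K⟦X⟧} (hf : constantCoeff f = 0) (m : ℕ) :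
    binomialPow (a + m) f * (1 - f) ^ m = binomialPow a f := by
  rw [binomialPow_add _ _ hf, ← binomialPow_one_pow hf, mul_assoc, ← mul_pow,
    binomialPow_one_mul hf, one_pow, mul_one]

lemma prod_binomialPow {ι : Type*} (s : Finset ι) (a : K) {f : ι → K⟦X⟧}
    (hf : ∀ i ∈ s, constantCoeff (f i) = 0) {h : K⟦X⟧} (hh : ∏ i ∈ s, (1 - f i) = 1 - h) :
    ∏ i ∈ s, binomialPow a (f i) = binomialPow a h := by
  classical
  induction s using Finset.induction_on generalizing h with
  | empty =>
    obtain rfl : h = 0 := by rw [prod_empty] at hh; linear_combination hh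
    exact eq_binomialPow_of_one_sub_mul_derivative (map_zero _) (by simp) (by simp)
  | insert i s hi ih =>
    have hs : ∀ j ∈ s, constantCoeff (f j) = 0 := fun j hj => hf j (mem_insert_of_mem hj)
    have h0 : constantCoeff (1 - ∏ j ∈ s, (1 - f j)) = 0 := by
      rw [map_sub, map_prod, prod_eq_one fun j hj => by simp [hs j hj], map_one, sub_self]
    rw [prod_insert hi, ih hs (h := 1 - ∏ j ∈ s, (1 - f j)) (by ring)]
    refine binomialPow_mul_binomialPow a (hf i (mem_insert_self _ _)) h0 ?_
    rw [← hh, prod_insert hi]; ring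

end BinomialPower

section Gegenbauer

variable {K : Type*} [Field K]

/-- The generating function `(1 - z X) ^ (-a) * (1 - w X) ^ (-b)` of the Heisenberg polynomials of
type `(a, b)` in two variables `z`, `w`. -/
def heisenbergSeries (a b z w : K) : K⟦X⟧ := binomialPow a (C z * X) * binomialPow b (C w * X)

lemma heisenbergSeries_comm (a b z w : K) : heisenbergSeries a b z w = heisenbergSeries b a w z :=
  mul_comm _ _

lemma coeff_heisenbergSeries (a b z w : K) (j : ℕ) :
    coeff j (heisenbergSeries a b z w) = ∑ p ∈ antidiagonal j,
      rising a p.1 / p.1.factorial * z ^ p.1 * (rising b p.2 / p.2.factorial * w ^ p.2) := by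
  simp only [heisenbergSeries, coeff_mul, coeff_binomialPow_C_mul_X]

lemma coeff_heisenbergSeries_mul_mul (a b c z w : K) (j : ℕ) :
    coeff j (heisenbergSeries a b (c * z) (c * w)) =
      c ^ j * coeff j (heisenbergSeries a b z w) := by
  rw [heisenbergSeries, ← rescale_binomialPow, ← rescale_binomialPow, ← map_mul (rescale c),
    coeff_rescale, heisenbergSeries]

/-- The Gegenbauer polynomial of degree `j` and parameter `k`, homogenized: at `(A, A⁻¹)` it is the
usual one at `(A + A⁻¹) / 2`. -/
def gegenbauer (k z w : K) (j : ℕ) : K := coeff j (heisenbergSeries k k z w)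

lemma gegenbauer_comm (k z w : K) (j : ℕ) : gegenbauer k z w j = gegenbauer k w z j := by
  rw [gegenbauer, heisenbergSeries_comm, gegenbauer]

lemma gegenbauer_mul_mul (k c z w : K) (j : ℕ) :
    gegenbauer k (c * z) (c * w) j = c ^ j * gegenbauer k z w j :=
  coeff_heisenbergSeries_mul_mul k k c z w j

/-- `X ^ l` times the `l`-th Hasse derivative of a power series. -/
def xPowHasseDeriv (l : ℕ) (g : K⟦X⟧) : K⟦X⟧ := PowerSeries.mk fun m => m.choose l * coeff m g

lemma xPowHasseDeriv_mul (i : ℕ) (g h : K⟦X⟧) :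
    xPowHasseDeriv i (g * h) =
      ∑ p ∈ antidiagonal i, xPowHasseDeriv p.1 g * xPowHasseDeriv p.2 h := by
  ext J
  simp only [xPowHasseDeriv, coeff_mk, map_sum, coeff_mul]
  rw [sum_comm, mul_sum]
  refine sum_congr rfl fun q hq => ?_
  rw [← HasAntidiagonal.mem_antidiagonal.1 hq, Nat.add_choose_eq, Nat.cast_sum, sum_mul]
  refine sum_congr rfl fun p _ => ?_
  push_cast; ring

variable [CharZero K]

lemma choose_add_mul_rising (k : K) (l m : ℕ) :
    ((l + m).choose l : K) * (rising k (l + m) / (l + m).factorial) =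
      rising k l / l.factorial * (rising (k + l) m / m.factorial) := by
  have hl := Nat.cast_ne_zero (R := K).2 l.factorial_ne_zero
  have hm := Nat.cast_ne_zero (R := K).2 m.factorial_ne_zero
  have hlm := Nat.cast_ne_zero (R := K).2 (l + m).factorial_ne_zero
  rw [Nat.cast_add_choose, rising_add]
  field_simp

lemma xPowHasseDeriv_binomialPow (k c : K) (l : ℕ) :
    xPowHasseDeriv l (binomialPow k (C c * X)) =
      X ^ l * (C (rising k l / l.factorial * c ^ l) * binomialPow (k + l) (C c * X)) := by
  ext J
  rw [xPowHasseDeriv, coeff_mk, coeff_X_pow_mul', coeff_binomialPow_C_mul_X]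
  split_ifs with h
  · obtain ⟨m, rfl⟩ := Nat.exists_eq_add_of_le h
    rw [coeff_C_mul, Nat.add_sub_cancel_left, coeff_binomialPow_C_mul_X, ← mul_assoc,
      choose_add_mul_rising, pow_add]
    ring
  · rw [Nat.choose_eq_zero_of_lt (not_le.1 h), Nat.cast_zero, zero_mul]

lemma sum_rising_mul_rising (a b : K) (m : ℕ) :
    ∑ p ∈ antidiagonal m, rising a p.1 / p.1.factorial * (rising b p.2 / p.2.factorial) =
      rising (a + b) m / m.factorial := by
  have h := congrArg (coeff m) (binomialPow_add a b (constantCoeff_X (R := K)))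
  simpa only [binomialPow_X, coeff_mul, coeff_mk] using h.symm

lemma sum_antidiagonal_fst_assoc {M : Type*} [AddCommMonoid M] (m : ℕ) (f : ℕ → ℕ → ℕ → M) :
    ∑ p ∈ antidiagonal m, ∑ q ∈ antidiagonal p.1, f q.1 q.2 p.2 =
      ∑ p ∈ antidiagonal m, ∑ q ∈ antidiagonal p.2, f p.1 q.1 q.2 := by
  rw [sum_sigma', sum_sigma']
  refine sum_bij' (fun x _ => ⟨(x.2.1, x.2.2 + x.1.2), (x.2.2, x.1.2)⟩)
    (fun x _ => ⟨(x.1.1 + x.2.1, x.2.2), (x.1.1, x.2.1)⟩) ?_ ?_ ?_ ?_ fun _ _ => rfl <;>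
  · rintro ⟨⟨a, b⟩, ⟨c, d⟩⟩ h
    simp only [mem_sigma, HasAntidiagonal.mem_antidiagonal] at h ⊢
    grind

lemma rising_mul_add_pow_mul_pow {A : Type*} [CommRing A] [Algebra K A] (k c : K) (y z : A)
    (a b : ℕ) :
    algebraMap K A (rising k a / a.factorial * (rising k b / b.factorial) / c) *
        ((y + z) ^ a * z ^ b) =
      ∑ q ∈ antidiagonal a, algebraMap K A (rising k q.1 / q.1.factorial / c *
        (rising (k + q.1) q.2 / q.2.factorial * (rising k b / b.factorial))) *
          (y ^ q.1 * z ^ (q.2 + b)) := by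
  rw [(Commute.all y z).add_pow', sum_mul, mul_sum]
  refine sum_congr rfl fun q hq => ?_
  have h := choose_add_mul_rising k q.1 q.2
  rw [HasAntidiagonal.mem_antidiagonal.1 hq] at h
  have hcoef : rising k q.1 / q.1.factorial / c *
        (rising (k + q.1) q.2 / q.2.factorial * (rising k b / b.factorial)) =
      a.choose q.1 * (rising k a / a.factorial * (rising k b / b.factorial) / c) := by
    linear_combination (-(rising k b / b.factorial / c)) * h
  rw [hcoef, map_mul, map_natCast, nsmul_eq_mul, pow_add]
  ring

/-- With `τ` a beta variable of parameters `(k, k)`, both sides are `E[(z + τ y) ^ m] / m!`: on the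
left the power is expanded around `z`, on the right it is that of `τ (z + y) + (1 - τ) z`. -/
lemma sum_beta_moments {A : Type*} [CommRing A] [Algebra K A] (k : K)
    (hk : ∀ j, rising (2 * k) j ≠ 0) (y z : A) (m : ℕ) :
    ∑ p ∈ antidiagonal m, algebraMap K A (rising k p.1 / rising (2 * k) p.1 /
        (p.1.factorial * p.2.factorial)) * (y ^ p.1 * z ^ p.2) =
      ∑ p ∈ antidiagonal m, algebraMap K A (rising k p.1 / p.1.factorial *
        (rising k p.2 / p.2.factorial) / rising (2 * k) m) * ((y + z) ^ p.1 * z ^ p.2) := by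
  simp only [rising_mul_add_pow_mul_pow]
  rw [sum_antidiagonal_fst_assoc m fun a b c => algebraMap K A
    (rising k a / a.factorial / rising (2 * k) m * (rising (k + a) b / b.factorial *
      (rising k c / c.factorial))) * (y ^ a * z ^ (b + c))]
  refine sum_congr rfl fun p hp => ?_
  have hm := HasAntidiagonal.mem_antidiagonal.1 hp
  have hz : ∀ q ∈ antidiagonal p.2, algebraMap K A
      (rising k p.1 / p.1.factorial / rising (2 * k) m * (rising (k + p.1) q.1 / q.1.factorial *
        (rising k q.2 / q.2.factorial))) * (y ^ p.1 * z ^ (q.1 + q.2)) = algebraMap K A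
      (rising k p.1 / p.1.factorial / rising (2 * k) m * (rising (k + p.1) q.1 / q.1.factorial *
        (rising k q.2 / q.2.factorial))) * (y ^ p.1 * z ^ p.2) := fun q hq => by
    rw [HasAntidiagonal.mem_antidiagonal.1 hq]
  rw [sum_congr rfl hz, ← sum_mul, ← map_sum, ← mul_sum, sum_rising_mul_rising, ← hm, rising_add,
    show k + p.1 + k = 2 * k + p.1 by ring]
  have hk' := hk (p.1 + p.2)
  rw [rising_add] at hk'
  have := left_ne_zero_of_mul hk'
  have := right_ne_zero_of_mul hk'
  congr 2
  field_simp

lemma gegenbauer_eq_sum_antidiagonal (k : K) (hk : ∀ j, rising (2 * k) j ≠ 0) (z w : K) (m : ℕ) :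
    gegenbauer k z w m / rising (2 * k) m = ∑ p ∈ antidiagonal m,
      rising k p.1 / rising (2 * k) p.1 / (p.1.factorial * p.2.factorial) *
        ((w - z) ^ p.1 * z ^ p.2) := by
  have h := sum_beta_moments (A := K) k hk (w - z) z m
  simp only [Algebra.algebraMap_self, RingHom.id_apply, sub_add_cancel] at h
  rw [h, gegenbauer_comm, gegenbauer, coeff_heisenbergSeries, sum_div]
  refine sum_congr rfl fun p _ => ?_
  ring

lemma binomialPow_eq_xPowSum (b z w : K) : binomialPow b (C w * X) = xPowSum fun i =>
    C (rising b i / i.factorial * (w - z) ^ i) * binomialPow (b + i) (C z * X) := by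
  have hz : constantCoeff (C z * X : K⟦X⟧) = 0 := by simp
  have hfactor : binomialPow b (C z * X) *
      binomialPow b (X * (C (w - z) * binomialPow 1 (C z * X))) = binomialPow b (C w * X) := by
    refine binomialPow_mul_binomialPow b hz (by simp) ?_
    rw [map_sub]
    linear_combination (-X * (C w - C z)) * binomialPow_one_mul hz
  rw [← hfactor, binomialPow_X_mul, mul_xPowSum]
  congr 1 with i : 1
  rw [mul_pow, binomialPow_one_pow hz, binomialPow_add _ _ hz, ← map_pow, map_mul]
  ring

lemma choose_mul_gegenbauer (k z w : K) (i j : ℕ) :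
    ((i + j).choose i : K) * gegenbauer k z w (i + j) = coeff j (∑ p ∈ antidiagonal i,
      C (rising k p.1 / p.1.factorial * z ^ p.1 * (rising k p.2 / p.2.factorial * w ^ p.2)) *
        (binomialPow (k + p.1) (C z * X) * binomialPow (k + p.2) (C w * X))) := by
  have hderiv : xPowHasseDeriv i (heisenbergSeries k k z w) = X ^ i * ∑ p ∈ antidiagonal i,
      C (rising k p.1 / p.1.factorial * z ^ p.1 * (rising k p.2 / p.2.factorial * w ^ p.2)) *
        (binomialPow (k + p.1) (C z * X) * binomialPow (k + p.2) (C w * X)) := by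
    rw [heisenbergSeries, xPowHasseDeriv_mul, mul_sum]
    refine sum_congr rfl fun p hp => ?_
    rw [xPowHasseDeriv_binomialPow, xPowHasseDeriv_binomialPow,
      ← HasAntidiagonal.mem_antidiagonal.1 hp, pow_add,
      map_mul C (_ * _)]
    ring
  have h := congrArg (coeff (i + j)) hderiv
  rwa [xPowHasseDeriv, coeff_mk, add_comm, coeff_X_pow_mul, add_comm] at h

variable (k : K) (hk : ∀ j, rising (2 * k) j ≠ 0) (c₁ c₂ d₁ d₂ : K)
include hk

lemma mk_gegenbauer_mul_gegenbauer :
    (PowerSeries.mk fun J => J.factorial / rising (2 * k) J *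
        (gegenbauer k c₁ c₂ J * gegenbauer k d₁ d₂ J)) =
      xPowSum fun i => ∑ p ∈ antidiagonal i,
        C (rising k i / rising (2 * k) i * (d₂ - d₁) ^ i * (rising k p.1 / p.1.factorial *
            c₂ ^ p.1 * (rising k p.2 / p.2.factorial * c₁ ^ p.2))) *
          (binomialPow (k + p.1) (C (c₂ * d₁) * X) * binomialPow (k + p.2) (C (c₁ * d₁) * X)) := by
  ext J
  have hd := gegenbauer_eq_sum_antidiagonal k hk d₁ d₂ J
  calc _ = J.factorial * (gegenbauer k c₂ c₁ J) * (gegenbauer k d₁ d₂ J / rising (2 * k) J) := by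
        rw [coeff_mk, gegenbauer_comm k c₂]; ring
    _ = ∑ p ∈ antidiagonal J, rising k p.1 / rising (2 * k) p.1 * (d₂ - d₁) ^ p.1 *
          (d₁ ^ p.2 * (J.choose p.1 * gegenbauer k c₂ c₁ J)) := by
        rw [hd, mul_sum]
        refine sum_congr rfl fun p hp => ?_
        have h1 := Nat.cast_ne_zero (R := K).2 p.1.factorial_ne_zero
        have h2 := Nat.cast_ne_zero (R := K).2 p.2.factorial_ne_zero
        rw [← HasAntidiagonal.mem_antidiagonal.1 hp, Nat.cast_add_choose]
        field_simp
    _ = ∑ p ∈ antidiagonal J, coeff p.2 (∑ q ∈ antidiagonal p.1,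
          C (rising k p.1 / rising (2 * k) p.1 * (d₂ - d₁) ^ p.1 * (rising k q.1 / q.1.factorial *
            c₂ ^ q.1 * (rising k q.2 / q.2.factorial * c₁ ^ q.2))) *
          (binomialPow (k + q.1) (C (c₂ * d₁) * X) *
            binomialPow (k + q.2) (C (c₁ * d₁) * X))) := by
        refine sum_congr rfl fun p hp => ?_
        obtain rfl := HasAntidiagonal.mem_antidiagonal.1 hp
        rw [choose_mul_gegenbauer, ← coeff_rescale, ← coeff_C_mul]
        simp only [map_sum, map_mul, rescale_binomialPow, rescale_C, mul_sum, mul_assoc,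
          mul_comm d₁]
    _ = _ := by
        rw [coeff_xPowSum, Nat.sum_antidiagonal_eq_sum_range_succ_mk]

omit hk in
lemma xPowSum_binomialPow_mul_binomialPow_eq :
    (xPowSum fun j => C (rising k j * rising k j / (rising (2 * k) j * j.factorial) *
        ((c₁ - c₂) * (d₁ - d₂)) ^ j) *
      (binomialPow (k + j) (C (c₂ * d₁) * X) * binomialPow (k + j) (C (c₁ * d₂) * X))) =
      xPowSum fun m => C (rising k m * (d₂ - d₁) ^ m) *
        (binomialPow k (C (c₂ * d₁) * X) * binomialPow (k + m) (C (c₁ * d₁) * X)) *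
        ∑ p ∈ antidiagonal m,
          C (rising k p.1 / rising (2 * k) p.1 / (p.1.factorial * p.2.factorial)) *
            ((C (c₂ - c₁) * binomialPow 1 (C (c₂ * d₁) * X)) ^ p.1 * C c₁ ^ p.2) := by
  have hc₂ : constantCoeff (C (c₂ * d₁) * X : K⟦X⟧) = 0 := by simp
  simp only [binomialPow_eq_xPowSum _ (c₁ * d₁) (c₁ * d₂), mul_xPowSum]
  rw [xPowSum_xPowSum]
  congr 1 with m : 1
  rw [mul_sum]
  refine sum_congr rfl fun p hp => ?_
  obtain rfl := HasAntidiagonal.mem_antidiagonal.1 hp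
  have hcoef : C (rising k p.1 * rising k p.1 / (rising (2 * k) p.1 * p.1.factorial) *
        ((c₁ - c₂) * (d₁ - d₂)) ^ p.1) *
      C (rising (k + p.1) p.2 / p.2.factorial * (c₁ * d₂ - c₁ * d₁) ^ p.2) =
      (C (rising k (p.1 + p.2) * (d₂ - d₁) ^ (p.1 + p.2)) : K⟦X⟧) *
        C (rising k p.1 / rising (2 * k) p.1 / (p.1.factorial * p.2.factorial)) *
          (C (c₂ - c₁) ^ p.1 * C c₁ ^ p.2) := by
    simp only [← map_mul, ← map_pow]
    rw [rising_add, show (c₁ - c₂) * (d₁ - d₂) = (c₂ - c₁) * (d₂ - d₁) by ring, ← mul_sub,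
      mul_pow, mul_pow, pow_add]
    congr 1
    ring
  rw [binomialPow_add k _ hc₂, ← binomialPow_one_pow hc₂, Nat.cast_add, add_assoc]
  linear_combination (binomialPow k (C (c₂ * d₁) * X) * binomialPow 1 (C (c₂ * d₁) * X) ^ p.1 *
    binomialPow (k + (p.1 + p.2)) (C (c₁ * d₁) * X)) * hcoef

lemma mk_gegenbauer_mul_gegenbauer_eq :
    (PowerSeries.mk fun J => J.factorial / rising (2 * k) J *
        (gegenbauer k c₁ c₂ J * gegenbauer k d₁ d₂ J)) =
      xPowSum fun m => C (rising k m * (d₂ - d₁) ^ m) *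
        (binomialPow k (C (c₂ * d₁) * X) * binomialPow (k + m) (C (c₁ * d₁) * X)) *
        ∑ p ∈ antidiagonal m,
          C (rising k p.1 / p.1.factorial * (rising k p.2 / p.2.factorial) / rising (2 * k) m) *
            ((C c₂ * binomialPow 1 (C (c₂ * d₁) * X) * (1 - C (c₁ * d₁) * X)) ^ p.1 *
              C c₁ ^ p.2) := by
  have hc₂ : constantCoeff (C (c₂ * d₁) * X : K⟦X⟧) = 0 := by simp
  have hc₁ : constantCoeff (C (c₁ * d₁) * X : K⟦X⟧) = 0 := by simp
  rw [mk_gegenbauer_mul_gegenbauer k hk]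
  congr 1 with m : 1
  rw [mul_sum]
  refine sum_congr rfl fun p hp => ?_
  obtain rfl := HasAntidiagonal.mem_antidiagonal.1 hp
  have hcoef : (C (rising k (p.1 + p.2) * (d₂ - d₁) ^ (p.1 + p.2)) : K⟦X⟧) *
      C (rising k p.1 / p.1.factorial * (rising k p.2 / p.2.factorial) /
        rising (2 * k) (p.1 + p.2)) * (C c₂ ^ p.1 * C c₁ ^ p.2) =
      C (rising k (p.1 + p.2) / rising (2 * k) (p.1 + p.2) * (d₂ - d₁) ^ (p.1 + p.2) *
        (rising k p.1 / p.1.factorial * c₂ ^ p.1 * (rising k p.2 / p.2.factorial * c₁ ^ p.2))) := by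
    simp only [← map_mul, ← map_pow]
    congr 1
    ring
  rw [← hcoef, Nat.cast_add, add_left_comm k, add_comm (p.1 : K),
    ← binomialPow_add_natCast_mul_pow (k + p.2) hc₁ p.1, binomialPow_add k _ hc₂,
    ← binomialPow_one_pow hc₂, mul_pow, mul_pow]
  ring

/-- Both sides expand in powers of `d₂ - d₁`; the coefficients agree by `sum_beta_moments`. -/
theorem xPowSum_binomialPow_mul_binomialPow :
    (xPowSum fun j => C (rising k j * rising k j / (rising (2 * k) j * j.factorial) *
        ((c₁ - c₂) * (d₁ - d₂)) ^ j) *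
      (binomialPow (k + j) (C (c₂ * d₁) * X) * binomialPow (k + j) (C (c₁ * d₂) * X))) =
      PowerSeries.mk fun J => J.factorial / rising (2 * k) J *
        (gegenbauer k c₁ c₂ J * gegenbauer k d₁ d₂ J) := by
  have hsum : C (c₂ - c₁) * binomialPow 1 (C (c₂ * d₁) * X) + C c₁ =
      C c₂ * binomialPow 1 (C (c₂ * d₁) * X) * (1 - C (c₁ * d₁) * X) := by
    have hone : binomialPow 1 (C (c₂ * d₁) * X) * (1 - C c₂ * C d₁ * X : K⟦X⟧) = 1 := by
      rw [← map_mul, binomialPow_one_mul (by simp)]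
    rw [map_sub, map_mul C c₁]
    linear_combination (-C c₁) * hone
  rw [xPowSum_binomialPow_mul_binomialPow_eq, mk_gegenbauer_mul_gegenbauer_eq k hk]
  simp only [← hsum]
  congr 1 with m : 1
  exact congrArg _ (sum_beta_moments k hk _ _ m)

end Gegenbauer

section Joukowski

variable {K : Type*} [Field K] [CharZero K]

omit [CharZero K] in
lemma sum_neg_one_pow_mul_choose_mul_rising (N : K) (M : ℕ) :
    ∑ i ∈ range (M + 2), (-1) ^ (M + 1 - i) * ((M + 1).choose i : K) * rising (N + 1 + i) M =
      0 := by
  have hdeg : ((ascPochhammer K M).comp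
      (Polynomial.X + Polynomial.C (N + 1))).natDegree < M + 1 := by
    refine lt_of_le_of_lt Polynomial.natDegree_comp_le ?_
    rw [ascPochhammer_natDegree, Polynomial.natDegree_X_add_C]; omega
  have h := congrFun (Polynomial.fwdDiff_iter_eq_zero_of_degree_lt hdeg) 0
  rw [fwdDiff_iter_eq_sum_shift] at h
  simp only [Pi.zero_apply] at h
  rw [← h]
  refine sum_congr rfl fun i _ => ?_
  simp [rising, zsmul_eq_mul, add_comm]

/-- The coefficients of the Lagrange expansion of `(1 + q) ^ N` in powers of `q / (1 + q) ^ 2`. -/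
def lagrangeCoeff (N : K) (i : ℕ) : K := rising N (2 * i) / (i.factorial * rising (N + 1) i)

lemma xPowSum_lagrangeCoeff (N : K) (hN : ∀ j, rising N j ≠ 0) :
    (xPowSum fun i => C (lagrangeCoeff N i) * binomialPow (N + 2 * i) (C (-1) * X)) = 1 := by
  ext M
  rw [coeff_xPowSum, coeff_one]
  cases M with
  | zero => simp [lagrangeCoeff]
  | succ M =>
    have : N ≠ 0 := by simpa [rising_succ] using hN 1
    have h := congrArg (fun t => N / (M + 1).factorial * t)
      (sum_neg_one_pow_mul_choose_mul_rising N M)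
    simp only [mul_zero, mul_sum] at h
    rw [if_neg M.succ_ne_zero, ← h]
    refine sum_congr rfl fun i hi => ?_
    obtain ⟨m, hm⟩ := Nat.exists_eq_add_of_le (Nat.lt_succ_iff.1 (mem_range.1 hi))
    have hi0 := Nat.cast_ne_zero (R := K).2 i.factorial_ne_zero
    have hm0 := Nat.cast_ne_zero (R := K).2 m.factorial_ne_zero
    have hM0 := Nat.cast_ne_zero (R := K).2 (i + m).factorial_ne_zero
    have hr0 : N * rising (N + 1) i ≠ 0 := rising_succ_left N i ▸ hN (i + 1)
    have hr1 := right_ne_zero_of_mul hr0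
    have hrising : rising N (2 * i) * rising (N + 2 * i) m =
        N * rising (N + 1) i * rising (N + 1 + i) M := by
      rw [show N + 2 * (i : K) = N + ((2 * i : ℕ) : K) by push_cast; ring, ← rising_add,
        ← rising_succ_left, show N + 1 + (i : K) = N + ((i + 1 : ℕ) : K) by push_cast; ring,
        ← rising_add]
      congr 1; omega
    rw [coeff_C_mul, coeff_binomialPow_C_mul_X, lagrangeCoeff, hm, Nat.add_sub_cancel_left,
      Nat.cast_add_choose]
    field_simp
    linear_combination hrising

variable (K) in
/-- The variable `u = 2 q / (1 + q ^ 2)`, the inverse Joukowski transform: `u⁻¹` is the half-sum of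
`q` and `q⁻¹`. -/
def joukowskiVar : K⟦X⟧ := X * (C 2 * binomialPow 1 (C (-1) * X ^ 2))

omit [CharZero K] in
lemma constantCoeff_neg_X_sq : constantCoeff (C (-1) * X ^ 2 : K⟦X⟧) = 0 := by simp

omit [CharZero K] in
lemma constantCoeff_joukowskiVar : constantCoeff (joukowskiVar K) = 0 := by simp [joukowskiVar]

lemma coeff_one_joukowskiVar_ne_zero : coeff 1 (joukowskiVar K) ≠ 0 := by
  rw [joukowskiVar, ← zero_add 1, coeff_succ_X_mul, coeff_zero_eq_constantCoeff_apply, map_mul,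
    constantCoeff_binomialPow _ constantCoeff_neg_X_sq]
  simp

/-- The even power series in `u` that equals `(1 + q ^ 2) ^ N` when `u = 2 q / (1 + q ^ 2)`. -/
def lagrangeSeries (N : K) : K⟦X⟧ := xPowSum fun i => C (lagrangeCoeff N i / 4 ^ i) * X ^ i

omit [CharZero K] in
lemma subst_C_mul_X_pow (c : K) (i : ℕ) {f : K⟦X⟧} (hf : constantCoeff f = 0) :
    (C c * X ^ i : K⟦X⟧).subst f = C c * f ^ i := by
  have hs := hasSubst_of_constantCoeff_eq_zero hf
  rw [subst_mul hs, subst_C_eq, subst_pow hs, subst_X hs]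

lemma binomialPow_mul_subst_lagrangeSeries (N : K) (hN : ∀ j, rising N j ≠ 0) :
    binomialPow N (C (-1) * X ^ 2) * (lagrangeSeries N).subst (joukowskiVar K) = 1 := by
  have hX : constantCoeff (X * X : K⟦X⟧) = 0 := by simp
  have h := congrArg (PowerSeries.subst (X * X : K⟦X⟧)) (xPowSum_lagrangeCoeff N hN)
  rw [subst_xPowSum, ← map_one C, subst_C_eq, map_one] at h
  rw [← h, lagrangeSeries, joukowskiVar, subst_xPowSum, mul_xPowSum]
  congr 1 with i : 1
  have hu : constantCoeff (X * (C 2 * binomialPow 1 (C (-1) * X ^ 2)) : K⟦X⟧) = 0 := by simp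
  have h4 : (C (lagrangeCoeff N i / 4 ^ i) : K⟦X⟧) * C 2 ^ (2 * i) = C (lagrangeCoeff N i) := by
    rw [← map_pow, ← map_mul, pow_mul]
    norm_num
  rw [subst_C_mul_X_pow _ _ hu, subst_mul (hasSubst_of_constantCoeff_eq_zero hX), subst_C_eq,
    subst_binomialPow _ (by simp) hX, subst_C_mul_X _ hX, ← h4, ← sq,
    show N + 2 * (i : K) = N + (2 * i : ℕ) by push_cast; rfl,
    binomialPow_add _ _ constantCoeff_neg_X_sq,
    ← binomialPow_one_pow constantCoeff_neg_X_sq]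
  ring

variable {n : ℕ} (k : K) (c₁ c₂ d₁ d₂ : K)

/-- The generating function of the homogeneous components of the expansion of the generalized
Bessel function in confluent Horn functions. -/
def hornGen (k q : K) (z : Fin n → K) : K⟦X⟧ :=
  xPowSum fun j => C (rising k j * rising k j / (rising (2 * k) j * j.factorial) *
      (q / 2 ^ n) ^ j) * (X ^ ((n - 1) * j) * ∏ s, binomialPow (k + j) (C (z s) * X))

/-- The generating function of the homogeneous components of the generalized Bessel function. -/
def besselGen (n : ℕ) (k c₁ c₂ d₁ d₂ : K) : K⟦X⟧ :=
  xPowSum fun j => C (j.factorial / rising (2 * k) j *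
      (gegenbauer k c₁ c₂ j * gegenbauer k d₁ d₂ j) / 2 ^ (n * j)) *
    (X ^ ((n - 1) * j) * lagrangeSeries (n * k + n * j))

lemma pow_mul_joukowskiVar_pow (hn : n ≠ 0) (j : ℕ) :
    (C 2 * binomialPow 1 (C (-1) * X ^ 2)) ^ j * joukowskiVar K ^ ((n - 1) * j) =
      X ^ ((n - 1) * j) * (C (2 ^ (n * j)) * binomialPow (n * j : K) (C (-1) * X ^ 2)) := by
  have hpow : j + (n - 1) * j = n * j := by
    rw [← one_add_mul, Nat.add_sub_cancel' (Nat.one_le_iff_ne_zero.2 hn)]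
  rw [joukowskiVar, mul_pow X, mul_left_comm, ← pow_add, hpow, mul_pow,
    binomialPow_one_pow constantCoeff_neg_X_sq, map_pow, Nat.cast_mul]

theorem binomialPow_mul_subst_besselGen (hn : n ≠ 0)
    (hnk : ∀ i j : ℕ, rising (n * k + n * i) j ≠ 0) :
    binomialPow (n * k) (C (-1) * X ^ 2) * (besselGen n k c₁ c₂ d₁ d₂).subst (joukowskiVar K) =
      xPowSum fun j => C (j.factorial / rising (2 * k) j *
        (gegenbauer k c₁ c₂ j * gegenbauer k d₁ d₂ j)) * X ^ ((n - 1) * j) := by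
  have hu := hasSubst_of_constantCoeff_eq_zero (constantCoeff_joukowskiVar (K := K))
  conv_lhs => rw [besselGen, joukowskiVar, subst_xPowSum, ← joukowskiVar]
  rw [mul_xPowSum]
  congr 1 with j : 1
  have hlagrange := binomialPow_mul_subst_lagrangeSeries (n * k + n * j : K) (hnk j)
  rw [binomialPow_add _ _ constantCoeff_neg_X_sq] at hlagrange
  rw [subst_mul hu, subst_mul hu, subst_pow hu, subst_X hu, subst_C_eq]
  set c := j.factorial / rising (2 * k) j * (gegenbauer k c₁ c₂ j * gegenbauer k d₁ d₂ j)
  have hc : (C (c / 2 ^ (n * j)) : K⟦X⟧) * C (2 ^ (n * j)) = C c := by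
    have h2 : (2 : K) ^ (n * j) ≠ 0 := pow_ne_zero _ two_ne_zero
    rw [← map_mul, div_mul_cancel₀ _ h2]
  rw [← hc]
  linear_combination (binomialPow (n * k : K) (C (-1) * X ^ 2) * C (c / 2 ^ (n * j)) *
      (lagrangeSeries (n * k + n * j)).subst (joukowskiVar K)) *
        pow_mul_joukowskiVar_pow (K := K) hn j +
    C (c / 2 ^ (n * j)) * X ^ ((n - 1) * j) * C (2 ^ (n * j)) * hlagrange

lemma binomialPow_mul_binomialPow_joukowskiVar (a c : K) :
    binomialPow a (C (-1) * X ^ 2) * binomialPow a (C c * joukowskiVar K) =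
      binomialPow a (C (2 * c) * X - X ^ 2) := by
  refine binomialPow_mul_binomialPow _ constantCoeff_neg_X_sq
    (by simp [constantCoeff_joukowskiVar]) ?_
  have hone := binomialPow_one_mul (constantCoeff_neg_X_sq (K := K))
  simp only [joukowskiVar, map_neg, map_one, map_mul] at hone ⊢
  linear_combination (-C c * X * C 2) * hone

omit [CharZero K] in
lemma subst_joukowskiVar_prod_binomialPow (a : K) (z : Fin n → K) :
    (∏ s, binomialPow a (C (z s) * X)).subst (joukowskiVar K) =
      ∏ s, binomialPow a (C (z s) * joukowskiVar K) := by
  rw [← coe_substAlgHom (hasSubst_of_constantCoeff_eq_zero constantCoeff_joukowskiVar), map_prod]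
  refine prod_congr rfl fun s _ => ?_
  rw [coe_substAlgHom, subst_binomialPow _ (by simp) constantCoeff_joukowskiVar,
    subst_C_mul_X _ constantCoeff_joukowskiVar]

variable {c₁ c₂ d₁ d₂} (z : Fin n → K) (hz : ∏ s, (1 - (C (2 * z s) * X - X ^ 2)) =
  (1 - C (c₂ * d₁) * X ^ n) * (1 - C (c₁ * d₂) * X ^ n))
include hz

lemma prod_binomialPow_joukowskiVar (hn : n ≠ 0) (a : K) :
    binomialPow (n * a) (C (-1) * X ^ 2) * ∏ s, binomialPow a (C (z s) * joukowskiVar K) =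
      binomialPow a (C (c₂ * d₁) * X ^ n) * binomialPow a (C (c₁ * d₂) * X ^ n) := by
  have hXn (c : K) : constantCoeff (C c * X ^ n : K⟦X⟧) = 0 := by simp [hn]
  have hprod : binomialPow (n * a) (C (-1) * X ^ 2) =
      ∏ _s : Fin n, binomialPow a (C (-1) * X ^ 2) := by
    rw [prod_const, card_univ, Fintype.card_fin, binomialPow_pow _ constantCoeff_neg_X_sq]
  rw [hprod, ← prod_mul_distrib]
  simp only [binomialPow_mul_binomialPow_joukowskiVar]
  rw [binomialPow_mul_binomialPow a (hXn _) (hXn _) (sub_sub_cancel 1 _).symm]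
  exact prod_binomialPow _ _ (fun s _ => by simp) (hz.trans (sub_sub_cancel 1 _).symm)

theorem binomialPow_mul_subst_hornGen (hn : n ≠ 0) (hk : ∀ j, rising (2 * k) j ≠ 0) :
    binomialPow (n * k) (C (-1) * X ^ 2) *
        (hornGen k ((c₁ - c₂) * (d₁ - d₂)) z).subst (joukowskiVar K) =
      xPowSum fun j => C (j.factorial / rising (2 * k) j *
        (gegenbauer k c₁ c₂ j * gegenbauer k d₁ d₂ j)) * X ^ ((n - 1) * j) := by
  have hu := hasSubst_of_constantCoeff_eq_zero (constantCoeff_joukowskiVar (K := K))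
  have hXn : constantCoeff (X ^ n : K⟦X⟧) = 0 := by simp [hn]
  have hXn' : (X : K⟦X⟧) ^ n = X * X ^ (n - 1) := (mul_pow_sub_one hn X).symm
  have hproduct := congrArg (PowerSeries.subst (X ^ n : K⟦X⟧))
    (xPowSum_binomialPow_mul_binomialPow k hk c₁ c₂ d₁ d₂)
  rw [← xPowSum_C, hXn', subst_xPowSum, subst_xPowSum, ← hXn'] at hproduct
  simp only [subst_C_eq, ← pow_mul] at hproduct
  conv_rhs => simp only [mul_comm _ (X ^ _)]
  rw [← hproduct]
  conv_lhs => rw [hornGen, joukowskiVar, subst_xPowSum, ← joukowskiVar]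
  rw [mul_xPowSum]
  congr 1 with j : 1
  have hz' := prod_binomialPow_joukowskiVar z hz hn (k + j)
  rw [mul_add, binomialPow_add _ _ constantCoeff_neg_X_sq] at hz'
  rw [subst_mul hu, subst_mul hu, subst_pow hu, subst_X hu,
    subst_joukowskiVar_prod_binomialPow, subst_C_eq,
    subst_mul (hasSubst_of_constantCoeff_eq_zero hXn),
    subst_mul (hasSubst_of_constantCoeff_eq_zero hXn), subst_C_eq,
    subst_binomialPow _ (by simp) hXn, subst_binomialPow _ (by simp) hXn, subst_C_mul_X _ hXn,
    subst_C_mul_X _ hXn, ← hz']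
  have hc : (C (rising k j * rising k j / (rising (2 * k) j * j.factorial) *
      ((c₁ - c₂) * (d₁ - d₂) / 2 ^ n) ^ j) : K⟦X⟧) * C (2 ^ (n * j)) =
      C (rising k j * rising k j / (rising (2 * k) j * j.factorial) *
        ((c₁ - c₂) * (d₁ - d₂)) ^ j) := by
    have h2 : (2 : K) ^ (n * j) ≠ 0 := pow_ne_zero _ two_ne_zero
    rw [← map_mul, div_pow, ← pow_mul, mul_assoc, div_mul_cancel₀ _ h2]
  rw [← hc]
  linear_combination (binomialPow (n * k) (C (-1) * X ^ 2) *
    C (rising k j * rising k j / (rising (2 * k) j * j.factorial) *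
      ((c₁ - c₂) * (d₁ - d₂) / 2 ^ n) ^ j) *
    ∏ s, binomialPow (k + j) (C (z s) * joukowskiVar K)) * pow_mul_joukowskiVar_pow (K := K) hn j

theorem hornGen_eq_besselGen (hn : n ≠ 0) (hk : ∀ j, rising (2 * k) j ≠ 0)
    (hnk : ∀ i j : ℕ, rising (n * k + n * i) j ≠ 0) :
    hornGen k ((c₁ - c₂) * (d₁ - d₂)) z = besselGen n k c₁ c₂ d₁ d₂ := by
  refine subst_injective constantCoeff_joukowskiVar coeff_one_joukowskiVar_ne_zero ?_
  have h := (binomialPow_mul_subst_hornGen k z hz hn hk).trans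
    (binomialPow_mul_subst_besselGen k c₁ c₂ d₁ d₂ hn hnk).symm
  refine mul_left_cancel₀ (fun h0 => ?_) h
  simpa [constantCoeff_binomialPow _ constantCoeff_neg_X_sq] using congrArg constantCoeff h0

end Joukowski

section Heisenberg

variable {K : Type*} [Field K]

/-- The Heisenberg polynomial of type `(a, b)` and degree `j` in `z` and `w`. -/
def heisenberg (a b z w : K) (j : ℕ) : K := coeff j (heisenbergSeries a b z w)

/-- The partial derivative of `heisenberg a b z w j` with respect to `z`. -/
def heisenbergDerivFst (a b z w : K) (j : ℕ) : K := a * coeff j (X * heisenbergSeries (a + 1) b z w)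

/-- The partial derivative of `heisenberg a b z w j` with respect to `w`. -/
def heisenbergDerivSnd (a b z w : K) (j : ℕ) : K := b * coeff j (X * heisenbergSeries a (b + 1) z w)

lemma heisenberg_zero (a b z w : K) : heisenberg a b z w 0 = 1 := by
  simp [heisenberg, coeff_heisenbergSeries]

variable [CharZero K]

lemma derivative_binomialPow (a : K) {f : K⟦X⟧} (hf : constantCoeff f = 0) :
    d⁄dX K (binomialPow a f) = C a * d⁄dX K f * binomialPow (a + 1) f := by
  have hf1 : (1 - f : K⟦X⟧) ≠ 0 := fun h => by simpa [hf] using congrArg constantCoeff h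
  refine mul_left_cancel₀ hf1 ?_
  rw [one_sub_mul_derivative_binomialPow a hf, ← binomialPow_add_one_mul a hf]
  ring

lemma one_sub_mul_heisenbergSeries_left (a b z w : K) :
    (1 - C z * X) * heisenbergSeries (a + 1) b z w = heisenbergSeries a b z w := by
  rw [heisenbergSeries, heisenbergSeries, ← binomialPow_add_one_mul a (f := C z * X) (by simp)]
  ring

lemma one_sub_mul_heisenbergSeries_right (a b z w : K) :
    (1 - C w * X) * heisenbergSeries a (b + 1) z w = heisenbergSeries a b z w := by
  rw [heisenbergSeries_comm a (b + 1), one_sub_mul_heisenbergSeries_left, heisenbergSeries_comm]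

lemma derivative_heisenbergSeries (a b z w : K) :
    d⁄dX K (heisenbergSeries a b z w) =
      C (a * z) * heisenbergSeries (a + 1) b z w + C (b * w) * heisenbergSeries a (b + 1) z w := by
  have hX (c : K) : constantCoeff (C c * X : K⟦X⟧) = 0 := by simp
  simp only [heisenbergSeries, Derivation.leibniz, derivative_binomialPow _ (hX _), smul_eq_mul,
    derivative_C, derivative_X, map_mul]
  ring

omit [CharZero K] in
lemma coeff_X_mul_derivative (f : K⟦X⟧) (j : ℕ) : coeff j (X * d⁄dX K f) = j * coeff j f := by
  cases j with
  | zero => simp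
  | succ j => rw [coeff_succ_X_mul, coeff_derivative, mul_comm]; push_cast; rfl

lemma heisenberg_euler (a b z w : K) (j : ℕ) :
    z * heisenbergDerivFst a b z w j + w * heisenbergDerivSnd a b z w j =
      j * heisenberg a b z w j := by
  simp only [heisenberg, heisenbergDerivFst, heisenbergDerivSnd]
  rw [← coeff_X_mul_derivative, derivative_heisenbergSeries, mul_add, map_add,
    mul_left_comm X, mul_left_comm X, coeff_C_mul, coeff_C_mul]
  ring

lemma heisenbergDerivFst_add_heisenbergDerivSnd_succ (a b z w : K) (j : ℕ) :
    heisenbergDerivFst a b z w (j + 1) + heisenbergDerivSnd a b z w (j + 1) =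
      (j + a + b) * heisenberg a b z w j := by
  have heuler := coeff_X_mul_derivative (heisenbergSeries a b z w) j
  rw [heisenberg, add_assoc, add_mul, ← heuler, heisenbergDerivFst, heisenbergDerivSnd,
    coeff_succ_X_mul, coeff_succ_X_mul, ← coeff_C_mul, ← coeff_C_mul, ← coeff_C_mul, ← map_add,
    ← map_add, derivative_heisenbergSeries]
  congr 1
  simp only [map_mul, map_add]
  linear_combination C a * one_sub_mul_heisenbergSeries_left a b z w +
    C b * one_sub_mul_heisenbergSeries_right a b z w

lemma sub_mul_heisenbergDerivSnd (k z w : K) (j : ℕ) :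
    (z - w) * heisenbergDerivSnd (k + 1) k z w j =
      k * (heisenberg (k + 1) k z w j - heisenberg (k + 1) k w z j) := by
  rw [heisenbergDerivSnd, heisenberg, heisenberg,
    ← one_sub_mul_heisenbergSeries_right (k + 1) k z w,
    heisenbergSeries_comm (k + 1) k w z, ← one_sub_mul_heisenbergSeries_left k (k + 1) z w,
    ← map_sub, mul_left_comm, ← coeff_C_mul]
  congr 2
  simp only [map_sub]
  ring

lemma heisenberg_add_heisenberg_swap (k z w : K) (j : ℕ) :
    k * (heisenberg (k + 1) k z w j + heisenberg (k + 1) k w z j) =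
      (j + 2 * k) * gegenbauer k z w j := by
  have heuler := coeff_X_mul_derivative (heisenbergSeries k k z w) j
  rw [gegenbauer, add_mul, ← heuler, derivative_heisenbergSeries, heisenberg, heisenberg,
    heisenbergSeries_comm (k + 1) k w z, ← map_add, ← coeff_C_mul, ← coeff_C_mul, ← map_add]
  congr 1
  simp only [map_mul, map_ofNat]
  linear_combination C k * one_sub_mul_heisenbergSeries_left k k z w +
    C k * one_sub_mul_heisenbergSeries_right k k z w

lemma heisenberg_succ (k z w : K) (j : ℕ) :
    (k + (j + 1)) * heisenberg (k + 1) k z w (j + 1) =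
      k * heisenberg (k + 1) k w z (j + 1) +
        (2 * k + (j + 1)) * (z * heisenberg (k + 1) k z w j) := by
  have hz : z * heisenberg (k + 1) k z w j =
      heisenberg (k + 1) k z w (j + 1) - gegenbauer k z w (j + 1) := by
    rw [heisenberg, heisenberg, gegenbauer, ← one_sub_mul_heisenbergSeries_left k k z w, ← map_sub,
      ← coeff_C_mul, ← coeff_succ_X_mul]
    congr 1
    ring
  have hswap := heisenberg_add_heisenberg_swap k z w (j + 1)
  push_cast at hswap
  rw [hz]
  linear_combination -hswap

end Heisenberg

section RootsOfUnity

/-- The `n`-th roots of unity `exp (2πi(l + 1) / n)`, in the order that matches the positive roots: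
the reflection along the root number `l + 1` is `x ↦ rotation n l * conj x`. -/
def rotation (n : ℕ) (l : Fin n) : ℂ := Complex.exp (2 * Real.pi * Complex.I / n) ^ ((l : ℕ) + 1)

lemma rotation_pow (n : ℕ) (l : Fin n) : rotation n l ^ n = 1 := by
  have hn : n ≠ 0 := (l.pos).ne'
  rw [rotation, pow_right_comm, (Complex.isPrimitiveRoot_exp n hn).pow_eq_one, one_pow]

lemma rotation_ne_zero (n : ℕ) (l : Fin n) : rotation n l ≠ 0 :=
  pow_ne_zero _ (Complex.exp_ne_zero _)

lemma norm_rotation (n : ℕ) (l : Fin n) : ‖rotation n l‖ = 1 :=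
  Complex.norm_eq_one_of_pow_eq_one (rotation_pow n l) (l.pos).ne'

lemma rotation_mul_conj (n : ℕ) (l : Fin n) : rotation n l * conj (rotation n l) = 1 := by
  rw [Complex.mul_conj, Complex.normSq_eq_norm_sq, norm_rotation]
  simp

lemma sum_rotation_pow {n : ℕ} (hn : n ≠ 0) (e : ℕ) :
    ∑ l : Fin n, rotation n l ^ e = if n ∣ e then (n : ℂ) else 0 := by
  have hζ := Complex.isPrimitiveRoot_exp n hn
  have hgeom : ∑ l : Fin n, rotation n l ^ e =
      Complex.exp (2 * Real.pi * Complex.I / n) ^ e *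
        ∑ i ∈ range n, (Complex.exp (2 * Real.pi * Complex.I / n) ^ e) ^ i := by
    rw [mul_sum, sum_range]
    exact sum_congr rfl fun l _ => by rw [rotation]; ring
  rw [hgeom]
  split_ifs with h
  · rw [(hζ.pow_eq_one_iff_dvd e).2 h]
    simp
  · have hne := mt (hζ.pow_eq_one_iff_dvd e).1 h
    rw [geom_sum_eq hne, pow_right_comm, hζ.pow_eq_one, one_pow, sub_self, zero_div, mul_zero]

lemma sub_rotation_mul_ne_zero {n : ℕ} {z w : ℂ} (h : z ^ n ≠ w ^ n) (l : Fin n) :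
    z - rotation n l * w ≠ 0 := fun h0 =>
  h (by rw [sub_eq_zero.1 h0, mul_pow, rotation_pow, one_mul])

lemma rotation_pow_div_sub {n : ℕ} {z w : ℂ} (h : z ^ n ≠ w ^ n) (i : ℕ) (l : Fin n) :
    rotation n l ^ (i + 1) / (z - rotation n l * w) =
      (∑ q ∈ range n, rotation n l ^ (i + 1 + q) * (w ^ q * z ^ (n - 1 - q))) /
        (z ^ n - w ^ n) := by
  rw [div_eq_div_iff (sub_rotation_mul_ne_zero h l) (sub_ne_zero.2 h)]
  have hgeom := (Commute.all (rotation n l * w) z).geom_sum₂_mul n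
  rw [mul_pow, rotation_pow, one_mul] at hgeom
  have hsum : ∑ q ∈ range n, rotation n l ^ (i + 1 + q) * (w ^ q * z ^ (n - 1 - q)) =
      rotation n l ^ (i + 1) * ∑ q ∈ range n, (rotation n l * w) ^ q * z ^ (n - 1 - q) := by
    rw [mul_sum]
    exact sum_congr rfl fun q _ => by rw [pow_add, mul_pow]; ring
  rw [hsum]
  linear_combination rotation n l ^ (i + 1) * hgeom

lemma sum_rotation_pow_div_sub {n : ℕ} {z w : ℂ} (h : z ^ n ≠ w ^ n) {i : ℕ} (hi : i < n) :
    ∑ l : Fin n, rotation n l ^ (i + 1) / (z - rotation n l * w) =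
      n * (z ^ i * w ^ (n - 1 - i)) / (z ^ n - w ^ n) := by
  have hn : n ≠ 0 := by omega
  rw [sum_congr rfl fun l _ => rotation_pow_div_sub h i l, ← sum_div, sum_comm]
  congr 1
  simp only [← sum_mul, sum_rotation_pow hn]
  rw [sum_eq_single (n - 1 - i)]
  · rw [if_pos (by rw [show i + 1 + (n - 1 - i) = n by omega]),
      show n - 1 - (n - 1 - i) = i by omega]
    ring
  · intro q hq hqi
    rw [if_neg, zero_mul]
    intro hdvd
    have hq' := mem_range.1 hq
    have := Nat.eq_of_dvd_of_lt_two_mul (by omega) hdvd (by omega)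
    omega
  · exact fun h => absurd (mem_range.2 (by omega)) h

lemma sum_one_div_sub_rotation_mul {n : ℕ} (hn : n ≠ 0) {z w : ℂ} (h : z ^ n ≠ w ^ n) :
    ∑ l : Fin n, 1 / (z - rotation n l * w) = n * z ^ (n - 1) / (z ^ n - w ^ n) := by
  have hsum := sum_rotation_pow_div_sub h (i := n - 1) (by omega)
  rw [Nat.sub_add_cancel (Nat.one_le_iff_ne_zero.2 hn)] at hsum
  simpa [rotation_pow] using hsum

end RootsOfUnity

section DunklMonomials

lemma mul_coeff_X_mul_binomialPow (a z : ℂ) (m : ℕ) :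
    a * coeff m (X * binomialPow (a + 1) (C z * X)) =
      rising a m / m.factorial * (m * z ^ (m - 1)) := by
  cases m with
  | zero => simp
  | succ m =>
    have hm : (m + 1 : ℂ) ≠ 0 := Nat.cast_add_one_ne_zero m
    have hfact := Nat.cast_ne_zero (R := ℂ).2 m.factorial_ne_zero
    rw [coeff_succ_X_mul, coeff_binomialPow_C_mul_X, rising_succ_left, Nat.factorial_succ]
    push_cast
    field_simp

lemma hasDerivAt_coeff_binomialPow (a : ℂ) (m : ℕ) {z : ℝ → ℂ} {z' : ℂ} {t : ℝ}
    (hz : HasDerivAt z z' t) :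
    HasDerivAt (fun s => coeff m (binomialPow a (C (z s) * X)))
      (a * coeff m (X * binomialPow (a + 1) (C (z t) * X)) * z') t := by
  rw [mul_coeff_X_mul_binomialPow]
  simp only [coeff_binomialPow_C_mul_X]
  exact ((hz.fun_pow m).const_mul (rising a m / m.factorial)).congr_deriv (by ring)

lemma hasDerivAt_heisenberg (a b : ℂ) (j : ℕ) {z w : ℝ → ℂ} {z' w' : ℂ} {t : ℝ}
    (hz : HasDerivAt z z' t) (hw : HasDerivAt w w' t) :
    HasDerivAt (fun s => heisenberg a b (z s) (w s) j)
      (heisenbergDerivFst a b (z t) (w t) j * z' +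
        heisenbergDerivSnd a b (z t) (w t) j * w') t := by
  have hsum := HasDerivAt.fun_sum fun p (_ : p ∈ antidiagonal j) =>
    (hasDerivAt_coeff_binomialPow a p.1 hz).mul (hasDerivAt_coeff_binomialPow b p.2 hw)
  simp only [heisenberg, heisenbergSeries, coeff_mul j (binomialPow a _)]
  refine hsum.congr_deriv ?_
  rw [heisenbergDerivFst, heisenbergDerivSnd, heisenbergSeries, heisenbergSeries, ← mul_assoc,
    mul_left_comm X, coeff_mul, coeff_mul, sum_add_distrib, mul_sum, mul_sum, sum_mul, sum_mul]
  congr 1 <;> exact sum_congr rfl fun p _ => by ring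

lemma ofReal_rising (a : ℝ) (m : ℕ) : ((rising a m : ℝ) : ℂ) = rising (a : ℂ) m := by
  induction m with
  | zero => simp
  | succ m ih => rw [rising_succ, rising_succ, ← ih]; push_cast; rfl

lemma conj_rising (a : ℝ) (m : ℕ) : conj (rising (a : ℂ) m) = rising (a : ℂ) m := by
  rw [← ofReal_rising, Complex.conj_ofReal]

lemma conj_heisenberg (a b : ℝ) (z w : ℂ) (j : ℕ) :
    conj (heisenberg (a : ℂ) b z w j) = heisenberg (a : ℂ) b (conj z) (conj w) j := by
  simp [heisenberg, coeff_heisenbergSeries, conj_rising]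

/-- The polynomial `x ^ r * heisenberg (k + 1) k (x ^ n) (conj x ^ n) j`, annihilated by the
conjugate complex Dunkl operator for `r < n`. -/
def heisenbergMonomial (n : ℕ) (k : ℝ) (r j : ℕ) (x : ℂ) : ℂ :=
  x ^ r * heisenberg (k + 1 : ℂ) k (x ^ n) (conj x ^ n) j

lemma conj_heisenbergMonomial (n : ℕ) (k : ℝ) (r j : ℕ) (x : ℂ) :
    conj (heisenbergMonomial n k r j x) =
      conj x ^ r * heisenberg (k + 1 : ℂ) k (conj x ^ n) (x ^ n) j := by
  have h := conj_heisenberg (k + 1) k (x ^ n) (conj x ^ n) j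
  push_cast at h
  simp [heisenbergMonomial, h]

lemma heisenbergMonomial_rotation_mul_conj (n : ℕ) (k : ℝ) (r j : ℕ) (x : ℂ) (l : Fin n) :
    heisenbergMonomial n k r j (rotation n l * conj x) =
      rotation n l ^ r * conj (heisenbergMonomial n k r j x) := by
  have h : conj (rotation n l) ^ n = 1 := by rw [← map_pow, rotation_pow, map_one]
  rw [conj_heisenbergMonomial, heisenbergMonomial]
  simp only [map_mul, Complex.conj_conj, mul_pow, rotation_pow, h, one_mul]
  ring

lemma heisenbergMonomial_succ_left (n : ℕ) (k : ℝ) (r j : ℕ) (x : ℂ) :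
    heisenbergMonomial n k (r + 1) j x = x * heisenbergMonomial n k r j x := by
  rw [heisenbergMonomial, heisenbergMonomial, pow_succ', mul_assoc]

lemma heisenbergMonomial_zero_succ {n : ℕ} (hn : n ≠ 0) (k : ℝ) (j : ℕ) (x : ℂ) :
    (k + (j + 1)) * heisenbergMonomial n k 0 (j + 1) x =
      k * conj (heisenbergMonomial n k 0 (j + 1) x) +
        (2 * k + (j + 1)) * (x * heisenbergMonomial n k (n - 1) j x) := by
  rw [conj_heisenbergMonomial, ← heisenbergMonomial_succ_left,
    Nat.sub_add_cancel (Nat.one_le_iff_ne_zero.2 hn)]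
  simp only [heisenbergMonomial, pow_zero, one_mul]
  exact heisenberg_succ (k : ℂ) (x ^ n) (conj x ^ n) j

/-- `g` has Dunkl derivative `v` at `x` in the direction `ξ`. The quotient of root pairings
`⟪α, ξ⟫ / ⟪α, x⟫` is written as `(ξ - ω * conj ξ) / (x - ω * conj x)` for the reflection
`x ↦ ω * conj x`; the notion is meant for `x` off the mirrors. -/
def HasDunklDerivAt (n : ℕ) (k : ℝ) (g : ℂ → ℂ) (ξ x v : ℂ) : Prop :=
  HasDerivAt (fun t : ℝ => g (x + t * ξ))
    (v - k * ∑ l : Fin n, (ξ - rotation n l * conj ξ) / (x - rotation n l * conj x) *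
      (g x - g (rotation n l * conj x))) 0

lemma hasDerivAt_add_ofReal_mul (x ξ : ℂ) : HasDerivAt (fun t : ℝ => x + t * ξ) ξ 0 := by
  simpa using ((Complex.ofRealCLM.hasDerivAt (x := (0 : ℝ))).mul_const ξ).const_add x

lemma hasDerivAt_heisenbergMonomial (n : ℕ) (k : ℝ) (r j : ℕ) (x ξ : ℂ) :
    HasDerivAt (fun t : ℝ => heisenbergMonomial n k r j (x + t * ξ))
      (r * x ^ (r - 1) * ξ * heisenberg (k + 1 : ℂ) k (x ^ n) (conj x ^ n) j +
        x ^ r * (heisenbergDerivFst (k + 1 : ℂ) k (x ^ n) (conj x ^ n) j * (n * x ^ (n - 1) * ξ) +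
          heisenbergDerivSnd (k + 1 : ℂ) k (x ^ n) (conj x ^ n) j *
            (n * conj x ^ (n - 1) * conj ξ))) 0 := by
  have hx := hasDerivAt_add_ofReal_mul x ξ
  have hxc : HasDerivAt (fun t : ℝ => conj (x + t * ξ)) (conj ξ) 0 := by
    simpa using hasDerivAt_add_ofReal_mul (conj x) (conj ξ)
  have h := (hx.fun_pow r).mul
    (hasDerivAt_heisenberg (k + 1 : ℂ) k j (hx.fun_pow n) (hxc.fun_pow n))
  exact h.congr_deriv (by simp only [Complex.ofReal_zero, zero_mul, add_zero])

lemma sum_dunklDifference_heisenbergMonomial {n : ℕ} (k : ℝ) {r : ℕ} (hr : r < n) (j : ℕ) {x : ℂ}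
    (hx : x ^ n ≠ conj x ^ n) (ξ : ℂ) :
    ∑ l : Fin n, (ξ - rotation n l * conj ξ) / (x - rotation n l * conj x) *
        (heisenbergMonomial n k r j x - heisenbergMonomial n k r j (rotation n l * conj x)) =
      ξ * (heisenbergMonomial n k r j x * (n * x ^ (n - 1) / (x ^ n - conj x ^ n)) -
          conj (heisenbergMonomial n k r j x) *
            ∑ l : Fin n, rotation n l ^ r / (x - rotation n l * conj x)) -
        conj ξ * (heisenbergMonomial n k r j x *
            (n * (x ^ 0 * conj x ^ (n - 1 - 0)) / (x ^ n - conj x ^ n)) -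
          conj (heisenbergMonomial n k r j x) *
            (n * (x ^ r * conj x ^ (n - 1 - r)) / (x ^ n - conj x ^ n))) := by
  have hn : n ≠ 0 := by omega
  rw [← sum_one_div_sub_rotation_mul hn hx, ← sum_rotation_pow_div_sub hx (i := 0) (by omega),
    ← sum_rotation_pow_div_sub hx hr]
  simp only [mul_sum, ← sum_sub_distrib]
  exact sum_congr rfl fun l _ => by rw [heisenbergMonomial_rotation_mul_conj]; ring

lemma hasDunklDerivAt_heisenbergMonomial {n : ℕ} (k : ℝ) {r : ℕ} (hr : r < n) (j : ℕ) {x : ℂ}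
    (hx : x ^ n ≠ conj x ^ n) (ξ : ℂ) :
    HasDunklDerivAt n k (heisenbergMonomial n k r j) ξ x
      (ξ * (r * x ^ (r - 1) * heisenberg (k + 1 : ℂ) k (x ^ n) (conj x ^ n) j +
        n * x ^ (n - 1) * x ^ r * heisenbergDerivFst (k + 1 : ℂ) k (x ^ n) (conj x ^ n) j +
        k * (heisenbergMonomial n k r j x * (n * x ^ (n - 1) / (x ^ n - conj x ^ n)) -
          conj (heisenbergMonomial n k r j x) *
            ∑ l : Fin n, rotation n l ^ r / (x - rotation n l * conj x)))) := by
  refine (hasDerivAt_heisenbergMonomial n k r j x ξ).congr_deriv ?_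
  rw [sum_dunklDifference_heisenbergMonomial k hr j hx]
  have hd : x ^ n - conj x ^ n ≠ 0 := sub_ne_zero.2 hx
  -- The coefficient of `conj ξ` vanishes.
  have hconj : (n : ℂ) * conj x ^ (n - 1) * x ^ r *
        heisenbergDerivSnd (k + 1 : ℂ) k (x ^ n) (conj x ^ n) j =
      k * (heisenbergMonomial n k r j x *
          (n * (x ^ 0 * conj x ^ (n - 1 - 0)) / (x ^ n - conj x ^ n)) -
        conj (heisenbergMonomial n k r j x) *
          (n * (x ^ r * conj x ^ (n - 1 - r)) / (x ^ n - conj x ^ n))) := by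
    have hpow : conj x ^ (n - 1) = conj x ^ r * conj x ^ (n - 1 - r) := by
      rw [← pow_add]
      congr 1
      omega
    rw [conj_heisenbergMonomial, heisenbergMonomial, Nat.sub_zero, hpow]
    field_simp
    linear_combination n * conj x ^ r * conj x ^ (n - 1 - r) * x ^ r *
      sub_mul_heisenbergDerivSnd (k : ℂ) (x ^ n) (conj x ^ n) j
  linear_combination conj ξ * hconj

lemma hasDunklDerivAt_heisenbergMonomial_zero_succ {n : ℕ} (hn : n ≠ 0) (k : ℝ)
    (j : ℕ) {x : ℂ} (hx : x ^ n ≠ conj x ^ n) (ξ : ℂ) :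
    HasDunklDerivAt n k (heisenbergMonomial n k 0 (j + 1)) ξ x
      (ξ * ((2 * k + (j + 1)) * n * heisenbergMonomial n k (n - 1) j x)) := by
  convert hasDunklDerivAt_heisenbergMonomial k (Nat.pos_of_ne_zero hn) (j + 1) hx ξ using 2
  have hd : x ^ n - conj x ^ n ≠ 0 := sub_ne_zero.2 hx
  have hadd := heisenbergDerivFst_add_heisenbergDerivSnd_succ (k + 1 : ℂ) k (x ^ n) (conj x ^ n) j
  have hsub := sub_mul_heisenbergDerivSnd (k : ℂ) (x ^ n) (conj x ^ n) (j + 1)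
  rw [conj_heisenbergMonomial, heisenbergMonomial, heisenbergMonomial]
  simp only [pow_zero, one_mul, Nat.cast_zero, zero_mul, zero_add, mul_one]
  rw [sum_one_div_sub_rotation_mul hn hx]
  field_simp
  linear_combination x ^ (n - 1) * (-(x ^ n - conj x ^ n) * hadd + hsub)

lemma hasDunklDerivAt_heisenbergMonomial_succ_left {n : ℕ} (k : ℝ) {r : ℕ} (hr : r + 1 < n)
    (j : ℕ) {x : ℂ} (hx : x ^ n ≠ conj x ^ n) (ξ : ℂ) :
    HasDunklDerivAt n k (heisenbergMonomial n k (r + 1) j) ξ x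
      (ξ * ((n * j + (r + 1) + n * k) * heisenbergMonomial n k r j x)) := by
  convert hasDunklDerivAt_heisenbergMonomial k hr j hx ξ using 2
  have hd : x ^ n - conj x ^ n ≠ 0 := sub_ne_zero.2 hx
  have hsub := sub_mul_heisenbergDerivSnd (k : ℂ) (x ^ n) (conj x ^ n) j
  have heuler := heisenberg_euler (k + 1 : ℂ) k (x ^ n) (conj x ^ n) j
  have hxpow : x ^ (n - 1) * x ^ (r + 1) = x ^ n * x ^ r := by
    rw [← pow_add, ← pow_add]
    congr 1
    omega
  have hcpow : conj x ^ (r + 1) * conj x ^ (n - 1 - r) = conj x ^ n := by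
    rw [← pow_add]
    congr 1
    omega
  rw [conj_heisenbergMonomial, heisenbergMonomial, heisenbergMonomial,
    sum_rotation_pow_div_sub hx (by omega)]
  have hdiff : x ^ (r + 1) * heisenberg (k + 1 : ℂ) k (x ^ n) (conj x ^ n) j *
        (n * x ^ (n - 1) / (x ^ n - conj x ^ n)) -
      conj x ^ (r + 1) * heisenberg (k + 1 : ℂ) k (conj x ^ n) (x ^ n) j *
        (n * (x ^ r * conj x ^ (n - 1 - r)) / (x ^ n - conj x ^ n)) =
      n * x ^ r * (x ^ n * heisenberg (k + 1 : ℂ) k (x ^ n) (conj x ^ n) j -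
        conj x ^ n * heisenberg (k + 1 : ℂ) k (conj x ^ n) (x ^ n) j) / (x ^ n - conj x ^ n) := by
    linear_combination n * heisenberg (k + 1 : ℂ) k (x ^ n) (conj x ^ n) j /
        (x ^ n - conj x ^ n) * hxpow -
      n * heisenberg (k + 1 : ℂ) k (conj x ^ n) (x ^ n) j * x ^ r / (x ^ n - conj x ^ n) * hcpow
  rw [hdiff, mul_assoc (n : ℂ) (x ^ (n - 1)), hxpow, Nat.add_sub_cancel]
  push_cast
  field_simp
  linear_combination x ^ r * n * (-(x ^ n - conj x ^ n) * heuler + conj x ^ n * hsub)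

/-- The homogeneous polynomial of degree `m` annihilated by the conjugate complex Dunkl operator. -/
def dunklMonomial (n : ℕ) (k : ℝ) (m : ℕ) : ℂ → ℂ := heisenbergMonomial n k (m % n) (m / n)

lemma dunklMonomial_zero (n : ℕ) (k : ℝ) (x : ℂ) : dunklMonomial n k 0 x = 1 := by
  simp [dunklMonomial, heisenbergMonomial, heisenberg_zero]

/-- The coefficient of `conj (dunklMonomial n k m)` in the recursion for `dunklMonomial n k m`. -/
def conjCoeff (n : ℕ) (k : ℝ) (m : ℕ) : ℝ := if n ∣ m then k / (k + (m / n : ℕ)) else 0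

/-- The coefficient of `x * dunklMonomial n k (m - 1)` in the recursion for
`dunklMonomial n k m`. -/
def predCoeff (n : ℕ) (k : ℝ) (m : ℕ) : ℝ :=
  if n ∣ m then (2 * k + (m / n : ℕ)) / (k + (m / n : ℕ)) else 1

lemma predCoeff_pos (n : ℕ) {k : ℝ} (hk : 0 < k) (m : ℕ) : 0 < predCoeff n k m := by
  rw [predCoeff]
  split_ifs <;> positivity

lemma conjCoeff_zero (n : ℕ) {k : ℝ} (hk : 0 < k) : conjCoeff n k 0 = 1 := by
  simp [conjCoeff, hk.ne']

lemma exists_succ_eq_mul_succ_of_dvd {n m : ℕ} (h : n ∣ m + 1) :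
    ∃ j, m + 1 = n * (j + 1) ∧ (m + 1) % n = 0 ∧ (m + 1) / n = j + 1 ∧ m % n = n - 1 ∧
      m / n = j := by
  obtain ⟨_ | j, hj⟩ := h
  · omega
  have hn : 0 < n := Nat.pos_of_ne_zero (by rintro rfl; omega)
  have hm : m = n - 1 + n * j := by rw [mul_add] at hj; omega
  refine ⟨j, hj, by rw [hj, Nat.mul_mod_right], by rw [hj, Nat.mul_div_cancel_left _ hn], ?_, ?_⟩
  · rw [hm, Nat.add_mul_mod_self_left, Nat.mod_eq_of_lt (by omega)]
  · rw [hm, Nat.add_mul_div_left _ _ hn, Nat.div_eq_of_lt (by omega), zero_add]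

lemma succ_mod_of_not_dvd {n m : ℕ} (h : ¬ n ∣ m + 1) : (m + 1) % n = m % n + 1 := by
  have hdiv := Nat.div_add_mod (m + 1) n
  rw [Nat.succ_div_of_not_dvd h] at hdiv
  have := Nat.div_add_mod m n
  omega

lemma dunklMonomial_succ {n : ℕ} (hn : n ≠ 0) {k : ℝ} (hk : 0 < k) (m : ℕ) (x : ℂ) :
    dunklMonomial n k (m + 1) x = conjCoeff n k (m + 1) * conj (dunklMonomial n k (m + 1) x) +
      predCoeff n k (m + 1) * (x * dunklMonomial n k m x) := by
  rw [conjCoeff, predCoeff, dunklMonomial, dunklMonomial]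
  split_ifs with h
  · obtain ⟨j, -, hmod, hdiv, hmod', hdiv'⟩ := exists_succ_eq_mul_succ_of_dvd h
    have hkj : (k : ℂ) + (j + 1) ≠ 0 := by
      have : 0 < k + (j + 1) := by positivity
      exact_mod_cast this.ne'
    rw [hmod, hdiv, hmod', hdiv']
    push_cast
    field_simp
    linear_combination heisenbergMonomial_zero_succ hn k j x
  · rw [succ_mod_of_not_dvd h, Nat.succ_div_of_not_dvd h, heisenbergMonomial_succ_left]
    simp

lemma dunklMonomial_rotation_mul_conj (n : ℕ) (k : ℝ) (m : ℕ) (x : ℂ) (l : Fin n) :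
    dunklMonomial n k m (rotation n l * conj x) =
      rotation n l ^ (m % n) * conj (dunklMonomial n k m x) :=
  heisenbergMonomial_rotation_mul_conj n k _ _ x l

lemma hasDunklDerivAt_dunklMonomial_zero (n : ℕ) (k : ℝ) (ξ x : ℂ) :
    HasDunklDerivAt n k (dunklMonomial n k 0) ξ x 0 := by
  have hone : dunklMonomial n k 0 = fun _ => 1 := funext (dunklMonomial_zero n k)
  rw [HasDunklDerivAt, hone]
  simpa using hasDerivAt_const (0 : ℝ) (1 : ℂ)

theorem hasDunklDerivAt_dunklMonomial_succ {n : ℕ} (hn : n ≠ 0) {k : ℝ} (hk : 0 < k) (m : ℕ)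
    {x : ℂ} (hx : x ^ n ≠ conj x ^ n) (ξ : ℂ) :
    HasDunklDerivAt n k (dunklMonomial n k (m + 1)) ξ x
      (ξ * (predCoeff n k (m + 1) * (m + 1 + n * k) * dunklMonomial n k m x)) := by
  rw [predCoeff, dunklMonomial, dunklMonomial]
  split_ifs with h
  · obtain ⟨j, hm, hmod, hdiv, hmod', hdiv'⟩ := exists_succ_eq_mul_succ_of_dvd h
    have hkj : (k : ℂ) + (j + 1) ≠ 0 := by
      have : 0 < k + (j + 1) := by positivity
      exact_mod_cast this.ne'
    have hm' : (m : ℂ) + 1 = n * (j + 1) := by exact_mod_cast hm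
    rw [hmod, hdiv, hmod', hdiv']
    convert hasDunklDerivAt_heisenbergMonomial_zero_succ hn k j hx ξ using 3
    rw [hm']
    push_cast
    field_simp
    ring
  · have hmod := succ_mod_of_not_dvd h
    have hlt := Nat.mod_lt (m + 1) (Nat.pos_of_ne_zero hn)
    have hm : (m : ℂ) = n * (m / n : ℕ) + (m % n : ℕ) := by
      exact_mod_cast (Nat.div_add_mod m n).symm
    rw [hmod, Nat.succ_div_of_not_dvd h]
    convert hasDunklDerivAt_heisenbergMonomial_succ_left k (hmod ▸ hlt) (m / n) hx ξ using 3
    push_cast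
    linear_combination hm

end DunklMonomials

section DunklCalculus

variable {n : ℕ} {k : ℝ} {g h : ℂ → ℂ} {ξ x v w : ℂ}

lemma HasDunklDerivAt.congr_deriv (hg : HasDunklDerivAt n k g ξ x v) (h : v = w) :
    HasDunklDerivAt n k g ξ x w := h ▸ hg

lemma HasDunklDerivAt.const_mul (hg : HasDunklDerivAt n k g ξ x v) (c : ℂ) :
    HasDunklDerivAt n k (fun x => c * g x) ξ x (c * v) := by
  refine (HasDerivAt.const_mul c hg).congr_deriv ?_
  rw [mul_sub, mul_left_comm c, mul_sum]
  congr 2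
  exact sum_congr rfl fun l _ => by ring

lemma HasDunklDerivAt.add (hg : HasDunklDerivAt n k g ξ x v) (hh : HasDunklDerivAt n k h ξ x w) :
    HasDunklDerivAt n k (fun x => g x + h x) ξ x (v + w) := by
  refine (HasDerivAt.fun_add hg hh).congr_deriv ?_
  rw [sub_add_sub_comm, ← mul_add, ← sum_add_distrib]
  congr 2
  exact sum_congr rfl fun l _ => by ring

lemma HasDunklDerivAt.sum {ι : Type*} {s : Finset ι} {g : ι → ℂ → ℂ} {v : ι → ℂ}
    (hg : ∀ i ∈ s, HasDunklDerivAt n k (g i) ξ x (v i)) :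
    HasDunklDerivAt n k (fun x => ∑ i ∈ s, g i x) ξ x (∑ i ∈ s, v i) := by
  refine (HasDerivAt.fun_sum hg).congr_deriv ?_
  rw [sum_sub_distrib, ← mul_sum, sum_comm]
  congr 2
  refine sum_congr rfl fun l _ => ?_
  rw [← mul_sum, sum_sub_distrib]

lemma conj_sub_rotation_mul (l : Fin n) (ξ : ℂ) :
    conj ξ - conj (rotation n l) * ξ = -conj (rotation n l) * (ξ - rotation n l * conj ξ) := by
  linear_combination (-conj ξ) * rotation_mul_conj n l

lemma HasDunklDerivAt.conj (hg : HasDunklDerivAt n k g ξ x v) :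
    HasDunklDerivAt n k (fun x => conj (g x)) ξ x (conj v) := by
  have hconj := (Complex.conjCLE.toContinuousLinearMap.hasFDerivAt
    (x := g (x + ((0 : ℝ) : ℂ) * ξ))).comp_hasDerivAt (0 : ℝ) hg
  refine hconj.congr_deriv ?_
  simp only [ContinuousLinearEquiv.coe_coe, Complex.conjCLE_apply, map_sub, map_mul, map_sum,
    Complex.conj_ofReal, map_div₀, Complex.conj_conj]
  congr 2
  refine sum_congr rfl fun l _ => ?_
  have hne : -(starRingEnd ℂ) (rotation n l) ≠ 0 :=
    neg_ne_zero.2 ((map_ne_zero (starRingEnd ℂ)).2 (rotation_ne_zero n l))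
  rw [conj_sub_rotation_mul, conj_sub_rotation_mul, mul_div_mul_left _ _ hne]

lemma hasDerivAt_mul_conj_pow (x ξ : ℂ) (i : ℕ) :
    HasDerivAt (fun t : ℝ => ((x + t * ξ) * (starRingEnd ℂ) (x + t * ξ)) ^ i)
      (i * (x * (starRingEnd ℂ) x) ^ (i - 1) *
        (ξ * (starRingEnd ℂ) x + x * (starRingEnd ℂ) ξ)) 0 := by
  have hxc : HasDerivAt (fun t : ℝ => (starRingEnd ℂ) (x + t * ξ)) ((starRingEnd ℂ) ξ) 0 := by
    simpa using hasDerivAt_add_ofReal_mul ((starRingEnd ℂ) x) ((starRingEnd ℂ) ξ)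
  have h := ((hasDerivAt_add_ofReal_mul x ξ).fun_mul hxc).fun_pow i
  exact h.congr_deriv (by simp only [Complex.ofReal_zero, zero_mul, add_zero])

lemma HasDunklDerivAt.mul_conj_pow_mul (hg : HasDunklDerivAt n k g ξ x v) (i : ℕ) :
    HasDunklDerivAt n k (fun x => (x * (starRingEnd ℂ) x) ^ i * g x) ξ x
      ((x * (starRingEnd ℂ) x) ^ i * v + i * (x * (starRingEnd ℂ) x) ^ (i - 1) *
        (ξ * (starRingEnd ℂ) x + x * (starRingEnd ℂ) ξ) * g x) := by
  refine ((hasDerivAt_mul_conj_pow x ξ i).fun_mul hg).congr_deriv ?_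
  have hinv (l : Fin n) : rotation n l * (starRingEnd ℂ) x *
      (starRingEnd ℂ) (rotation n l * (starRingEnd ℂ) x) = x * (starRingEnd ℂ) x := by
    rw [map_mul, Complex.conj_conj]
    linear_combination (x * (starRingEnd ℂ) x) * rotation_mul_conj n l
  simp only [hinv, ← mul_sub, Complex.ofReal_zero, zero_mul, add_zero,
    mul_left_comm _ ((x * (starRingEnd ℂ) x) ^ i)]
  rw [← mul_sum]
  ring

end DunklCalculus

section KernelComponents

/-- The coefficient of `dunklMonomial n k m` in the Dunkl kernel with spectral variable `y`. -/
def spectralCoeff (n : ℕ) (k : ℝ) (y : ℂ) : ℕ → ℂ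
  | 0 => 1 / 2
  | m + 1 => conj y / 2 * (spectralCoeff n k y m + conjCoeff n k m * conj (spectralCoeff n k y m)) /
      predCoeff n k (m + 1)

/-- The combination of `spectralCoeff` and its conjugate that drives its recursion. -/
def twistedSpectralCoeff (n : ℕ) (k : ℝ) (y : ℂ) (m : ℕ) : ℂ :=
  spectralCoeff n k y m + conjCoeff n k m * conj (spectralCoeff n k y m)

/-- The coefficient of `|x| ^ (2 * i)` in the radial Bessel series that accompanies
`dunklMonomial n k m` in the Dunkl kernel. -/
def radialCoeff (n : ℕ) (k : ℝ) (y : ℂ) (m i : ℕ) : ℝ :=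
  (Complex.normSq y / 4) ^ i / (i.factorial * rising (n * k + 1) (m + i))

lemma rising_pos {a : ℝ} (ha : 0 < a) (j : ℕ) : 0 < rising a j := by
  induction j with
  | zero => simp
  | succ j ih => rw [rising_succ]; positivity

lemma predCoeff_mul_spectralCoeff_succ (n : ℕ) {k : ℝ} (hk : 0 < k) (y : ℂ) (m : ℕ) :
    predCoeff n k (m + 1) * spectralCoeff n k y (m + 1) =
      conj y / 2 * twistedSpectralCoeff n k y m := by
  have hpred : (predCoeff n k (m + 1) : ℂ) ≠ 0 := by exact_mod_cast (predCoeff_pos n hk _).ne'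
  rw [spectralCoeff, twistedSpectralCoeff, mul_div_cancel₀ _ hpred]

lemma conj_twistedSpectralCoeff (n : ℕ) (k : ℝ) (y : ℂ) (m : ℕ) :
    conj (twistedSpectralCoeff n k y m) =
      conj (spectralCoeff n k y m) + conjCoeff n k m * spectralCoeff n k y m := by
  simp [twistedSpectralCoeff]

lemma radialCoeff_succ_left (n : ℕ) {k : ℝ} (hk : 0 < k) (y : ℂ) (m i : ℕ) :
    radialCoeff n k y (m + 1) i * (m + 1 + n * k + i) = radialCoeff n k y m i := by
  have hrising := (rising_pos (show 0 < n * k + 1 by positivity) (m + i)).ne'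
  have hne : (n * k + 1 + ((m + i : ℕ) : ℝ)) ≠ 0 := by positivity
  rw [radialCoeff, radialCoeff, show m + 1 + i = (m + i) + 1 by ring, rising_succ]
  push_cast at hne ⊢
  field_simp
  ring

lemma radialCoeff_succ_right (n : ℕ) (k : ℝ) (y : ℂ) (m i : ℕ) :
    radialCoeff n k y m (i + 1) * (i + 1) =
      Complex.normSq y / 4 * radialCoeff n k y (m + 1) i := by
  rw [radialCoeff, radialCoeff, show m + 1 + i = m + (i + 1) by ring, Nat.factorial_succ, pow_succ]
  push_cast
  field_simp

/-- The summand of bidegree `(m, i)` of the Dunkl kernel, homogeneous of degree `m + 2 * i`. -/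
def kernelTerm (n : ℕ) (k : ℝ) (y : ℂ) (m i : ℕ) (x : ℂ) : ℂ :=
  radialCoeff n k y m i * ((x * conj x) ^ i * (spectralCoeff n k y m * dunklMonomial n k m x +
    conj (spectralCoeff n k y m * dunklMonomial n k m x)))

lemma conj_kernelTerm (n : ℕ) (k : ℝ) (y : ℂ) (m i : ℕ) (x : ℂ) :
    conj (kernelTerm n k y m i x) = kernelTerm n k y m i x := by
  simp only [kernelTerm, map_mul, map_add, map_pow, Complex.conj_conj, Complex.conj_ofReal]
  ring

/-- The part of the complex Dunkl derivative of `kernelTerm n k y m i` that involves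
`dunklMonomial n k (m - 1)`. -/
def kernelTermLower (n : ℕ) (k : ℝ) (y : ℂ) (m i : ℕ) (x : ℂ) : ℂ :=
  match m with
  | 0 => 0
  | m + 1 => radialCoeff n k y m i *
      ((x * conj x) ^ i * (conj y / 2 * twistedSpectralCoeff n k y m * dunklMonomial n k m x))

/-- The part of the complex Dunkl derivative of `kernelTerm n k y m i` that involves
`conj (dunklMonomial n k m)`. -/
def kernelTermUpper (n : ℕ) (k : ℝ) (y : ℂ) (m i : ℕ) (x : ℂ) : ℂ :=
  match i with
  | 0 => 0
  | i + 1 => (Complex.normSq y / 4 * radialCoeff n k y (m + 1) i : ℝ) * ((x * conj x) ^ i *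
      (conj x * conj (twistedSpectralCoeff n k y m * dunklMonomial n k m x)))

lemma radialCoeff_mul_eq_kernelTermUpper (n : ℕ) (k : ℝ) (y : ℂ) (m i : ℕ) (x : ℂ) :
    (radialCoeff n k y m i : ℂ) * (i * (x * conj x) ^ (i - 1) *
        (conj x * conj (twistedSpectralCoeff n k y m * dunklMonomial n k m x))) =
      kernelTermUpper n k y m i x := by
  cases i with
  | zero => simp [kernelTermUpper]
  | succ i =>
    rw [kernelTermUpper, ← radialCoeff_succ_right, Nat.add_sub_cancel]
    push_cast
    ring

lemma hasDunklDerivAt_kernelTerm_of_dunklMonomial {n : ℕ} {k : ℝ} (y : ℂ) {m : ℕ} (i : ℕ)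
    {ξ x q : ℂ} (hq : HasDunklDerivAt n k (dunklMonomial n k m) ξ x (ξ * q)) :
    let v := radialCoeff n k y m i * ((x * conj x) ^ i * (spectralCoeff n k y m * q) +
      i * (x * conj x) ^ (i - 1) * (conj x * (spectralCoeff n k y m * dunklMonomial n k m x +
        conj (spectralCoeff n k y m * dunklMonomial n k m x))))
    HasDunklDerivAt n k (kernelTerm n k y m i) ξ x (ξ * v + conj (ξ * v)) := by
  have hs := hq.const_mul (spectralCoeff n k y m)
  have h := ((hs.add hs.conj).mul_conj_pow_mul i).const_mul (radialCoeff n k y m i : ℂ)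
  refine HasDunklDerivAt.congr_deriv (g := kernelTerm n k y m i) h ?_
  simp only [map_mul, map_add, map_pow, Complex.conj_conj, Complex.conj_ofReal, map_natCast]
  ring

lemma hasDunklDerivAt_kernelTerm {n : ℕ} (hn : n ≠ 0) {k : ℝ} (hk : 0 < k) (y : ℂ) (m i : ℕ)
    {x : ℂ} (hx : x ^ n ≠ conj x ^ n) (ξ : ℂ) :
    HasDunklDerivAt n k (kernelTerm n k y m i) ξ x
      (ξ * (kernelTermLower n k y m i x + kernelTermUpper n k y m i x) +
        conj (ξ * (kernelTermLower n k y m i x + kernelTermUpper n k y m i x))) := by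
  rw [← radialCoeff_mul_eq_kernelTermUpper, map_mul conj (twistedSpectralCoeff n k y m),
    conj_twistedSpectralCoeff]
  cases m with
  | zero =>
    have hzero := hasDunklDerivAt_dunklMonomial_zero n k ξ x
    rw [← mul_zero ξ] at hzero
    convert hasDunklDerivAt_kernelTerm_of_dunklMonomial y i hzero using 3 <;>
    · simp only [kernelTermLower, conjCoeff_zero n hk, dunklMonomial_zero, map_one, map_mul,
        Complex.ofReal_one]
      ring
  | succ m =>
    have hradial : (radialCoeff n k y (m + 1) i : ℂ) * (m + 1 + n * k + i) =
        radialCoeff n k y m i := by exact_mod_cast radialCoeff_succ_left n hk y m i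
    have hpow : (i : ℂ) * (x * conj x) ^ (i - 1) * (x * conj x) = i * (x * conj x) ^ i := by
      cases i with
      | zero => simp
      | succ i => rw [Nat.add_sub_cancel, pow_succ, mul_assoc]
    have hvalue := hasDunklDerivAt_kernelTerm_of_dunklMonomial y i
      (hasDunklDerivAt_dunklMonomial_succ hn hk m hx ξ)
    convert hvalue using 3 <;> congr 1 <;>
    · rw [kernelTermLower, ← predCoeff_mul_spectralCoeff_succ n hk, ← hradial, map_mul]
      linear_combination (-(radialCoeff n k y (m + 1) i * i * (x * conj x) ^ (i - 1) * conj x *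
          spectralCoeff n k y (m + 1))) * dunklMonomial_succ hn hk m x -
        radialCoeff n k y (m + 1) i * spectralCoeff n k y (m + 1) * predCoeff n k (m + 1) *
          dunklMonomial n k m x * hpow

lemma kernelTermLower_add_kernelTermUpper {n : ℕ} (hn : n ≠ 0) {k : ℝ} (hk : 0 < k) (y : ℂ)
    (m i : ℕ) (x : ℂ) :
    kernelTermLower n k y (m + 2) i x + kernelTermUpper n k y m (i + 1) x =
      conj y / 2 * kernelTerm n k y (m + 1) i x := by
  have hmono := congrArg conj (dunklMonomial_succ hn hk m x)
  have hspec := congrArg conj (predCoeff_mul_spectralCoeff_succ n hk y m)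
  simp only [twistedSpectralCoeff, map_mul, map_add, Complex.conj_conj, Complex.conj_ofReal,
    map_div₀, map_ofNat] at hmono hspec
  simp only [kernelTermLower, kernelTermUpper, kernelTerm, twistedSpectralCoeff, map_mul, map_add,
    Complex.conj_conj, Complex.conj_ofReal]
  push_cast [← Complex.mul_conj]
  linear_combination
    (-(radialCoeff n k y (m + 1) i * (x * conj x) ^ i * conj x * conj y / 2 *
      conj (dunklMonomial n k m x))) * hspec -
    (radialCoeff n k y (m + 1) i * (x * conj x) ^ i * conj y / 2 *
      conj (spectralCoeff n k y (m + 1))) * hmono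

lemma kernelTermLower_one (n : ℕ) {k : ℝ} (hk : 0 < k) (y : ℂ) (i : ℕ) (x : ℂ) :
    kernelTermLower n k y 1 i x = conj y / 2 * kernelTerm n k y 0 i x := by
  simp only [kernelTermLower, kernelTerm, twistedSpectralCoeff, conjCoeff_zero n hk, map_mul,
    dunklMonomial_zero, map_one, Complex.ofReal_one]
  ring

/-- The homogeneous component of degree `N` of the Dunkl kernel with spectral variable `y`. -/
def kernelComponent (n : ℕ) (k : ℝ) (y : ℂ) (N : ℕ) (x : ℂ) : ℂ :=
  ∑ i ∈ range (N / 2 + 1), kernelTerm n k y (N - 2 * i) i x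

lemma conj_kernelComponent (n : ℕ) (k : ℝ) (y : ℂ) (N : ℕ) (x : ℂ) :
    conj (kernelComponent n k y N x) = kernelComponent n k y N x := by
  simp only [kernelComponent, map_sum, conj_kernelTerm]

lemma kernelComponent_zero (n : ℕ) (k : ℝ) (y x : ℂ) : kernelComponent n k y 0 x = 1 := by
  norm_num [kernelComponent, kernelTerm, radialCoeff, spectralCoeff, dunklMonomial_zero, map_ofNat]

lemma sum_kernelTermLower_add_kernelTermUpper {n : ℕ} (hn : n ≠ 0) {k : ℝ} (hk : 0 < k) (y : ℂ)
    (N : ℕ) (x : ℂ) :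
    ∑ i ∈ range ((N + 1) / 2 + 1),
        (kernelTermLower n k y (N + 1 - 2 * i) i x + kernelTermUpper n k y (N + 1 - 2 * i) i x) =
      conj y / 2 * kernelComponent n k y N x := by
  rw [sum_add_distrib, kernelComponent, mul_sum,
    sum_range_succ' (fun i => kernelTermUpper n k y (N + 1 - 2 * i) i x), kernelTermUpper, add_zero]
  rcases Nat.even_or_odd' N with ⟨M, rfl | rfl⟩
  · rw [show (2 * M + 1) / 2 = M by omega, show 2 * M / 2 = M by omega, sum_range_succ,
      sum_range_succ, add_right_comm, ← sum_add_distrib]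
    congr 1
    · refine sum_congr rfl fun i hi => ?_
      have hi' := mem_range.1 hi
      rw [show 2 * M + 1 - 2 * i = (2 * M - 2 * i - 1) + 2 by omega,
        show 2 * M + 1 - 2 * (i + 1) = 2 * M - 2 * i - 1 by omega,
        kernelTermLower_add_kernelTermUpper hn hk,
        show 2 * M - 2 * i - 1 + 1 = 2 * M - 2 * i by omega]
    · rw [show 2 * M + 1 - 2 * M = 1 by omega, Nat.sub_self, kernelTermLower_one n hk]
  · rw [show (2 * M + 1 + 1) / 2 = M + 1 by omega, show (2 * M + 1) / 2 = M by omega,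
      sum_range_succ, show 2 * M + 1 + 1 - 2 * (M + 1) = 0 by omega, kernelTermLower, add_zero,
      ← sum_add_distrib]
    refine sum_congr rfl fun i hi => ?_
    have hi' := mem_range.1 hi
    rw [show 2 * M + 1 + 1 - 2 * i = (2 * M - 2 * i) + 2 by omega,
      show 2 * M + 1 + 1 - 2 * (i + 1) = 2 * M - 2 * i by omega,
      kernelTermLower_add_kernelTermUpper hn hk,
      show 2 * M - 2 * i + 1 = 2 * M + 1 - 2 * i by omega]

lemma hasDunklDerivAt_kernelComponent_zero (n : ℕ) (k : ℝ) (y ξ x : ℂ) :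
    HasDunklDerivAt n k (kernelComponent n k y 0) ξ x 0 := by
  have hone : kernelComponent n k y 0 = fun _ => 1 := funext (kernelComponent_zero n k y)
  rw [HasDunklDerivAt, hone]
  simpa using hasDerivAt_const (0 : ℝ) (1 : ℂ)

theorem hasDunklDerivAt_kernelComponent_succ {n : ℕ} (hn : n ≠ 0) {k : ℝ} (hk : 0 < k) (y : ℂ)
    (N : ℕ) {x : ℂ} (hx : x ^ n ≠ conj x ^ n) (ξ : ℂ) :
    HasDunklDerivAt n k (kernelComponent n k y (N + 1)) ξ x
      ((inner ℝ ξ y : ℝ) * kernelComponent n k y N x) := by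
  have h := HasDunklDerivAt.sum (s := range ((N + 1) / 2 + 1)) fun i _ =>
    hasDunklDerivAt_kernelTerm hn hk y (N + 1 - 2 * i) i hx ξ
  refine HasDunklDerivAt.congr_deriv (g := kernelComponent n k y (N + 1)) h ?_
  rw [sum_add_distrib, ← map_sum, ← mul_sum, sum_kernelTermLower_add_kernelTermUpper hn hk, map_mul,
    map_mul, conj_kernelComponent, map_div₀, Complex.conj_conj, map_ofNat, Complex.inner,
    mul_comm y, Complex.re_eq_add_conj, map_mul, Complex.conj_conj]
  ring

end KernelComponents

section BoundedForms

variable {E F : Type*} [NormedAddCommGroup E] [NormedSpace ℝ E] [NormedAddCommGroup F]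
  [NormedSpace ℝ F]

/-- `g` is the diagonal of an `N`-linear map of norm at most `B`; such bounds control sums of
homogeneous polynomials of growing degree. -/
def IsBoundedForm (N : ℕ) (B : ℝ) (g : E → F) : Prop :=
  ∃ p : ContinuousMultilinearMap ℝ (fun _ : Fin N => E) F, ‖p‖ ≤ B ∧ ∀ x, g x = p fun _ => x

variable {N : ℕ} {B B' : ℝ} {g h : E → F}

lemma IsBoundedForm.mono (hg : IsBoundedForm N B g) (hB : B ≤ B') : IsBoundedForm N B' g := by
  obtain ⟨p, hp, hgp⟩ := hg
  exact ⟨p, hp.trans hB, hgp⟩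

lemma IsBoundedForm.add (hg : IsBoundedForm N B g) (hh : IsBoundedForm N B' h) :
    IsBoundedForm N (B + B') (fun x => g x + h x) := by
  obtain ⟨p, hp, hgp⟩ := hg
  obtain ⟨q, hq, hhq⟩ := hh
  exact ⟨p + q, norm_add_le_of_le hp hq, fun x => congrArg₂ (· + ·) (hgp x) (hhq x)⟩

lemma IsBoundedForm.sum {ι : Type*} {s : Finset ι} {g : ι → E → F} {B : ι → ℝ}
    (hg : ∀ i ∈ s, IsBoundedForm N (B i) (g i)) :
    IsBoundedForm N (∑ i ∈ s, B i) (fun x => ∑ i ∈ s, g i x) := by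
  choose! p hp hgp using hg
  refine ⟨∑ i ∈ s, p i, norm_sum_le_of_le s hp, fun x => ?_⟩
  rw [_root_.sum_apply]
  exact sum_congr rfl fun i hi => hgp i hi x

lemma IsBoundedForm.conj {g : E → ℂ} (hg : IsBoundedForm N B g) :
    IsBoundedForm N B (fun x => conj (g x)) := by
  obtain ⟨p, hp, hgp⟩ := hg
  refine ⟨Complex.conjCLE.toContinuousLinearMap.compContinuousMultilinearMap p, ?_, fun x => ?_⟩
  · exact (Complex.conjLIE.toLinearIsometry.norm_compContinuousMultilinearMap p).trans_le hp
  · simp [hgp]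

lemma IsBoundedForm.norm_le (hg : IsBoundedForm N B g) (x : E) : ‖g x‖ ≤ B * ‖x‖ ^ N := by
  obtain ⟨p, hp, hgp⟩ := hg
  rw [hgp]
  simpa using p.le_of_opNorm_le hp fun _ => x

lemma IsBoundedForm.bound_nonneg (hg : IsBoundedForm N B g) : 0 ≤ B := by
  obtain ⟨p, hp, -⟩ := hg
  exact (norm_nonneg p).trans hp

lemma isBoundedForm_const_mul_pow_mul_conj_pow (c : ℂ) (a b : ℕ) :
    IsBoundedForm (a + b) ‖c‖ (fun x : ℂ => c * (x ^ a * conj x ^ b)) := by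
  let L (i : Fin (a + b)) : ℂ →L[ℝ] ℂ :=
    Fin.append (fun _ : Fin a => .id ℝ ℂ) (fun _ : Fin b => Complex.conjCLE.toContinuousLinearMap) i
  refine ⟨c • (ContinuousMultilinearMap.mkPiAlgebra ℝ (Fin (a + b)) ℂ).compContinuousLinearMap L,
    ?_, fun x => ?_⟩
  · rw [norm_smul]
    refine mul_le_of_le_one_right (norm_nonneg c)
      (ContinuousMultilinearMap.opNorm_le_bound zero_le_one fun m => ?_)
    have hL (i : Fin (a + b)) : ‖L i (m i)‖ = ‖m i‖ := by
      refine Fin.addCases (fun i => ?_) (fun i => ?_) i <;> simp [L]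
    simp [hL]
  · simp [L, Fin.prod_univ_add]

lemma IsBoundedForm.hasDerivAt_line (hg : IsBoundedForm N B g) (x ξ : E) (t : ℝ) {R : ℝ}
    (hx : ‖x + t • ξ‖ ≤ R) :
    ∃ d, HasDerivAt (fun s : ℝ => g (x + s • ξ)) d t ∧ ‖d‖ ≤ B * (N * R ^ (N - 1) * ‖ξ‖) := by
  have hB := hg.bound_nonneg
  obtain ⟨p, hp, hgp⟩ := hg
  have hline : HasDerivAt (fun (s : ℝ) (_ : Fin N) => x + s • ξ) (fun _ => ξ) t :=
    hasDerivAt_pi.2 fun _ => by simpa using ((hasDerivAt_id t).smul_const ξ).const_add x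
  simp only [hgp]
  refine ⟨_, (p.hasFDerivAt _).comp_hasDerivAt t hline, ?_⟩
  rw [ContinuousMultilinearMap.linearDeriv_apply]
  calc _ ≤ ∑ _ : Fin N, B * (R ^ (N - 1) * ‖ξ‖) := by
        refine norm_sum_le_of_le _ fun i _ => (p.le_of_opNorm_le hp _).trans ?_
        gcongr
        rw [← mul_prod_erase univ _ (mem_univ i), Function.update_self, mul_comm]
        gcongr
        rw [prod_congr rfl fun j hj => by rw [Function.update_of_ne (ne_of_mem_erase hj)],
          prod_const, card_erase_of_mem (mem_univ i), card_univ, Fintype.card_fin]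
        gcongr
    _ = _ := by rw [sum_const, card_univ, Fintype.card_fin, nsmul_eq_mul]; ring

end BoundedForms

section BoundedFormSeries

variable {E F : Type*} [NormedAddCommGroup E] [NormedSpace ℝ E] [NormedAddCommGroup F]
  [NormedSpace ℝ F] [CompleteSpace F] {g : ℕ → E → F} {b : ℕ → ℝ}

theorem analyticOnNhd_tsum_of_isBoundedForm (hg : ∀ N, IsBoundedForm N (b N) (g N))
    (hb : ∀ R : ℝ, 0 ≤ R → Summable fun N => b N * R ^ N) :
    AnalyticOnNhd ℝ (fun x => ∑' N, g N x) Set.univ := by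
  choose p hp hgp using hg
  let q : FormalMultilinearSeries ℝ E F := p
  have hradius : q.radius = ⊤ := q.radius_eq_top_of_summable_norm fun r =>
    .of_nonneg_of_le (fun N => by positivity)
      (fun N => mul_le_mul_of_nonneg_right (hp N) (by positivity)) (hb r r.2)
  have hsum : (fun x => ∑' N, g N x) = q.sum := funext fun x => tsum_congr fun N => hgp N x
  have hq := (q.hasFPowerSeriesOnBall (by rw [hradius]; exact ENNReal.zero_lt_top)).analyticOnNhd
  rw [hradius, Metric.eball_top] at hq
  rwa [hsum]

lemma summable_of_isBoundedForm (hg : ∀ N, IsBoundedForm N (b N) (g N))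
    (hb : ∀ R : ℝ, 0 ≤ R → Summable fun N => b N * R ^ N) (x : E) : Summable fun N => g N x :=
  .of_norm_bounded (hb ‖x‖ (norm_nonneg x)) fun N => (hg N).norm_le x

lemma natCast_mul_pow_pred_le {R : ℝ} (hR : 0 ≤ R) (N : ℕ) :
    N * R ^ (N - 1) ≤ (R + 1) ^ N := by
  induction N with
  | zero => simp
  | succ N ih =>
    have hpow : R ^ N ≤ (R + 1) ^ N := pow_le_pow_left₀ hR (le_add_of_nonneg_right zero_le_one) N
    have hN : N * R ^ N = N * R ^ (N - 1) * R := by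
      cases N with
      | zero => simp
      | succ N => rw [Nat.add_sub_cancel, pow_succ, mul_assoc]
    rw [Nat.add_sub_cancel, Nat.cast_succ, add_mul, hN, one_mul, pow_succ, mul_add, mul_one]
    gcongr

theorem hasDerivAt_tsum_of_isBoundedForm (hg : ∀ N, IsBoundedForm N (b N) (g N))
    (hb : ∀ R : ℝ, 0 ≤ R → Summable fun N => b N * R ^ N) (x ξ : E) {d : ℕ → F}
    (hd : ∀ N, HasDerivAt (fun t : ℝ => g N (x + t • ξ)) (d N) 0) :
    HasDerivAt (fun t : ℝ => ∑' N, g N (x + t • ξ)) (∑' N, d N) 0 := by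
  have hball : ∀ t ∈ Set.Ioo (-1 : ℝ) 1, ‖x + t • ξ‖ ≤ ‖x‖ + ‖ξ‖ := by
    intro t ht
    refine norm_add_le_of_le le_rfl ?_
    rw [norm_smul]
    exact mul_le_of_le_one_left (norm_nonneg ξ) (abs_le.2 ⟨ht.1.le, ht.2.le⟩)
  have hzero : (0 : ℝ) ∈ Set.Ioo (-1 : ℝ) 1 := by simp
  choose! d' hderiv hnorm using fun (N : ℕ) (t : ℝ) (ht : t ∈ Set.Ioo (-1 : ℝ) 1) =>
    (hg N).hasDerivAt_line x ξ t (hball t ht)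
  have hdd (N : ℕ) : d N = d' N 0 := (hd N).unique (hderiv N 0 hzero)
  have hbound : Summable fun N => b N * (N * (‖x‖ + ‖ξ‖) ^ (N - 1) * ‖ξ‖) := by
    refine .of_nonneg_of_le (fun N => ?_) (fun N => ?_)
      ((hb (‖x‖ + ‖ξ‖ + 1) (by positivity)).mul_right ‖ξ‖)
    · have := (hg N).bound_nonneg
      positivity
    · rw [← mul_assoc]
      have := (hg N).bound_nonneg
      gcongr
      exact natCast_mul_pow_pred_le (by positivity) N
  have htsum := hasDerivAt_tsum_of_isPreconnected hbound isOpen_Ioo isPreconnected_Ioo hderiv hnorm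
    hzero (by simpa using summable_of_isBoundedForm hg hb x) hzero
  simpa only [hdd] using htsum

end BoundedFormSeries

section KernelBounds

lemma conjCoeff_mem_Icc (n : ℕ) {k : ℝ} (hk : 0 < k) (m : ℕ) : conjCoeff n k m ∈ Set.Icc 0 1 := by
  rw [conjCoeff]
  split_ifs
  · exact ⟨by positivity,
      (div_le_one (by positivity)).2 (le_add_of_nonneg_right (Nat.cast_nonneg _))⟩
  · simp

lemma one_le_predCoeff (n : ℕ) {k : ℝ} (hk : 0 < k) (m : ℕ) : 1 ≤ predCoeff n k m := by
  rw [predCoeff]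
  split_ifs
  · rw [one_le_div (by positivity)]
    linarith
  · exact le_rfl

lemma norm_spectralCoeff_le (n : ℕ) {k : ℝ} (hk : 0 < k) (y : ℂ) (m : ℕ) :
    ‖spectralCoeff n k y m‖ ≤ ‖y‖ ^ m := by
  induction m with
  | zero => norm_num [spectralCoeff]
  | succ m ih =>
    obtain ⟨hconj, hconj'⟩ := conjCoeff_mem_Icc n hk m
    have htwisted : ‖spectralCoeff n k y m + conjCoeff n k m * conj (spectralCoeff n k y m)‖ ≤
        ‖y‖ ^ m + 1 * ‖y‖ ^ m := by
      refine norm_add_le_of_le ih ?_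
      rw [norm_mul, RCLike.norm_conj, Complex.norm_real, Real.norm_of_nonneg hconj]
      gcongr
    rw [spectralCoeff, norm_div, norm_mul, norm_div, RCLike.norm_conj, Complex.norm_real,
      Real.norm_of_nonneg (predCoeff_pos n hk _).le, RCLike.norm_ofNat]
    calc _ ≤ ‖y‖ / 2 * (‖y‖ ^ m + 1 * ‖y‖ ^ m) :=
          (div_le_self (by positivity) (one_le_predCoeff n hk _)).trans (by gcongr)
      _ = _ := by ring

lemma factorial_le_rising {a : ℝ} (ha : 1 ≤ a) (j : ℕ) : (j.factorial : ℝ) ≤ rising a j := by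
  induction j with
  | zero => simp
  | succ j ih =>
    rw [rising_succ, Nat.factorial_succ, mul_comm]
    push_cast
    exact mul_le_mul ih (by linarith) (by positivity) (rising_pos (by linarith) j).le

lemma rising_div_factorial_le_pow {a : ℝ} (ha : 1 ≤ a) (j : ℕ) :
    rising a j / j.factorial ≤ a ^ j := by
  induction j with
  | zero => simp
  | succ j ih =>
    have hstep : (a + j) / (j + 1) ≤ a := by
      rw [div_le_iff₀ (by positivity)]
      linarith [le_mul_of_one_le_left (Nat.cast_nonneg (α := ℝ) j) ha]
    rw [rising_succ, Nat.factorial_succ, Nat.cast_mul, mul_comm ((j + 1 : ℕ) : ℝ),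
      mul_div_mul_comm, pow_succ]
    push_cast
    exact mul_le_mul ih hstep (by positivity) (by positivity)

lemma radialCoeff_nonneg (n : ℕ) {k : ℝ} (hk : 0 < k) (y : ℂ) (m i : ℕ) :
    0 ≤ radialCoeff n k y m i := by
  have hrising := rising_pos (show 0 < n * k + 1 by positivity) (m + i)
  have hnorm := Complex.normSq_nonneg y
  rw [radialCoeff]
  positivity

lemma factorial_add_le_two_pow_mul (i m : ℕ) :
    (i + m).factorial ≤ 2 ^ (i + m) * (i.factorial * m.factorial) := by
  rw [← Nat.add_choose_mul_factorial_mul_factorial, mul_assoc]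
  exact Nat.mul_le_mul_right _ (Nat.choose_le_two_pow _ _)

lemma radialCoeff_le (n : ℕ) {k : ℝ} (hk : 0 < k) (y : ℂ) (m i : ℕ) :
    radialCoeff n k y m i ≤ ‖y‖ ^ (2 * i) * (2 ^ (m + 2 * i) / (m + 2 * i).factorial) := by
  have hnk : 0 ≤ n * k := by positivity
  have hrising := rising_pos (show 0 < n * k + 1 by positivity) (m + i)
  have hfact : ((m + 2 * i).factorial : ℝ) ≤
      2 ^ (m + 2 * i) * (i.factorial * rising (n * k + 1) (m + i)) := by
    have h : ((i + (m + i)).factorial : ℝ) ≤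
        2 ^ (i + (m + i)) * (i.factorial * (m + i).factorial) := by
      exact_mod_cast factorial_add_le_two_pow_mul i (m + i)
    rw [show i + (m + i) = m + 2 * i by ring] at h
    refine h.trans ?_
    gcongr
    exact factorial_le_rising (by linarith) _
  rw [radialCoeff, Complex.normSq_eq_norm_sq, div_eq_mul_inv, pow_mul]
  refine mul_le_mul ?_ ?_ (by positivity) (by positivity)
  · gcongr
    linarith [sq_nonneg ‖y‖]
  · rw [inv_eq_one_div, div_le_div_iff₀ (by positivity) (by positivity), one_mul]
    exact hfact

lemma mul_dunklMonomial_eq_sum (n : ℕ) (k : ℝ) (m i : ℕ) (c x : ℂ) :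
    c * ((x * conj x) ^ i * dunklMonomial n k m x) = ∑ p ∈ antidiagonal (m / n),
      c * ((rising (k + 1) p.1 / p.1.factorial * (rising k p.2 / p.2.factorial) : ℝ) : ℂ) *
        (x ^ (i + m % n + n * p.1) * conj x ^ (i + n * p.2)) := by
  rw [dunklMonomial, heisenbergMonomial, heisenberg, coeff_heisenbergSeries, mul_sum, mul_sum,
    mul_sum]
  refine sum_congr rfl fun p _ => ?_
  push_cast [ofReal_rising]
  ring

lemma isBoundedForm_mul_dunklMonomial (n : ℕ) {k : ℝ} (hk : 0 < k) (m i : ℕ) (c : ℂ) :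
    IsBoundedForm (m + 2 * i) (‖c‖ * (2 * k + 1) ^ m)
      (fun x : ℂ => c * ((x * conj x) ^ i * dunklMonomial n k m x)) := by
  simp only [mul_dunklMonomial_eq_sum]
  have hform := IsBoundedForm.sum (N := m + 2 * i) (s := antidiagonal (m / n)) fun p hp => by
    have hdeg : i + m % n + n * p.1 + (i + n * p.2) = m + 2 * i := by
      have hdiv := Nat.div_add_mod m n
      rw [← HasAntidiagonal.mem_antidiagonal.1 hp, mul_add] at hdiv
      omega
    exact hdeg ▸ isBoundedForm_const_mul_pow_mul_conj_pow
      (c * ((rising (k + 1) p.1 / p.1.factorial * (rising k p.2 / p.2.factorial) : ℝ) : ℂ))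
      (i + m % n + n * p.1) (i + n * p.2)
  refine hform.mono ?_
  have hnorm (p : ℕ × ℕ) :
      ‖c * ((rising (k + 1) p.1 / p.1.factorial * (rising k p.2 / p.2.factorial) : ℝ) : ℂ)‖ =
        ‖c‖ * (rising (k + 1) p.1 / p.1.factorial * (rising k p.2 / p.2.factorial)) := by
    have hfst := rising_pos (show 0 < k + 1 by positivity) p.1
    have hsnd := rising_pos hk p.2
    rw [norm_mul, Complex.norm_real, Real.norm_of_nonneg (by positivity)]
  simp only [hnorm]
  rw [← mul_sum, sum_rising_mul_rising, show k + 1 + k = 2 * k + 1 by ring]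
  gcongr
  exact (rising_div_factorial_le_pow (by linarith) _).trans
    (pow_le_pow_right₀ (by linarith) (Nat.div_le_self m n))

lemma isBoundedForm_kernelTerm (n : ℕ) {k : ℝ} (hk : 0 < k) (y : ℂ) (m i : ℕ) :
    IsBoundedForm (m + 2 * i)
      (2 * (2 * (2 * k + 1) * ‖y‖) ^ (m + 2 * i) / (m + 2 * i).factorial)
      (kernelTerm n k y m i) := by
  have hform := isBoundedForm_mul_dunklMonomial n hk m i
    (radialCoeff n k y m i * spectralCoeff n k y m)
  have hterm : kernelTerm n k y m i = fun x =>
      radialCoeff n k y m i * spectralCoeff n k y m * ((x * conj x) ^ i * dunklMonomial n k m x) +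
        conj (radialCoeff n k y m i * spectralCoeff n k y m *
          ((x * conj x) ^ i * dunklMonomial n k m x)) := by
    ext x
    simp only [kernelTerm, map_mul, map_pow, Complex.conj_conj, Complex.conj_ofReal]
    ring
  rw [hterm]
  refine (hform.add hform.conj).mono ?_
  have hradial := radialCoeff_nonneg n hk y m i
  rw [← two_mul, norm_mul, Complex.norm_real, Real.norm_of_nonneg hradial]
  calc _ ≤ 2 * ((‖y‖ ^ (2 * i) * (2 ^ (m + 2 * i) / (m + 2 * i).factorial)) * ‖y‖ ^ m *
          (2 * k + 1) ^ (m + 2 * i)) := by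
        gcongr
        · exact radialCoeff_le n hk y m i
        · exact norm_spectralCoeff_le n hk y m
        · linarith
        · omega
    _ = _ := by rw [mul_pow, mul_pow, pow_add ‖y‖]; ring

lemma isBoundedForm_kernelComponent (n : ℕ) {k : ℝ} (hk : 0 < k) (y : ℂ) (N : ℕ) :
    IsBoundedForm N (2 * (4 * (2 * k + 1) * ‖y‖) ^ N / N.factorial) (kernelComponent n k y N) := by
  have hterm (i : ℕ) (hi : i ∈ range (N / 2 + 1)) : IsBoundedForm N
      (2 * (2 * (2 * k + 1) * ‖y‖) ^ N / N.factorial) (kernelTerm n k y (N - 2 * i) i) := by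
    have h := isBoundedForm_kernelTerm n hk y (N - 2 * i) i
    have hi' := mem_range.1 hi
    rwa [Nat.sub_add_cancel (by omega)] at h
  refine IsBoundedForm.mono (g := kernelComponent n k y N) (IsBoundedForm.sum hterm) ?_
  rw [sum_const, card_range, nsmul_eq_mul]
  have hcount : ((N / 2 + 1 : ℕ) : ℝ) ≤ 2 ^ N := by
    have := Nat.lt_two_pow_self (n := N)
    exact_mod_cast (by omega : N / 2 + 1 ≤ 2 ^ N)
  calc _ ≤ 2 ^ N * (2 * (2 * (2 * k + 1) * ‖y‖) ^ N / N.factorial) := by gcongr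
    _ = _ := by
      rw [show 4 * (2 * k + 1) * ‖y‖ = 2 * (2 * (2 * k + 1) * ‖y‖) by ring, mul_pow 2]
      ring

lemma summable_two_mul_pow_div_factorial_mul_pow (M R : ℝ) :
    Summable fun N : ℕ => 2 * M ^ N / N.factorial * R ^ N :=
  ((Real.summable_pow_div_factorial (M * R)).mul_left 2).congr fun N => by rw [mul_pow]; ring

lemma summable_kernelComponent (n : ℕ) {k : ℝ} (hk : 0 < k) (y x : ℂ) :
    Summable fun N => kernelComponent n k y N x :=
  summable_of_isBoundedForm (isBoundedForm_kernelComponent n hk y)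
    (fun R _ => summable_two_mul_pow_div_factorial_mul_pow _ R) x

/-- The series of homogeneous components that turns out to be the Dunkl kernel with spectral
variable `y`. Its terms are real; the real part only changes the type. -/
def kernelSeries (n : ℕ) (k : ℝ) (y x : ℂ) : ℝ := (∑' N, kernelComponent n k y N x).re

lemma ofReal_kernelSeries (n : ℕ) (k : ℝ) (y x : ℂ) :
    (kernelSeries n k y x : ℂ) = ∑' N, kernelComponent n k y N x := by
  rw [kernelSeries, ← Complex.conj_eq_iff_re, Complex.conj_tsum]
  simp only [conj_kernelComponent]

lemma analyticOnNhd_kernelSeries (n : ℕ) {k : ℝ} (hk : 0 < k) (y : ℂ) :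
    AnalyticOnNhd ℝ (kernelSeries n k y) Set.univ :=
  (Complex.reCLM.analyticOnNhd Set.univ).comp
    (analyticOnNhd_tsum_of_isBoundedForm (isBoundedForm_kernelComponent n hk y)
      fun R _ => summable_two_mul_pow_div_factorial_mul_pow _ R) (Set.mapsTo_univ _ _)

lemma kernelSeries_zero_right (n : ℕ) {k : ℝ} (hk : 0 < k) (y : ℂ) : kernelSeries n k y 0 = 1 := by
  rw [kernelSeries, tsum_eq_single 0, kernelComponent_zero, Complex.one_re]
  intro N hN
  have hle := (isBoundedForm_kernelComponent n hk y N).norm_le 0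
  rw [norm_zero, zero_pow hN, mul_zero] at hle
  exact norm_le_zero_iff.1 hle

theorem hasDunklDerivAt_tsum_kernelComponent {n : ℕ} (hn : n ≠ 0) {k : ℝ} (hk : 0 < k) (y : ℂ)
    {x : ℂ} (hx : x ^ n ≠ conj x ^ n) (ξ : ℂ) :
    HasDunklDerivAt n k (fun x => ∑' N, kernelComponent n k y N x) ξ x
      ((inner ℝ ξ y : ℝ) * ∑' N, kernelComponent n k y N x) := by
  let v : ℕ → ℂ := fun N => match N with
    | 0 => 0
    | N + 1 => (inner ℝ ξ y : ℝ) * kernelComponent n k y N x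
  have hv : ∀ N, HasDunklDerivAt n k (kernelComponent n k y N) ξ x (v N)
    | 0 => hasDunklDerivAt_kernelComponent_zero n k y ξ x
    | N + 1 => hasDunklDerivAt_kernelComponent_succ hn hk y N hx ξ
  have hsummable := summable_kernelComponent n hk y
  have hderiv := hasDerivAt_tsum_of_isBoundedForm (isBoundedForm_kernelComponent n hk y)
    (fun R _ => summable_two_mul_pow_div_factorial_mul_pow _ R) x ξ hv
  refine hderiv.congr_deriv (HasSum.tsum_eq (HasSum.sub ?_ (HasSum.mul_left _ ?_)))
  · rw [← hasSum_nat_add_iff' 1]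
    simpa [v] using (hsummable x).hasSum.mul_left ((inner ℝ ξ y : ℝ) : ℂ)
  · exact hasSum_sum fun l _ => ((hsummable x).hasSum.sub (hsummable _).hasSum).mul_left _

end KernelBounds

section Reflections

variable {n : ℕ}

lemma posRoot_sq (l : Fin n) : posRoot n l ^ 2 = -rotation n l := by
  rw [posRoot, rotation, mul_pow, ← Complex.exp_nat_mul, ← Complex.exp_nat_mul, neg_sq,
    Complex.I_sq, neg_one_mul]
  congr 2
  push_cast
  ring

lemma norm_posRoot (l : Fin n) : ‖posRoot n l‖ = 1 := by
  rw [posRoot, norm_mul, norm_neg, Complex.norm_I, one_mul, mul_comm, Complex.norm_exp_ofReal_mul_I]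

lemma posRoot_mul_conj (l : Fin n) : posRoot n l * conj (posRoot n l) = 1 := by
  rw [Complex.mul_conj, Complex.normSq_eq_norm_sq, norm_posRoot, one_pow, Complex.ofReal_one]

lemma conj_posRoot_ne_zero (l : Fin n) : conj (posRoot n l) ≠ 0 :=
  right_ne_zero_of_mul_eq_one (posRoot_mul_conj l)

lemma two_mul_inner_posRoot (l : Fin n) (x : ℂ) :
    ((2 * inner ℝ (posRoot n l) x : ℝ) : ℂ) =
      conj (posRoot n l) * (x - rotation n l * conj x) := by
  rw [Complex.inner]
  push_cast
  rw [Complex.re_eq_add_conj, map_mul, Complex.conj_conj]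
  linear_combination (-conj x * posRoot n l) * posRoot_mul_conj l +
    conj (posRoot n l) * conj x * posRoot_sq l

lemma reflect_posRoot (l : Fin n) (x : ℂ) :
    reflect (posRoot n l) x = rotation n l * conj x := by
  rw [reflect, Complex.real_smul, two_mul_inner_posRoot]
  linear_combination (-(x - rotation n l * conj x)) * posRoot_mul_conj l

lemma norm_reflect_posRoot (l : Fin n) (x : ℂ) : ‖reflect (posRoot n l) x‖ = ‖x‖ := by
  rw [reflect_posRoot, norm_mul, norm_rotation, RCLike.norm_conj, one_mul]

lemma inner_posRoot_ne_zero {x : ℂ} (hx : x ^ n ≠ conj x ^ n) (l : Fin n) :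
    (inner ℝ (posRoot n l) x : ℝ) ≠ 0 := fun h0 => by
  have h := two_mul_inner_posRoot l x
  rw [h0, mul_zero, Complex.ofReal_zero] at h
  exact mul_ne_zero (conj_posRoot_ne_zero l) (sub_rotation_mul_ne_zero hx l) h.symm

lemma inner_posRoot_div_inner_posRoot (l : Fin n) (ξ x : ℂ) :
    ((inner ℝ (posRoot n l) ξ / inner ℝ (posRoot n l) x : ℝ) : ℂ) =
      (ξ - rotation n l * conj ξ) / (x - rotation n l * conj x) := by
  rw [← mul_div_mul_left _ _ (conj_posRoot_ne_zero l), ← two_mul_inner_posRoot,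
    ← two_mul_inner_posRoot, ← Complex.ofReal_div, mul_div_mul_left _ _ two_ne_zero]

lemma sub_reflect (a x : ℂ) : x - reflect a x = (2 * inner ℝ a x : ℝ) • a := by
  rw [reflect, sub_sub_cancel]

lemma continuous_reflect (a : ℂ) : Continuous (reflect a) := by
  unfold reflect
  fun_prop

lemma inner_mul_diffQuot (a : ℂ) (f : ℂ → ℝ) (x : ℂ) :
    inner ℝ a x * diffQuot a f x = f x - f (reflect a x) := by
  rw [diffQuot]
  split_ifs with h
  · rw [h, zero_mul, reflect, h, mul_zero, zero_smul, sub_zero, sub_self]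
  · exact mul_div_cancel₀ _ h

end Reflections

section Eigenfunction

lemma fderiv_apply_eq_of_hasDerivAt_line {f : ℂ → ℝ} {x ξ : ℂ} {d : ℝ}
    (hf : DifferentiableAt ℝ f x) (h : HasDerivAt (fun t : ℝ => f (x + t * ξ)) d 0) :
    fderiv ℝ f x ξ = d := by
  have hx : HasFDerivAt f (fderiv ℝ f x) (x + ((0 : ℝ) : ℂ) * ξ) := by simpa using hf.hasFDerivAt
  exact (hx.comp_hasDerivAt (0 : ℝ) (hasDerivAt_add_ofReal_mul x ξ)).unique h

lemma HasDunklDerivAt.dunklOp_eq {n : ℕ} {k : ℝ} {f : ℂ → ℝ} {ξ x : ℂ} {v : ℝ}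
    (hx : x ^ n ≠ (starRingEnd ℂ) x ^ n) (hf : DifferentiableAt ℝ f x)
    (h : HasDunklDerivAt n k (fun z => (f z : ℂ)) ξ x v) : dunklOp n k ξ f x = v := by
  have hre := Complex.reCLM.hasFDerivAt.comp_hasDerivAt (0 : ℝ) h
  have hquot (l : Fin n) : inner ℝ (posRoot n l) ξ * diffQuot (posRoot n l) f x =
      ((ξ - rotation n l * (starRingEnd ℂ) ξ) / (x - rotation n l * (starRingEnd ℂ) x) *
        (f x - f (rotation n l * (starRingEnd ℂ) x))).re := by
    rw [diffQuot, if_neg (inner_posRoot_ne_zero hx l), ← inner_posRoot_div_inner_posRoot,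
      Complex.re_ofReal_mul, Complex.sub_re, Complex.ofReal_re, Complex.ofReal_re,
      reflect_posRoot, div_mul_eq_mul_div, mul_div_assoc]
  rw [dunklOp, fderiv_apply_eq_of_hasDerivAt_line hf hre, Complex.reCLM_apply, Complex.sub_re,
    Complex.re_ofReal_mul, Complex.re_sum, Complex.ofReal_re]
  simp only [hquot, sub_add_cancel]

lemma dunklOp_kernelSeries_of_pow_ne {n : ℕ} (hn : n ≠ 0) {k : ℝ} (hk : 0 < k) (y : ℂ) {x : ℂ}
    (hx : x ^ n ≠ conj x ^ n) (ξ : ℂ) :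
    dunklOp n k ξ (kernelSeries n k y) x = inner ℝ ξ y * kernelSeries n k y x := by
  refine HasDunklDerivAt.dunklOp_eq hx
    (analyticOnNhd_kernelSeries n hk y x (Set.mem_univ x)).differentiableAt ?_
  simp only [Complex.ofReal_mul, ofReal_kernelSeries]
  exact hasDunklDerivAt_tsum_kernelComponent hn hk y hx ξ

lemma dense_setOf_pow_ne_conj_pow {n : ℕ} (hn : n ≠ 0) : Dense {x : ℂ | x ^ n ≠ conj x ^ n} := by
  intro x₀
  by_contra hx₀
  rw [mem_closure_iff_frequently, not_frequently] at hx₀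
  have hanalytic : AnalyticOnNhd ℝ (fun x : ℂ => x ^ n - conj x ^ n) Set.univ :=
    (analyticOnNhd_id.fun_pow n).sub
      ((Complex.conjCLE.toContinuousLinearMap.analyticOnNhd Set.univ).fun_pow n)
  have hzero : (fun x : ℂ => x ^ n - conj x ^ n) =ᶠ[𝓝 x₀] 0 := by
    filter_upwards [hx₀] with x hx
    simpa [sub_eq_zero] using hx
  have hroot : Complex.exp ((Real.pi / (2 * n) : ℝ) * Complex.I) ^ n = Complex.I := by
    have hn' : (n : ℂ) ≠ 0 := Nat.cast_ne_zero.2 hn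
    have hangle : (n : ℂ) * ((Real.pi / (2 * n) : ℝ) * Complex.I) = Real.pi / 2 * Complex.I := by
      push_cast
      field_simp
    rw [← Complex.exp_nat_mul, hangle, Complex.exp_pi_div_two_mul_I]
  have him := congrArg Complex.im (hanalytic.eqOn_zero_of_preconnected_of_eventuallyEq_zero
    isPreconnected_univ (Set.mem_univ x₀) hzero
    (Set.mem_univ (Complex.exp ((Real.pi / (2 * n) : ℝ) * Complex.I))))
  simp only [← map_pow, hroot, Complex.conj_I, Pi.zero_apply] at him
  norm_num at him

lemma tendsto_diffQuot_of_inner_eq_zero {f : ℂ → ℝ} {a x₀ : ℂ}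
    (hf : HasStrictFDerivAt f (fderiv ℝ f x₀) x₀) (h₀ : inner ℝ a x₀ = (0 : ℝ)) :
    Tendsto (diffQuot a f) (𝓝[{x | inner ℝ a x ≠ (0 : ℝ)}] x₀) (𝓝 (diffQuot a f x₀)) := by
  have hfixed : reflect a x₀ = x₀ := by rw [reflect, h₀, mul_zero, zero_smul, sub_zero]
  have hpair : Tendsto (fun x => (x, reflect a x)) (𝓝[{x | inner ℝ a x ≠ (0 : ℝ)}] x₀)
      (𝓝 (x₀, x₀)) := by
    have h := (continuous_id.prodMk (continuous_reflect a)).tendsto x₀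
    rw [id, hfixed] at h
    exact tendsto_nhdsWithin_of_tendsto_nhds h
  have hlittle : (fun x => f x - f (reflect a x) - inner ℝ a x * (2 * fderiv ℝ f x₀ a))
      =o[𝓝[{x | inner ℝ a x ≠ (0 : ℝ)}] x₀] fun x => (inner ℝ a x : ℝ) := by
    refine ((hf.isLittleO.comp_tendsto hpair).congr_left fun x => ?_).trans_isBigO ?_
    · simp only [Function.comp, sub_reflect, map_smul, smul_eq_mul]
      ring
    · refine Asymptotics.IsBigO.of_bound (2 * ‖a‖) (Eventually.of_forall fun x => ?_)
      simp only [Function.comp, sub_reflect, norm_smul, norm_mul, Real.norm_two]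
      exact (mul_right_comm _ _ _).le
  have hlim := hlittle.tendsto_div_nhds_zero.add_const (2 * fderiv ℝ f x₀ a)
  rw [zero_add] at hlim
  rw [diffQuot, if_pos h₀]
  refine hlim.congr' ?_
  filter_upwards [self_mem_nhdsWithin] with x (hx : inner ℝ a x ≠ (0 : ℝ))
  rw [diffQuot, if_neg hx]
  field_simp
  ring

lemma tendsto_diffQuot {f : ℂ → ℝ} (hf : ContDiff ℝ 1 f) (a x₀ : ℂ) :
    Tendsto (diffQuot a f) (𝓝[{x | inner ℝ a x ≠ (0 : ℝ)}] x₀) (𝓝 (diffQuot a f x₀)) := by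
  by_cases h₀ : inner ℝ a x₀ = (0 : ℝ)
  · exact tendsto_diffQuot_of_inner_eq_zero (hf.contDiffAt.hasStrictFDerivAt one_ne_zero) h₀
  · have hinner : Continuous fun x : ℂ => (inner ℝ a x : ℝ) := by fun_prop
    have hquot : Tendsto (fun x => (f x - f (reflect a x)) / inner ℝ a x) (𝓝 x₀)
        (𝓝 ((f x₀ - f (reflect a x₀)) / inner ℝ a x₀)) :=
      ((hf.continuous.sub (hf.continuous.comp (continuous_reflect a))).tendsto x₀).div
        (hinner.tendsto x₀) h₀
    rw [diffQuot, if_neg h₀]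
    refine (tendsto_nhdsWithin_of_tendsto_nhds hquot).congr' ?_
    filter_upwards [self_mem_nhdsWithin] with x (hx : inner ℝ a x ≠ (0 : ℝ))
    rw [diffQuot, if_neg hx]

lemma tendsto_dunklOp {f : ℂ → ℝ} (hf : ContDiff ℝ 1 f) (n : ℕ) (k : ℝ) (ξ x₀ : ℂ) :
    Tendsto (dunklOp n k ξ f) (𝓝[{x | x ^ n ≠ conj x ^ n}] x₀) (𝓝 (dunklOp n k ξ f x₀)) := by
  have hderiv : Continuous fun x => fderiv ℝ f x ξ :=
    (hf.continuous_fderiv one_ne_zero).clm_apply continuous_const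
  refine (tendsto_nhdsWithin_of_tendsto_nhds (hderiv.tendsto x₀)).add
    (Tendsto.const_mul _ (tendsto_finsetSum _ fun l _ => Tendsto.const_mul _ ?_))
  exact (tendsto_diffQuot hf (posRoot n l) x₀).mono_left
    (nhdsWithin_mono x₀ fun x hx => inner_posRoot_ne_zero hx l)

theorem isDunklEigenfunction_kernelSeries {n : ℕ} (hn : n ≠ 0) {k : ℝ} (hk : 0 < k) (y : ℂ) :
    IsDunklEigenfunction n k y (kernelSeries n k y) := by
  have hanalytic := analyticOnNhd_kernelSeries n hk y
  refine ⟨hanalytic, fun ξ x₀ => ?_, kernelSeries_zero_right n hk y⟩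
  have hsmooth : ContDiff ℝ 1 (kernelSeries n k y) :=
    contDiffOn_univ.1 (hanalytic.contDiffOn uniqueDiffOn_univ)
  have : (𝓝[{x : ℂ | x ^ n ≠ conj x ^ n}] x₀).NeBot :=
    mem_closure_iff_nhdsWithin_neBot.1 (dense_setOf_pow_ne_conj_pow hn x₀)
  have hright := tendsto_nhdsWithin_of_tendsto_nhds (s := {x : ℂ | x ^ n ≠ conj x ^ n})
    ((hsmooth.continuous.tendsto x₀).const_mul (inner ℝ ξ y : ℝ))
  refine tendsto_nhds_unique (tendsto_dunklOp hsmooth n k ξ x₀) (hright.congr' ?_)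
  filter_upwards [self_mem_nhdsWithin] with x hx
  exact (dunklOp_kernelSeries_of_pow_ne hn hk y hx ξ).symm

end Eigenfunction

section MaximumPrinciple

variable {E : Type*}

lemma fderiv_self_nonneg_of_isMaxOn_closedBall [NormedAddCommGroup E] [NormedSpace ℝ E]
    {f : E → ℝ} {x : E} {R : ℝ} (hx : ‖x‖ ≤ R) (hmax : IsMaxOn f (Metric.closedBall 0 R) x)
    (hf : DifferentiableAt ℝ f x) : 0 ≤ fderiv ℝ f x x := by
  have hR : 0 ≤ R := (norm_nonneg x).trans hx
  have hsegment : segment ℝ x (x + -x) ⊆ Metric.closedBall 0 R :=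
    (convex_closedBall 0 R).segment_subset (mem_closedBall_zero_iff.2 hx) (by simpa using hR)
  have hinward := hmax.localize.hasFDerivWithinAt_nonpos hf.hasFDerivAt.hasFDerivWithinAt
    (mem_posTangentConeAt_of_segment_subset hsegment)
  rwa [map_neg, neg_nonpos] at hinward

variable [NormedAddCommGroup E] [InnerProductSpace ℝ E]

lemma mul_norm_mul_le_fderiv_self_of_isMaxOn {g : E → ℝ} {c R : ℝ} {x : E} (hx₀ : x ≠ 0)
    (hx : ‖x‖ ≤ R) (hg : DifferentiableAt ℝ g x)
    (hmax : IsMaxOn (fun z => Real.exp (-(c * ‖z‖)) * g z) (Metric.closedBall 0 R) x) :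
    c * ‖x‖ * g x ≤ fderiv ℝ g x x := by
  have hnorm : DifferentiableAt ℝ (fun z : E => ‖z‖) x :=
    (contDiffAt_norm ℝ hx₀).differentiableAt one_ne_zero
  have hweighted := ((hnorm.hasFDerivAt.const_mul c).fun_neg.exp).fun_mul hg.hasFDerivAt
  have hnonneg := fderiv_self_nonneg_of_isMaxOn_closedBall hx hmax hweighted.differentiableAt
  have hself : fderiv ℝ (fun z => Real.exp (-(c * ‖z‖)) * g z) x x =
      Real.exp (-(c * ‖x‖)) * (fderiv ℝ g x x - c * ‖x‖ * g x) := by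
    rw [hweighted.fderiv]
    simp only [_root_.add_apply, _root_.smul_apply, _root_.neg_apply, smul_eq_mul,
      hnorm.fderiv_norm_self]
    ring
  rw [hself] at hnonneg
  exact sub_nonneg.1 (nonneg_of_mul_nonneg_right hnonneg (Real.exp_pos _))

theorem nonpos_of_fderiv_self_le [ProperSpace E] {g : E → ℝ} (hg : Differentiable ℝ g)
    (hg₀ : g 0 = 0) {C : ℝ} (hle : ∀ x, 0 < g x → (∀ z, ‖z‖ = ‖x‖ → g z ≤ g x) →
      fderiv ℝ g x x ≤ C * ‖x‖ * g x) (x₁ : E) : g x₁ ≤ 0 := by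
  by_contra! hx₁
  let h : E → ℝ := fun x => Real.exp (-((C + 1) * ‖x‖)) * g x
  have hcont : Continuous h := by
    have := hg.continuous
    fun_prop
  obtain ⟨x₀, hx₀, hmax⟩ := (isCompact_closedBall (0 : E) ‖x₁‖).exists_isMaxOn
    ⟨x₁, mem_closedBall_zero_iff.2 le_rfl⟩ hcont.continuousOn
  have hx₀' : ‖x₀‖ ≤ ‖x₁‖ := mem_closedBall_zero_iff.1 hx₀
  have hpos : 0 < g x₀ := by
    have hx₁_le : h x₁ ≤ h x₀ := hmax (mem_closedBall_zero_iff.2 le_rfl)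
    exact (mul_pos_iff_of_pos_left (Real.exp_pos _)).1
      ((mul_pos (Real.exp_pos _) hx₁).trans_le hx₁_le)
  have hne : x₀ ≠ 0 := fun h0 => hpos.ne' (h0 ▸ hg₀)
  have hsphere (z : E) (hz : ‖z‖ = ‖x₀‖) : g z ≤ g x₀ := by
    have hz_le : h z ≤ h x₀ := hmax (mem_closedBall_zero_iff.2 (hz.trans_le hx₀'))
    simp only [h, hz] at hz_le
    exact le_of_mul_le_mul_left hz_le (Real.exp_pos _)
  have hlower := mul_norm_mul_le_fderiv_self_of_isMaxOn hne hx₀' (hg x₀) hmax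
  have hupper := hle x₀ hpos hsphere
  have hprod : 0 < ‖x₀‖ * g x₀ := mul_pos (norm_pos_iff.2 hne) hpos
  linarith

end MaximumPrinciple

section Uniqueness

namespace IsDunklEigenfunction

variable {n : ℕ} {k : ℝ} {y : ℂ} {f g : ℂ → ℝ}

lemma differentiable (hf : IsDunklEigenfunction n k y f) : Differentiable ℝ f := fun x =>
  (hf.analytic x (Set.mem_univ x)).differentiableAt

lemma fderiv_self (hf : IsDunklEigenfunction n k y f) (x : ℂ) :
    fderiv ℝ f x x = inner ℝ x y * f x - k * ∑ l : Fin n, (f x - f (reflect (posRoot n l) x)) := by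
  simp only [← hf.eigen x x, dunklOp, inner_mul_diffQuot, add_sub_cancel_right]

lemma le (hk : 0 ≤ k) (hf : IsDunklEigenfunction n k y f) (hg : IsDunklEigenfunction n k y g)
    (x : ℂ) : f x ≤ g x := by
  rw [← sub_nonpos]
  refine nonpos_of_fderiv_self_le (g := fun x => f x - g x) (C := ‖y‖)
    (hf.differentiable.fun_sub hg.differentiable) (by rw [hf.normalized, hg.normalized, sub_self])
    (fun x hpos hsphere => ?_) x
  have hreflect : 0 ≤ k * ∑ l : Fin n, (f x - g x -
      (f (reflect (posRoot n l) x) - g (reflect (posRoot n l) x))) :=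
    mul_nonneg hk (sum_nonneg fun l _ => sub_nonneg.2 (hsphere _ (norm_reflect_posRoot l x)))
  have hcauchy := mul_le_mul_of_nonneg_right (real_inner_le_norm x y) hpos.le
  rw [fderiv_fun_sub (hf.differentiable x) (hg.differentiable x), _root_.sub_apply,
    hf.fderiv_self, hg.fderiv_self]
  simp only [sum_sub_distrib] at hreflect ⊢
  linarith

theorem unique (hk : 0 ≤ k) (hf : IsDunklEigenfunction n k y f)
    (hg : IsDunklEigenfunction n k y g) : f = g :=
  funext fun x => (hf.le hk hg x).antisymm (hg.le hk hf x)

end IsDunklEigenfunction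

theorem dunklKernel_eq_kernelSeries {n : ℕ} (hn : n ≠ 0) {k : ℝ} (hk : 0 < k) (x y : ℂ) :
    dunklKernel n k x y = kernelSeries n k y x := by
  have h := isDunklEigenfunction_kernelSeries hn hk y
  have hkernel : IsDunklEigenfunction n k y (Classical.epsilon (IsDunklEigenfunction n k y)) :=
    Classical.epsilon_spec ⟨_, h⟩
  exact congrFun (hkernel.unique hk.le h) x

end Uniqueness

section Averaging

lemma genBessel_eq_sum_rotation {n : ℕ} (hn : n ≠ 0) {k : ℝ} (hk : 0 < k) (x y : ℂ) :
    genBessel n k x y = 1 / (2 * n) * ∑ l : Fin n,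
      (kernelSeries n k y (rotation n l * x) + kernelSeries n k y (rotation n l * conj x)) := by
  have hexp (l : ℕ) : Complex.exp (Complex.I * ((2 * Real.pi * l / n : ℝ) : ℂ)) =
      Complex.exp (2 * Real.pi * Complex.I / n) ^ l := by
    rw [← Complex.exp_nat_mul]
    congr 1
    push_cast
    ring
  simp only [genBessel, dunklKernel_eq_kernelSeries hn hk, hexp, rotation]
  set ζ := Complex.exp (2 * Real.pi * Complex.I / n)
  have hζ : ζ ^ n = 1 := (Complex.isPrimitiveRoot_exp n hn).pow_eq_one
  let summand : ℕ → ℝ := fun l =>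
    kernelSeries n k y (ζ ^ l * x) + kernelSeries n k y (ζ ^ l * conj x)
  have hcycle := sum_range_succ summand n
  rw [sum_range_succ', show summand n = summand 0 by simp only [summand, hζ, pow_zero]] at hcycle
  rw [Fin.sum_univ_eq_sum_range (fun l => summand (l + 1)) n, add_right_cancel hcycle]

theorem genBessel_zero_left {n : ℕ} (hn : n ≠ 0) {k : ℝ} (hk : 0 < k) (y : ℂ) :
    genBessel n k 0 y = 1 := by
  have hn' : (n : ℝ) ≠ 0 := Nat.cast_ne_zero.2 hn
  rw [genBessel_eq_sum_rotation hn hk]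
  simp only [map_zero, mul_zero, kernelSeries_zero_right n hk, sum_const, card_univ,
    Fintype.card_fin, nsmul_eq_mul]
  field_simp
  norm_num

lemma hasSum_genBessel {n : ℕ} (hn : n ≠ 0) {k : ℝ} (hk : 0 < k) (x y : ℂ) :
    HasSum (fun N => 1 / (2 * n : ℂ) * ∑ l : Fin n,
      (kernelComponent n k y N (rotation n l * x) +
        kernelComponent n k y N (rotation n l * conj x))) (genBessel n k x y) := by
  have hkernel (z : ℂ) : HasSum (fun N => kernelComponent n k y N z) (kernelSeries n k y z) := by
    rw [ofReal_kernelSeries]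
    exact (summable_kernelComponent n hk y z).hasSum
  rw [genBessel_eq_sum_rotation hn hk]
  push_cast
  exact (hasSum_sum fun l _ => (hkernel _).add (hkernel _)).mul_left _

lemma dunklMonomial_rotation_mul (n : ℕ) (k : ℝ) (m : ℕ) (x : ℂ) (l : Fin n) :
    dunklMonomial n k m (rotation n l * x) = rotation n l ^ (m % n) * dunklMonomial n k m x := by
  have hconj := dunklMonomial_rotation_mul_conj n k m (conj x) l
  rwa [Complex.conj_conj, dunklMonomial, conj_heisenbergMonomial, Complex.conj_conj,
    ← heisenbergMonomial, ← dunklMonomial] at hconj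

lemma kernelTerm_rotation_add (n : ℕ) (k : ℝ) (y : ℂ) (m i : ℕ) (x : ℂ) (l : Fin n) :
    kernelTerm n k y m i (rotation n l * x) + kernelTerm n k y m i (rotation n l * conj x) =
      radialCoeff n k y m i * ((x * conj x) ^ i *
        ((rotation n l ^ (m % n) * spectralCoeff n k y m +
          conj (rotation n l ^ (m % n) * spectralCoeff n k y m)) *
            (dunklMonomial n k m x + conj (dunklMonomial n k m x)))) := by
  have hnorm : rotation n l * x * conj (rotation n l * x) = x * conj x := by
    rw [map_mul]
    linear_combination (x * conj x) * rotation_mul_conj n l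
  have hnorm' : rotation n l * conj x * conj (rotation n l * conj x) = x * conj x := by
    rw [map_mul, Complex.conj_conj]
    linear_combination (x * conj x) * rotation_mul_conj n l
  rw [kernelTerm, kernelTerm, hnorm, hnorm', dunklMonomial_rotation_mul_conj,
    dunklMonomial_rotation_mul]
  simp only [map_mul, map_pow, Complex.conj_conj]
  ring

lemma sum_kernelTerm_rotation {n : ℕ} (hn : n ≠ 0) (k : ℝ) (y : ℂ) (m i : ℕ) (x : ℂ) :
    ∑ l : Fin n, (kernelTerm n k y m i (rotation n l * x) +
        kernelTerm n k y m i (rotation n l * conj x)) =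
      if n ∣ m then n * (radialCoeff n k y m i * ((x * conj x) ^ i *
        ((spectralCoeff n k y m + conj (spectralCoeff n k y m)) *
          (dunklMonomial n k m x + conj (dunklMonomial n k m x))))) else 0 := by
  have hsum : ∑ l : Fin n, rotation n l ^ (m % n) = if n ∣ m then (n : ℂ) else 0 := by
    simp only [sum_rotation_pow hn, Nat.dvd_mod_iff dvd_rfl]
  have hsum' : ∑ l : Fin n, (rotation n l ^ (m % n) * spectralCoeff n k y m +
      conj (rotation n l ^ (m % n) * spectralCoeff n k y m)) =
        if n ∣ m then n * (spectralCoeff n k y m + conj (spectralCoeff n k y m)) else 0 := by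
    rw [sum_add_distrib, ← map_sum, ← sum_mul, hsum]
    split_ifs
    · rw [map_mul, Complex.conj_natCast, mul_add]
    · rw [zero_mul, map_zero, add_zero]
  simp only [kernelTerm_rotation_add]
  rw [← mul_sum, ← mul_sum, ← sum_mul, hsum']
  split_ifs
  · ring
  · rw [zero_mul, mul_zero, mul_zero]

end Averaging

section ClosedForm

variable {n : ℕ} {k : ℝ}

lemma conjCoeff_mul (hn : n ≠ 0) (k : ℝ) (j : ℕ) : conjCoeff n k (n * j) = k / (k + j) := by
  rw [conjCoeff, if_pos (dvd_mul_right n j), Nat.mul_div_cancel_left j (Nat.pos_of_ne_zero hn)]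

lemma predCoeff_mul (hn : n ≠ 0) (k : ℝ) (j : ℕ) :
    predCoeff n k (n * j) = (2 * k + j) / (k + j) := by
  rw [predCoeff, if_pos (dvd_mul_right n j), Nat.mul_div_cancel_left j (Nat.pos_of_ne_zero hn)]

lemma twistedSpectralCoeff_mul_add (hk : 0 < k) (y : ℂ) (j : ℕ) {r : ℕ} (hr : r < n) :
    twistedSpectralCoeff n k y (n * j + r) =
      (conj y / 2) ^ r * twistedSpectralCoeff n k y (n * j) := by
  induction r with
  | zero => simp
  | succ r ih =>
    have hdvd : ¬ n ∣ n * j + (r + 1) := fun h =>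
      absurd (Nat.le_of_dvd (by omega) ((Nat.dvd_add_right (dvd_mul_right n j)).1 h)) (by omega)
    have hrec := predCoeff_mul_spectralCoeff_succ n hk y (n * j + r)
    rw [add_assoc, predCoeff, if_neg hdvd, ih (by omega), Complex.ofReal_one, one_mul] at hrec
    rw [twistedSpectralCoeff, conjCoeff, if_neg hdvd, hrec, pow_succ', Complex.ofReal_zero,
      zero_mul, add_zero, mul_assoc]

lemma predCoeff_mul_spectralCoeff_mul_succ (hn : n ≠ 0) (hk : 0 < k) (y : ℂ) (j : ℕ) :
    predCoeff n k (n * (j + 1)) * spectralCoeff n k y (n * (j + 1)) =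
      (conj y / 2) ^ n * twistedSpectralCoeff n k y (n * j) := by
  obtain ⟨m, rfl⟩ := Nat.exists_eq_add_one_of_ne_zero hn
  have hrec := predCoeff_mul_spectralCoeff_succ (m + 1) hk y ((m + 1) * j + m)
  rw [twistedSpectralCoeff_mul_add hk y j m.lt_succ_self] at hrec
  rw [mul_add, mul_one, ← add_assoc, hrec, pow_succ', mul_assoc]

lemma conj_heisenberg_conj_div_two_pow (y : ℂ) (j : ℕ) :
    conj (heisenberg (k + 1 : ℂ) k ((conj y / 2) ^ n) ((y / 2) ^ n) j) =
      heisenberg (k + 1 : ℂ) k ((y / 2) ^ n) ((conj y / 2) ^ n) j := by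
  have h := conj_heisenberg (k + 1) k ((conj y / 2) ^ n) ((y / 2) ^ n) j
  push_cast at h
  rw [h, map_pow, map_pow, map_div₀, map_div₀, Complex.conj_conj, map_ofNat]

lemma sq_mul_spectralCoeff_mul_succ (hn : n ≠ 0) (hk : 0 < k) (y : ℂ) (j : ℕ) {c : ℝ}
    (hc : twistedSpectralCoeff n k y (n * j) =
      c * heisenberg (k + 1 : ℂ) k ((conj y / 2) ^ n) ((y / 2) ^ n) j) :
    ((2 * k + (j + 1)) ^ 2 * spectralCoeff n k y (n * (j + 1)) : ℂ) = (k + (j + 1)) * c *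
      ((k + (j + 1)) * heisenberg (k + 1 : ℂ) k ((conj y / 2) ^ n) ((y / 2) ^ n) (j + 1) -
        k * conj (heisenberg (k + 1 : ℂ) k ((conj y / 2) ^ n) ((y / 2) ^ n) (j + 1))) := by
  have hrec := predCoeff_mul_spectralCoeff_mul_succ hn hk y j
  have hheis := heisenberg_succ (k : ℂ) ((conj y / 2) ^ n) ((y / 2) ^ n) j
  have hkj : (k + (j + 1) : ℂ) ≠ 0 := by exact_mod_cast (show k + (j + 1) ≠ 0 by positivity)
  rw [hc, predCoeff_mul hn] at hrec
  push_cast at hrec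
  rw [div_mul_eq_mul_div, div_eq_iff hkj] at hrec
  rw [conj_heisenberg_conj_div_two_pow]
  linear_combination (2 * k + (j + 1) : ℂ) * hrec - (k + (j + 1)) * c * hheis

lemma twistedSpectralCoeff_mul (hn : n ≠ 0) (hk : 0 < k) (y : ℂ) (j : ℕ) :
    twistedSpectralCoeff n k y (n * j) = (j.factorial / rising (2 * k + 1) j : ℝ) *
      heisenberg (k + 1 : ℂ) k ((conj y / 2) ^ n) ((y / 2) ^ n) j := by
  induction j with
  | zero =>
    norm_num [twistedSpectralCoeff, spectralCoeff, conjCoeff_zero n hk, heisenberg_zero, map_ofNat]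
  | succ j ih =>
    have hu := sq_mul_spectralCoeff_mul_succ hn hk y j ih
    have hu_conj := congrArg conj hu
    simp only [map_mul, map_sub, map_add, map_pow, Complex.conj_ofReal, map_natCast,
      map_one, Complex.conj_conj, map_ofNat] at hu_conj
    have hkj : (k + (j + 1) : ℂ) ≠ 0 := by exact_mod_cast (show k + (j + 1) ≠ 0 by positivity)
    have h2kj : (2 * k + (j + 1) : ℂ) ≠ 0 := by
      exact_mod_cast (show 2 * k + (j + 1) ≠ 0 by positivity)
    have hscale : (((j + 1).factorial / rising (2 * k + 1) (j + 1) : ℝ) : ℂ) =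
        (j + 1) * (j.factorial / rising (2 * k + 1) j : ℝ) / (2 * k + (j + 1)) := by
      rw [rising_succ, Nat.factorial_succ, add_assoc, add_comm (1 : ℝ)]
      push_cast
      rw [mul_div_assoc, div_mul_eq_div_div, mul_div_assoc]
    rw [hscale, twistedSpectralCoeff, conjCoeff_mul hn]
    refine mul_left_cancel₀ (mul_ne_zero hkj (pow_ne_zero 2 h2kj)) ?_
    push_cast at hu hu_conj ⊢
    field_simp
    linear_combination (k + (j + 1) : ℂ) * hu + (k : ℂ) * hu_conj

lemma mul_spectralCoeff_add_conj (hn : n ≠ 0) (hk : 0 < k) (y : ℂ) (j : ℕ) :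
    k * (spectralCoeff n k y (n * j) + conj (spectralCoeff n k y (n * j))) =
      (k + j) * (j.factorial / rising (2 * k + 1) j : ℝ) *
        gegenbauer (k : ℂ) ((conj y / 2) ^ n) ((y / 2) ^ n) j := by
  have htwisted := twistedSpectralCoeff_mul hn hk y j
  have htwisted_conj := congrArg conj htwisted
  rw [map_mul, Complex.conj_ofReal, conj_heisenberg_conj_div_two_pow] at htwisted_conj
  rw [twistedSpectralCoeff, conjCoeff_mul hn] at htwisted htwisted_conj
  simp only [map_add, map_mul, Complex.conj_ofReal, Complex.conj_conj] at htwisted_conj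
  have hswap := heisenberg_add_heisenberg_swap (k : ℂ) ((conj y / 2) ^ n) ((y / 2) ^ n) j
  have hkj : (k + j : ℂ) ≠ 0 := by exact_mod_cast (show k + j ≠ 0 by positivity)
  have h2kj : (j + 2 * k : ℂ) ≠ 0 := by exact_mod_cast (show j + 2 * k ≠ 0 by positivity)
  have hcancel : ((k / (k + j) : ℝ) : ℂ) * (k + j) = k := by
    push_cast
    exact div_mul_cancel₀ _ hkj
  refine mul_left_cancel₀ h2kj ?_
  linear_combination (k * (k + j) : ℂ) * (htwisted + htwisted_conj) -
    k * (spectralCoeff n k y (n * j) + conj (spectralCoeff n k y (n * j))) * hcancel +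
    (k + j) * (j.factorial / rising (2 * k + 1) j : ℝ) * hswap

lemma mul_dunklMonomial_add_conj (hn : n ≠ 0) (k : ℝ) (x : ℂ) (j : ℕ) :
    k * (dunklMonomial n k (n * j) x + conj (dunklMonomial n k (n * j) x)) =
      (j + 2 * k) * gegenbauer (k : ℂ) (x ^ n) (conj x ^ n) j := by
  rw [dunklMonomial, Nat.mul_mod_right, Nat.mul_div_cancel_left j (Nat.pos_of_ne_zero hn),
    conj_heisenbergMonomial, heisenbergMonomial, pow_zero, pow_zero, one_mul, one_mul,
    heisenberg_add_heisenberg_swap]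

end ClosedForm

section Coefficients

lemma ofReal_rising_ne_zero {a : ℝ} (ha : 0 < a) (j : ℕ) : rising (a : ℂ) j ≠ 0 := by
  rw [← ofReal_rising]
  exact_mod_cast (rising_pos ha j).ne'

variable {K : Type*} [Field K]

lemma add_mul_inv_rising_add_one {a : K} (ha : ∀ j, rising a j ≠ 0) (j : ℕ) :
    (a + j) * (rising (a + 1) j)⁻¹ = a * (rising a j)⁻¹ := by
  have hsucc := rising_succ_left a j
  rw [rising_succ] at hsucc
  have hne : rising (a + 1) j ≠ 0 := right_ne_zero_of_mul (rising_succ_left a j ▸ ha (j + 1))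
  rw [← div_eq_mul_inv, ← div_eq_mul_inv, div_eq_div_iff hne (ha j), mul_comm, hsucc]

lemma add_div_factorial_mul_rising [CharZero K] {a : K} (ha : ∀ j, rising a j ≠ 0) (m i : ℕ) :
    (a + m) / (i.factorial * rising (a + 1) (m + i)) =
      a * lagrangeCoeff (a + m) i / rising a (m + 2 * i) := by
  have hi : (i.factorial : K) ≠ 0 := Nat.cast_ne_zero.2 i.factorial_ne_zero
  have hsucc : a * rising (a + 1) (m + i) = rising a m * ((a + m) * rising (a + m + 1) i) := by
    rw [← rising_succ_left, ← rising_succ_left, ← rising_add, add_assoc]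
  have hsucc_ne : a * rising (a + 1) (m + i) ≠ 0 := rising_succ_left a (m + i) ▸ ha (m + i + 1)
  have hne : rising (a + 1) (m + i) ≠ 0 := right_ne_zero_of_mul hsucc_ne
  have hne' : rising (a + m + 1) i ≠ 0 :=
    right_ne_zero_of_mul (right_ne_zero_of_mul (hsucc ▸ hsucc_ne))
  have hadd_ne : rising a m * rising (a + m) (2 * i) ≠ 0 := rising_add a m (2 * i) ▸ ha _
  have hm := ha m
  have h2i : rising (a + m) (2 * i) ≠ 0 := right_ne_zero_of_mul hadd_ne
  rw [lagrangeCoeff, rising_add a m (2 * i)]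
  field_simp
  linear_combination -hsucc

/-- The contribution of the indices `j` of the outer sum and `i` of the Lagrange expansion to the
coefficient of `X ^ (n * j + 2 * i)` in `besselGen n k c₁ c₂ d₁ d₂`. -/
def besselGenCoeff (n : ℕ) (k c₁ c₂ d₁ d₂ : K) (j i : ℕ) : K :=
  j.factorial / rising (2 * k) j * (gegenbauer k c₁ c₂ j * gegenbauer k d₁ d₂ j) / 2 ^ (n * j) *
    (lagrangeCoeff (n * k + n * j) i / 4 ^ i)

lemma besselGenCoeff_mul_mul (n : ℕ) (k s t c₁ c₂ d₁ d₂ : K) (j i : ℕ) :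
    besselGenCoeff n k (s * c₁) (s * c₂) (t * d₁) (t * d₂) j i =
      (s * t) ^ j * besselGenCoeff n k c₁ c₂ d₁ d₂ j i := by
  rw [besselGenCoeff, besselGenCoeff, gegenbauer_mul_mul, gegenbauer_mul_mul]
  ring

lemma coeff_lagrangeSeries (N : K) (d : ℕ) {M : ℕ} (hM : d / 2 < M) :
    coeff d (lagrangeSeries N) =
      ∑ i ∈ range M, if 2 * i = d then lagrangeCoeff N i / 4 ^ i else 0 := by
  have hcoeff (i : ℕ) (hi : i ∈ range (d + 1)) :
      coeff (d - i) (C (lagrangeCoeff N i / 4 ^ i) * X ^ i : K⟦X⟧) =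
        if 2 * i = d then lagrangeCoeff N i / 4 ^ i else 0 := by
    have hi' := mem_range.1 hi
    rw [coeff_C_mul, coeff_X_pow, mul_ite, mul_one, mul_zero]
    exact if_congr (by omega) rfl rfl
  rw [lagrangeSeries, coeff_xPowSum, sum_congr rfl hcoeff, ← sum_filter, ← sum_filter]
  congr 1
  ext i
  simp only [mem_filter, mem_range]
  omega

lemma coeff_besselGen {n : ℕ} (hn : n ≠ 0) (k c₁ c₂ d₁ d₂ : K) (N : ℕ) :
    coeff N (besselGen n k c₁ c₂ d₁ d₂) = ∑ j ∈ range (N + 1), ∑ i ∈ range (N / 2 + 1),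
      if n * j + 2 * i = N then besselGenCoeff n k c₁ c₂ d₁ d₂ j i else 0 := by
  rw [besselGen, coeff_xPowSum]
  refine sum_congr rfl fun j hj => ?_
  have hj' := mem_range.1 hj
  have hnj : n * j = (n - 1) * j + j := by
    rw [← Nat.succ_mul, Nat.succ_eq_add_one, Nat.sub_add_cancel (Nat.pos_of_ne_zero hn)]
  rw [coeff_C_mul, coeff_X_pow_mul', coeff_lagrangeSeries _ _ (M := N / 2 + 1) (by omega)]
  split_ifs with h
  · simp only [mul_sum, mul_ite, mul_zero]
    exact sum_congr rfl fun i _ => if_congr (by omega) (besselGenCoeff.eq_def ..).symm rfl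
  · rw [mul_zero, sum_eq_zero]
    exact fun i _ => if_neg (by omega)

end Coefficients

section OrbitMean

variable {n : ℕ} {k : ℝ}

lemma spectralCoeff_add_conj_mul_dunklMonomial_add_conj (hn : n ≠ 0) (hk : 0 < k) (x y : ℂ)
    (j : ℕ) :
    (spectralCoeff n k y (n * j) + conj (spectralCoeff n k y (n * j))) *
        (dunklMonomial n k (n * j) x + conj (dunklMonomial n k (n * j) x)) =
      2 * ((k + j) / k) * (j.factorial / rising (2 * k : ℂ) j *
        (gegenbauer (k : ℂ) (x ^ n) (conj x ^ n) j * gegenbauer (k : ℂ) (y ^ n) (conj y ^ n) j) /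
          2 ^ (n * j)) := by
  have hk' : (k : ℂ) ≠ 0 := by exact_mod_cast hk.ne'
  have hscale : gegenbauer (k : ℂ) ((conj y / 2) ^ n) ((y / 2) ^ n) j =
      gegenbauer (k : ℂ) (y ^ n) (conj y ^ n) j / 2 ^ (n * j) := by
    rw [gegenbauer_comm, div_pow, div_pow, div_eq_inv_mul, div_eq_inv_mul (conj y ^ n),
      gegenbauer_mul_mul, inv_pow, ← pow_mul, ← div_eq_inv_mul]
  have hspectral := mul_spectralCoeff_add_conj hn hk y j
  have hrising := add_mul_inv_rising_add_one (a := (2 * k : ℂ))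
    (fun i => by exact_mod_cast ofReal_rising_ne_zero (mul_pos two_pos hk) i) j
  rw [hscale, Complex.ofReal_div, ofReal_rising] at hspectral
  push_cast at hspectral
  refine mul_left_cancel₀ (mul_ne_zero hk' hk') ?_
  rw [mul_mul_mul_comm, hspectral, mul_dunklMonomial_add_conj hn]
  simp only [div_eq_mul_inv] at hrising ⊢
  linear_combination (k + j : ℂ) * j.factorial *
    gegenbauer (k : ℂ) (x ^ n) (conj x ^ n) j * gegenbauer (k : ℂ) (y ^ n) (conj y ^ n) j *
      (2 ^ (n * j))⁻¹ * (hrising - 2 * k * (rising (2 * k : ℂ) j)⁻¹ * mul_inv_cancel₀ hk')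

lemma radialCoeff_mul_add_mul_div (hn : n ≠ 0) (hk : 0 < k) (y : ℂ) (j i : ℕ) :
    radialCoeff n k y (n * j) i * ((k + j) / k) = (y * conj y) ^ i *
      (lagrangeCoeff (n * k + n * j : ℂ) i / 4 ^ i) / rising (n * k : ℂ) (n * j + 2 * i) := by
  have hk' : (k : ℂ) ≠ 0 := by exact_mod_cast hk.ne'
  have hn' : (n : ℂ) ≠ 0 := by exact_mod_cast hn
  have hlagrange := add_div_factorial_mul_rising (a := (n * k : ℂ)) (fun i => by
    exact_mod_cast ofReal_rising_ne_zero (mul_pos (Nat.cast_pos.2 (Nat.pos_of_ne_zero hn)) hk) i)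
    (n * j) i
  rw [radialCoeff, Complex.mul_conj]
  push_cast [ofReal_rising] at hlagrange ⊢
  refine mul_left_cancel₀ (mul_ne_zero hn' hk') ?_
  calc _ = (Complex.normSq y / 4 : ℂ) ^ i * ((n * k + n * j) /
          (i.factorial * rising (n * k + 1 : ℂ) (n * j + i))) := by field_simp
    _ = _ := by rw [hlagrange, div_pow]; ring

lemma radialCoeff_mul_eq_besselGenCoeff (hn : n ≠ 0) (hk : 0 < k) (x y : ℂ) (j i : ℕ) :
    radialCoeff n k y (n * j) i * ((x * conj x) ^ i *
      ((spectralCoeff n k y (n * j) + conj (spectralCoeff n k y (n * j))) *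
        (dunklMonomial n k (n * j) x + conj (dunklMonomial n k (n * j) x)))) =
      2 * ((x * conj x) * (y * conj y)) ^ i / rising (n * k : ℂ) (n * j + 2 * i) *
        besselGenCoeff n (k : ℂ) (x ^ n) (conj x ^ n) (y ^ n) (conj y ^ n) j i := by
  rw [spectralCoeff_add_conj_mul_dunklMonomial_add_conj hn hk, besselGenCoeff]
  linear_combination 2 * (x * conj x) ^ i * (j.factorial / rising (2 * k : ℂ) j *
    (gegenbauer (k : ℂ) (x ^ n) (conj x ^ n) j * gegenbauer (k : ℂ) (y ^ n) (conj y ^ n) j) /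
      2 ^ (n * j)) * radialCoeff_mul_add_mul_div hn hk y j i

lemma sum_kernelComponent_rotation (hn : n ≠ 0) (hk : 0 < k) (ρ r : ℝ) {a b : ℂ}
    (ha : a * conj a = 1) (hb : b * conj b = 1) (N : ℕ) :
    1 / (2 * n : ℂ) * ∑ l : Fin n, (kernelComponent n k (r * b) N (rotation n l * (ρ * a)) +
        kernelComponent n k (r * b) N (rotation n l * conj (ρ * a : ℂ))) =
      ((ρ * r : ℝ) : ℂ) ^ N / rising (n * k : ℂ) N *
        coeff N (besselGen n (k : ℂ) (a ^ n) (conj a ^ n) (b ^ n) (conj b ^ n)) := by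
  have hn' : (n : ℂ) ≠ 0 := by exact_mod_cast hn
  simp only [kernelComponent, ← Finset.sum_add_distrib]
  rw [sum_comm, coeff_besselGen hn, sum_comm (s := range (N + 1)), mul_sum, mul_sum]
  refine sum_congr rfl fun i hi => ?_
  have hi' := mem_range.1 hi
  rw [sum_kernelTerm_rotation hn]
  split_ifs with hdvd
  · obtain ⟨j, hj⟩ := hdvd
    have hN : n * j + 2 * i = N := by omega
    have hjN : j ≤ n * j := Nat.le_mul_of_pos_left j (Nat.pos_of_ne_zero hn)
    have hunique (j' : ℕ) (hne : j' ≠ j) : n * j' + 2 * i ≠ N := fun h =>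
      hne (Nat.eq_of_mul_eq_mul_left (Nat.pos_of_ne_zero hn) (by omega))
    rw [sum_eq_single_of_mem j (mem_range.2 (by omega)) fun j' _ hne => if_neg (hunique j' hne),
      if_pos hN, hj, radialCoeff_mul_eq_besselGenCoeff hn hk, hN]
    simp only [map_mul, Complex.conj_ofReal, mul_pow _ _ n, besselGenCoeff_mul_mul]
    have hradius : ((ρ * a * (ρ * conj a)) * (r * b * (r * conj b)) : ℂ) = (ρ * r) ^ 2 := by
      linear_combination (ρ * r : ℂ) ^ 2 * (b * conj b * ha + hb)
    have hpow : ((ρ * r : ℂ) ^ 2) ^ i * ((ρ : ℂ) ^ n * (r : ℂ) ^ n) ^ j = (ρ * r) ^ N := by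
      rw [← mul_pow, ← pow_mul, ← pow_mul, ← pow_add, add_comm, hN]
    rw [hradius, Complex.ofReal_mul, ← hpow]
    field_simp
  · rw [mul_zero, sum_eq_zero, mul_zero]
    exact fun j _ => if_neg fun h => hdvd ⟨j, by omega⟩

lemma hasSum_coeff_besselGen (hn : n ≠ 0) (hk : 0 < k) (ρ r : ℝ) {a b : ℂ}
    (ha : a * conj a = 1) (hb : b * conj b = 1) :
    HasSum (fun N => ((ρ * r : ℝ) : ℂ) ^ N / rising (n * k : ℂ) N *
        coeff N (besselGen n (k : ℂ) (a ^ n) (conj a ^ n) (b ^ n) (conj b ^ n)))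
      (genBessel n k (ρ * a) (r * b)) := by
  simpa only [sum_kernelComponent_rotation hn hk ρ r ha hb] using
    hasSum_genBessel hn hk (ρ * a) (r * b)

end OrbitMean

section RotationProduct

variable {n : ℕ}

lemma prod_one_sub_rotation_mul_X (hn : n ≠ 0) (c : ℂ) :
    ∏ s, (1 - C (c * rotation n s) * X : ℂ⟦X⟧) = 1 - C (c ^ n) * X ^ n := by
  set ζ := Complex.exp (2 * Real.pi * Complex.I / n) with hζ
  have hroot := Complex.isPrimitiveRoot_exp n hn
  have hpow : (C (c * ζ) * X : ℂ⟦X⟧) ^ n = C (c ^ n) * X ^ n := by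
    rw [mul_pow, ← map_pow, mul_pow c, hroot.pow_eq_one, mul_one]
  have hprod := congrArg (Polynomial.eval 1) (X_pow_sub_C_eq_prod
    (hroot.map_of_injective (f := (C : ℂ →+* ℂ⟦X⟧)) C_injective) (Nat.pos_of_ne_zero hn) hpow)
  rw [Polynomial.eval_prod] at hprod
  simp only [Polynomial.eval_sub, Polynomial.eval_pow, Polynomial.eval_X, Polynomial.eval_C,
    one_pow] at hprod
  rw [hprod, ← Fin.prod_univ_eq_prod_range (fun i => 1 - C ζ ^ i * (C (c * ζ) * X : ℂ⟦X⟧)) n]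
  refine prod_congr rfl fun s _ => ?_
  rw [rotation, ← hζ, pow_succ]
  simp only [map_mul, map_pow]
  ring

lemma prod_one_sub_conj_rotation_mul_X (hn : n ≠ 0) (c : ℂ) :
    ∏ s, (1 - C (c * conj (rotation n s)) * X : ℂ⟦X⟧) = 1 - C (c ^ n) * X ^ n := by
  have h := congrArg (PowerSeries.map (starRingEnd ℂ)) (prod_one_sub_rotation_mul_X hn (conj c))
  simpa only [map_prod, map_sub, map_one, map_mul, map_pow, PowerSeries.map_C, PowerSeries.map_X,
    Complex.conj_conj] using h

lemma prod_one_sub_two_mul_X_sub_X_sq (hn : n ≠ 0) {u v : ℂ} (huv : u * v = 1) {z : Fin n → ℂ}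
    (hz : ∀ s, 2 * z s = u * rotation n s + v * conj (rotation n s)) :
    ∏ s, (1 - (C (2 * z s) * X - X ^ 2) : ℂ⟦X⟧) =
      (1 - C (u ^ n) * X ^ n) * (1 - C (v ^ n) * X ^ n) := by
  rw [← prod_one_sub_rotation_mul_X hn, ← prod_one_sub_conj_rotation_mul_X hn, ← prod_mul_distrib]
  refine prod_congr rfl fun s _ => ?_
  have hunit : (C (u * rotation n s) : ℂ⟦X⟧) * C (v * conj (rotation n s)) = 1 := by
    rw [← map_mul, mul_mul_mul_comm, huv, rotation_mul_conj, one_mul, map_one]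
  rw [hz, map_add]
  linear_combination (-X ^ 2) * hunit

end RotationProduct

section Summability

lemma rising_nonneg {a : ℝ} (ha : 0 ≤ a) (j : ℕ) : 0 ≤ rising a j := by
  induction j with
  | zero => simp
  | succ j ih => rw [rising_succ]; positivity

lemma rising_le_rising {a b : ℝ} (ha : 0 ≤ a) (hab : a ≤ b) (j : ℕ) : rising a j ≤ rising b j := by
  induction j with
  | zero => simp
  | succ j ih =>
    rw [rising_succ, rising_succ]
    exact mul_le_mul ih (by linarith) (by positivity) (rising_nonneg (ha.trans hab) j)

lemma rising_mul_rising_le {a b : ℝ} (ha : 0 ≤ a) (hb : 0 ≤ b) (i j : ℕ) :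
    rising a i * rising b j ≤ rising (a + b) (i + j) := by
  rw [rising_add]
  exact mul_le_mul (rising_le_rising ha (by linarith) i)
    (rising_le_rising hb (by linarith [i.cast_nonneg (α := ℝ)]) j) (rising_nonneg hb j)
    (rising_nonneg (add_nonneg ha hb) i)

lemma prod_rising_le {ι : Type*} (s : Finset ι) {a : ι → ℝ} (ha : ∀ i, 0 ≤ a i) (m : ι → ℕ) :
    ∏ i ∈ s, rising (a i) (m i) ≤ rising (∑ i ∈ s, a i) (∑ i ∈ s, m i) := by
  induction s using Finset.cons_induction with
  | empty => simp
  | cons i s hi ih =>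
    rw [prod_cons, sum_cons, sum_cons]
    exact (mul_le_mul_of_nonneg_left ih (rising_nonneg (ha i) _)).trans
      (rising_mul_rising_le (ha i) (sum_nonneg fun _ _ => ha _) _ _)

lemma pow_le_rising {a : ℝ} (ha : 0 ≤ a) (j : ℕ) : a ^ j ≤ rising a j := by
  induction j with
  | zero => simp
  | succ j ih =>
    rw [rising_succ, pow_succ]
    exact mul_le_mul ih (by linarith [j.cast_nonneg (α := ℝ)]) ha (rising_nonneg ha j)

lemma summable_prod_apply {ι β : Type*} [Fintype ι] {f : ι → β → ℝ} (hf : ∀ i b, 0 ≤ f i b)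
    (hsum : ∀ i, Summable (f i)) : Summable fun m : ι → β => ∏ i, f i (m i) := by
  classical
  refine summable_of_sum_le (c := ∏ i, ∑' b, f i b)
    (fun m => prod_nonneg fun i _ => hf i (m i)) fun u => ?_
  calc ∑ m ∈ u, ∏ i, f i (m i)
      ≤ ∑ m ∈ Fintype.piFinset fun i => u.image (· i), ∏ i, f i (m i) :=
        sum_le_sum_of_subset_of_nonneg
          (fun m hm => Fintype.mem_piFinset.2 fun i => mem_image_of_mem (· i) hm)
          fun m _ _ => prod_nonneg fun i _ => hf i (m i)
    _ = ∏ i, ∑ b ∈ u.image (· i), f i b := by rw [prod_univ_sum]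
    _ ≤ ∏ i, ∑' b, f i b := prod_le_prod (fun i _ => sum_nonneg fun b _ => hf i b)
        fun i _ => Summable.sum_le_tsum _ (fun b _ => hf i b) (hsum i)

lemma summable_prod_abs_pow_div_factorial {n : ℕ} (z : Fin n → ℝ) :
    Summable fun m : Fin n → ℕ => ∏ s, |z s| ^ m s / ((m s).factorial : ℝ) := by
  let f (s : Fin n) (i : ℕ) : ℝ := |z s| ^ i / i.factorial
  have hf (s : Fin n) (i : ℕ) : 0 ≤ f s i := by positivity
  have h : Summable fun m : Fin n → ℕ => ∏ s, f s (m s) :=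
    summable_prod_apply hf fun s => Real.summable_pow_div_factorial |z s|
  exact h

lemma abs_hornTerm_le {n : ℕ} {β : Fin n → ℝ} (hβ : ∀ s, 0 ≤ β s) (z : Fin n → ℝ)
    (m : Fin n → ℕ) :
    |hornTerm β (∑ s, β s) z m| ≤ ∏ s, |z s| ^ m s / (m s).factorial := by
  have hβ_prod : 0 ≤ ∏ s, rising (β s) (m s) := prod_nonneg fun s _ => rising_nonneg (hβ s) _
  have hγ : 0 ≤ rising (∑ s, β s) (∑ s, m s) := rising_nonneg (sum_nonneg fun s _ => hβ s) _
  change |(∏ s, rising (β s) (m s)) / rising (∑ s, β s) (∑ s, m s) *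
    ∏ s, z s ^ m s / ((m s).factorial : ℝ)| ≤ _
  rw [abs_mul, abs_of_nonneg (div_nonneg hβ_prod hγ), abs_prod]
  simp only [abs_div, abs_pow, Nat.abs_cast]
  exact mul_le_of_le_one_left (prod_nonneg fun s _ => by positivity)
    (div_le_one_of_le₀ (prod_rising_le univ hβ m) hγ)

variable {n : ℕ} {k : ℝ}

lemma abs_hornTerm_const_le (hk : 0 ≤ k) (z : Fin n → ℝ) (j : ℕ) (m : Fin n → ℕ) :
    |hornTerm (fun _ : Fin n => k + j) (n * k + n * j) z m| ≤
      ∏ s, |z s| ^ m s / (m s).factorial := by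
  simpa only [sum_const, card_univ, Fintype.card_fin, nsmul_eq_mul, mul_add] using
    abs_hornTerm_le (β := fun _ => k + j) (fun _ => by positivity) z m

theorem summable_hornTerm (hk : 0 ≤ k) (z : Fin n → ℝ) (j : ℕ) :
    Summable (hornTerm (fun _ : Fin n => k + j) (n * k + n * j) z) :=
  .of_norm_bounded (summable_prod_abs_pow_div_factorial z) (abs_hornTerm_const_le hk z j)

/-- The coefficient of the `j`-th confluent Horn function in the expansion of the generalized
Bessel function. -/
def hornCoeff (n : ℕ) (k q : ℝ) (j : ℕ) : ℝ :=
  poch k j * poch k j / (poch (2 * k) j * poch (n * k) (n * j) * j.factorial) * q ^ j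

lemma rising_mul_pow_le (hn : n ≠ 0) (hk : 0 ≤ k) (j : ℕ) :
    rising k j * (k ^ (n - 1)) ^ j ≤ rising (n * k) (n * j) :=
  calc rising k j * (k ^ (n - 1)) ^ j ≤ rising k j * rising k j ^ (n - 1) := by
        rw [pow_right_comm]
        exact mul_le_mul_of_nonneg_left
          (pow_le_pow_left₀ (pow_nonneg hk j) (pow_le_rising hk j) _) (rising_nonneg hk j)
    _ = ∏ _s : Fin n, rising k j := by
        rw [mul_pow_sub_one hn, prod_const, card_univ, Fintype.card_fin]
    _ ≤ rising (n * k) (n * j) := by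
        simpa only [sum_const, card_univ, Fintype.card_fin, nsmul_eq_mul, smul_eq_mul] using
          prod_rising_le (univ : Finset (Fin n)) (fun _ => hk) fun _ => j

lemma abs_hornCoeff_le (hn : n ≠ 0) (hk : 0 < k) (q : ℝ) (j : ℕ) :
    |hornCoeff n k q j| ≤ (|q| / k ^ (n - 1)) ^ j / j.factorial := by
  have : (0 : ℝ) < n := Nat.cast_pos.2 (Nat.pos_of_ne_zero hn)
  have hrising := rising_pos hk j
  have hrising_two : 0 < rising (2 * k) j := rising_pos (by positivity) j
  have hrising_n : 0 < rising (n * k) (n * j) := rising_pos (by positivity) _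
  have hbound : rising k j * (rising k j * (k ^ (n - 1)) ^ j) ≤
      rising (2 * k) j * rising (n * k) (n * j) :=
    mul_le_mul (rising_le_rising hk.le (by linarith) j) (rising_mul_pow_le hn hk.le j)
      (by positivity) hrising_two.le
  change |rising k j * rising k j / (rising (2 * k) j * rising (n * k) (n * j) * j.factorial) *
    q ^ j| ≤ _
  rw [abs_mul, abs_pow, abs_of_nonneg (by positivity), div_pow, div_div, div_mul_eq_mul_div,
    div_le_div_iff₀ (by positivity) (by positivity)]
  linear_combination (|q| ^ j * j.factorial) * hbound

/-- The terms of the expansion of the generalized Bessel function, as a multiple series indexed by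
the outer index and the indices of the confluent Horn functions. -/
def hornExpansionTerm (k q : ℝ) (z : Fin n → ℝ) (p : ℕ × (Fin n → ℕ)) : ℝ :=
  hornCoeff n k q p.1 * hornTerm (fun _ : Fin n => k + p.1) (n * k + n * p.1) z p.2

lemma summable_hornExpansionTerm (hn : n ≠ 0) (hk : 0 < k) (q : ℝ) (z : Fin n → ℝ) :
    Summable (hornExpansionTerm k q z) := by
  refine .of_norm_bounded ((Real.summable_pow_div_factorial (|q| / k ^ (n - 1))).mul_of_nonneg
    (summable_prod_abs_pow_div_factorial z) (fun j => by positivity)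
    fun m => prod_nonneg fun s _ => by positivity) fun p => ?_
  rw [hornExpansionTerm, norm_mul]
  exact mul_le_mul (abs_hornCoeff_le hn hk q _) (abs_hornTerm_const_le hk.le z _ _)
    (norm_nonneg _) (by positivity)

theorem hasSum_hornPhi (hn : n ≠ 0) (hk : 0 < k) (q : ℝ) (z : Fin n → ℝ) :
    HasSum (fun j => hornCoeff n k q j * hornPhi (fun _ : Fin n => k + j) (n * k + n * j) z)
      (∑' p, hornExpansionTerm k q z p) :=
  (summable_hornExpansionTerm hn hk q z).hasSum.prod_fiberwise fun j =>
    (summable_hornTerm hk.le z j).hasSum.mul_left _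

end Summability

section HornExpansion

lemma coeff_prod_univ {ι R : Type*} [Fintype ι] [DecidableEq ι] [CommSemiring R] (f : ι → R⟦X⟧)
    {d M : ℕ} (hd : d < M) :
    coeff d (∏ s, f s) = ∑ m ∈ Fintype.piFinset fun _ : ι => range M,
      if ∑ s, m s = d then ∏ s, coeff (m s) (f s) else 0 := by
  rw [coeff_prod, ← sum_filter]
  refine sum_nbij (fun l => ⇑l) (fun l hl => ?_) DFunLike.coe_injective.injOn (fun m hm => ?_)
    fun _ _ => rfl
  · have hsum := (mem_finsuppAntidiag.1 hl).1
    refine mem_filter.2 ⟨Fintype.mem_piFinset.2 fun s => mem_range.2 (lt_of_le_of_lt ?_ hd), hsum⟩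
    exact hsum ▸ single_le_sum (f := l) (fun _ _ => Nat.zero_le _) (mem_univ s)
  · exact ⟨Finsupp.equivFunOnFinite.symm m, mem_finsuppAntidiag.2
      ⟨(mem_filter.1 (mem_coe.1 hm)).2, subset_univ _⟩, rfl⟩

variable {n : ℕ}

/-- The contribution of the outer index `j` and the Horn indices `m` to the coefficient of
`X ^ (n * j + ∑ s, m s)` in `hornGen k q z`. -/
def hornGenCoeff (k q : ℂ) (z : Fin n → ℂ) (j : ℕ) (m : Fin n → ℕ) : ℂ :=
  rising k j * rising k j / (rising (2 * k) j * j.factorial) * (q / 2 ^ n) ^ j *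
    ∏ s, coeff (m s) (binomialPow (k + j) (C (z s) * X))

lemma coeff_hornGen (hn : n ≠ 0) (k q : ℂ) (z : Fin n → ℂ) (N : ℕ) :
    coeff N (hornGen k q z) = ∑ j ∈ range (N + 1),
      ∑ m ∈ Fintype.piFinset fun _ : Fin n => range (N + 1),
        if n * j + ∑ s, m s = N then hornGenCoeff k q z j m else 0 := by
  rw [hornGen, coeff_xPowSum]
  refine sum_congr rfl fun j hj => ?_
  have hj' := mem_range.1 hj
  have hnj : n * j = (n - 1) * j + j := by
    rw [← Nat.succ_mul, Nat.succ_eq_add_one, Nat.sub_add_cancel (Nat.pos_of_ne_zero hn)]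
  rw [coeff_C_mul, coeff_X_pow_mul', coeff_prod_univ _ (M := N + 1) (by omega)]
  split_ifs with h
  · simp only [mul_sum, mul_ite, mul_zero]
    exact sum_congr rfl fun m _ => if_congr (by omega) (hornGenCoeff.eq_def ..).symm rfl
  · rw [mul_zero, sum_eq_zero]
    exact fun m _ => if_neg (by omega)

lemma ofReal_hornExpansionTerm (k t : ℝ) (q : ℝ) (z : Fin n → ℝ) (j : ℕ) (m : Fin n → ℕ) :
    (hornExpansionTerm k ((t / 2) ^ n * q) (fun s => t * z s) (j, m) : ℂ) =
      (t : ℂ) ^ (n * j + ∑ s, m s) / rising (n * k : ℂ) (n * j + ∑ s, m s) *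
        hornGenCoeff (k : ℂ) q (fun s => z s) j m := by
  have hcoeff : ∏ s, coeff (m s) (binomialPow (k + j : ℂ) (C (z s : ℂ) * X)) =
      (∏ s, rising (k + j : ℂ) (m s)) * ∏ s, (z s : ℂ) ^ m s / ((m s).factorial : ℂ) := by
    rw [← prod_mul_distrib]
    refine prod_congr rfl fun s _ => ?_
    rw [coeff_binomialPow_C_mul_X, div_mul_eq_mul_div, mul_div_assoc]
  have hscale : ∏ s, (t * z s : ℂ) ^ m s / ((m s).factorial : ℂ) =
      (t : ℂ) ^ (∑ s, m s) * ∏ s, (z s : ℂ) ^ m s / ((m s).factorial : ℂ) := by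
    rw [← prod_pow_eq_pow_sum, ← prod_mul_distrib]
    exact prod_congr rfl fun s _ => by rw [mul_pow, mul_div_assoc]
  have htwo : (((t : ℂ) / 2) ^ n * q) ^ j = (t : ℂ) ^ (n * j) * (q / 2 ^ n) ^ j := by
    rw [div_pow, div_mul_eq_mul_div, mul_div_assoc, mul_pow, pow_mul]
  change (((rising k j * rising k j / (rising (2 * k) j * rising (n * k) (n * j) * j.factorial) *
    ((t / 2) ^ n * q) ^ j) * ((∏ s, rising (k + j) (m s)) / rising (n * k + n * j) (∑ s, m s) *
      ∏ s, (t * z s) ^ m s / ((m s).factorial : ℝ)) : ℝ) : ℂ) = _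
  push_cast [ofReal_rising]
  rw [hscale, htwo, hornGenCoeff, hcoeff, rising_add]
  push_cast
  simp only [div_eq_mul_inv, mul_inv]
  ring

lemma hasSum_coeff_hornGen (hn : n ≠ 0) {k : ℝ} (hk : 0 < k) (t q : ℝ) (z : Fin n → ℝ) :
    HasSum (fun N => (t : ℂ) ^ N / rising (n * k : ℂ) N *
        coeff N (hornGen (k : ℂ) q fun s => (z s : ℂ)))
      (∑' p, hornExpansionTerm k ((t / 2) ^ n * q) (fun s => t * z s) p : ℝ) := by
  let degree (p : ℕ × (Fin n → ℕ)) : ℕ := n * p.1 + ∑ s, p.2 s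
  have hfiberwise := Complex.hasSum_ofReal.2 ((summable_hornExpansionTerm hn hk
    ((t / 2) ^ n * q) fun s => t * z s).hasSum.tsum_fiberwise degree)
  refine hfiberwise.congr_fun fun N => ?_
  set F := (range (N + 1) ×ˢ Fintype.piFinset fun _ : Fin n => range (N + 1)).filter
    fun p => degree p = N with hF
  have hfiber : degree ⁻¹' {N} = (F : Set _) := by
    ext ⟨j, m⟩
    simp only [hF, degree, Set.mem_preimage, Set.mem_singleton_iff, coe_filter, mem_product,
      Fintype.mem_piFinset, mem_range, Set.mem_ofPred_eq]
    refine ⟨fun hN => ⟨⟨?_, fun s => ?_⟩, hN⟩, fun h => h.2⟩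
    · have := Nat.le_mul_of_pos_left j (Nat.pos_of_ne_zero hn)
      omega
    · have := single_le_sum (f := m) (fun _ _ => Nat.zero_le _) (mem_univ s)
      omega
  rw [hfiber, Finset.tsum_subtype' F, hF, Complex.ofReal_sum, sum_filter, sum_product,
    coeff_hornGen hn, mul_sum]
  refine sum_congr rfl fun j _ => ?_
  rw [mul_sum]
  refine sum_congr rfl fun m _ => ?_
  simp only [degree]
  split_ifs with hN
  · rw [ofReal_hornExpansionTerm, hN]
  · rw [mul_zero]

end HornExpansion

section Expansion

variable {n : ℕ} {k : ℝ}

lemma exp_I_mul_conj (φ : ℝ) :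
    Complex.exp (Complex.I * φ) * conj (Complex.exp (Complex.I * φ)) = 1 := by
  rw [← Complex.exp_conj, ← Complex.exp_add, map_mul, Complex.conj_I, Complex.conj_ofReal,
    neg_mul, add_neg_cancel, Complex.exp_zero]

lemma exp_pow_sub_conj_pow (n : ℕ) (φ : ℝ) :
    Complex.exp (Complex.I * φ) ^ n - conj (Complex.exp (Complex.I * φ)) ^ n =
      2 * Complex.I * (Real.sin (n * φ) : ℝ) := by
  rw [← map_pow, Complex.sub_conj, ← Complex.exp_nat_mul,
    show (n : ℂ) * (Complex.I * φ) = (n * φ : ℝ) * Complex.I by push_cast; ring,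
    Complex.exp_ofReal_mul_I_im]
  push_cast
  ring

lemma two_mul_bcos (n : ℕ) (φ θ : ℝ) (s : Fin n) :
    2 * (bcos n (θ - φ) s : ℂ) =
      conj (Complex.exp (Complex.I * φ)) * Complex.exp (Complex.I * θ) * rotation n s +
        Complex.exp (Complex.I * φ) * conj (Complex.exp (Complex.I * θ)) *
          conj (rotation n s) := by
  have hexp : conj (Complex.exp (Complex.I * φ)) * Complex.exp (Complex.I * θ) * rotation n s =
      Complex.exp ((θ - φ + 2 * Real.pi * ((s : ℕ) + 1) / n : ℝ) * Complex.I) := by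
    rw [rotation, ← Complex.exp_conj, ← Complex.exp_nat_mul, ← Complex.exp_add, ← Complex.exp_add,
      map_mul, Complex.conj_I, Complex.conj_ofReal]
    congr 1
    push_cast
    ring
  have hconj : Complex.exp (Complex.I * φ) * conj (Complex.exp (Complex.I * θ)) *
      conj (rotation n s) = conj (conj (Complex.exp (Complex.I * φ)) *
        Complex.exp (Complex.I * θ) * rotation n s) := by
    simp only [map_mul, Complex.conj_conj]
  rw [hconj, hexp, Complex.add_conj, Complex.exp_ofReal_mul_I_re, bcos]
  push_cast
  rfl

theorem genBessel_eq_tsum_hornPhi (hn : n ≠ 0) (hk : 0 < k) (ρ r φ θ : ℝ) :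
    genBessel n k (ρ * Complex.exp (Complex.I * φ)) (r * Complex.exp (Complex.I * θ)) =
      ∑' j : ℕ, hornCoeff n k (-4 * (ρ * r / 2) ^ n * Real.sin (n * θ) * Real.sin (n * φ)) j *
        hornPhi (fun _ : Fin n => k + j) (n * k + n * j) fun s => ρ * r * bcos n (θ - φ) s := by
  have ha := exp_I_mul_conj φ
  have hb := exp_I_mul_conj θ
  have hsin_a := exp_pow_sub_conj_pow n φ
  have hsin_b := exp_pow_sub_conj_pow n θ
  have hcos := two_mul_bcos n φ θ
  set a := Complex.exp (Complex.I * φ)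
  set b := Complex.exp (Complex.I * θ)
  set q := -4 * Real.sin (n * θ) * Real.sin (n * φ) with hq
  have hq_eq : (a ^ n - conj a ^ n) * (b ^ n - conj b ^ n) = q := by
    rw [hsin_a, hsin_b, hq]
    push_cast
    linear_combination 4 * Complex.sin (n * φ) * Complex.sin (n * θ) * Complex.I_sq
  have hprod := prod_one_sub_two_mul_X_sub_X_sq hn (u := conj a * b) (v := a * conj b)
    (by linear_combination b * conj b * ha + hb) hcos
  have hgen := hornGen_eq_besselGen (k : ℂ) _ (by simpa only [mul_pow] using hprod) hn
    (fun j => by exact_mod_cast ofReal_rising_ne_zero (mul_pos two_pos hk) j)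
    (fun i j => by
      have : (0 : ℝ) < n := Nat.cast_pos.2 (Nat.pos_of_ne_zero hn)
      exact_mod_cast ofReal_rising_ne_zero (show 0 < n * k + n * i by positivity) j)
  rw [hq_eq] at hgen
  have hbessel := hasSum_coeff_besselGen hn hk ρ r ha hb
  rw [← hgen] at hbessel
  rw [show -4 * (ρ * r / 2) ^ n * Real.sin (n * θ) * Real.sin (n * φ) = (ρ * r / 2) ^ n * q by
      rw [hq]; ring, (hasSum_hornPhi hn hk _ _).tsum_eq]
  exact_mod_cast hbessel.unique (hasSum_coeff_hornGen hn hk (ρ * r) q _)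

end Expansion

end DihedralBessel

end

theorem corollary1_general (n : ℕ) (hn : n ≠ 0) (k : ℝ) (hk : 0 < k) :
    (∀ y : ℂ, DihedralBessel.genBessel n k 0 y = 1) ∧
    ∀ ρ r φ θ : ℝ,
      (∀ j : ℕ, Summable (DihedralBessel.hornTerm (fun _ : Fin n => k + j) (n * k + n * j)
        (fun s => ρ * r * DihedralBessel.bcos n (θ - φ) s))) ∧
      Summable (fun j : ℕ =>
        DihedralBessel.poch k j * DihedralBessel.poch k j /
            (DihedralBessel.poch (2 * k) j * DihedralBessel.poch (n * k) (n * j) * j.factorial) *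
          (-4 * (ρ * r / 2) ^ n * Real.sin (n * θ) * Real.sin (n * φ)) ^ j *
          DihedralBessel.hornPhi (fun _ : Fin n => k + j) (n * k + n * j)
            (fun s => ρ * r * DihedralBessel.bcos n (θ - φ) s)) ∧
      DihedralBessel.genBessel n k (ρ * Complex.exp (Complex.I * φ))
          (r * Complex.exp (Complex.I * θ)) =
        DihedralBessel.normConst n k /
            (n * ProbabilityTheory.beta (k + 1 / 2) (1 / 2) * Real.Gamma (n * k)) *
          ∑' j : ℕ,
            DihedralBessel.poch k j * DihedralBessel.poch k j /
                (DihedralBessel.poch (2 * k) j * DihedralBessel.poch (n * k) (n * j) *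
                  j.factorial) *
              (-4 * (ρ * r / 2) ^ n * Real.sin (n * θ) * Real.sin (n * φ)) ^ j *
              DihedralBessel.hornPhi (fun _ : Fin n => k + j) (n * k + n * j)
                (fun s => ρ * r * DihedralBessel.bcos n (θ - φ) s) := by
  refine ⟨DihedralBessel.genBessel_zero_left hn hk, fun ρ r φ θ =>
    ⟨DihedralBessel.summable_hornTerm hk.le _, (DihedralBessel.hasSum_hornPhi hn hk _ _).summable,
      ?_⟩⟩
  have hn' : (0 : ℝ) < n := Nat.cast_pos.2 (Nat.pos_of_ne_zero hn)
  have hbeta : 0 < ProbabilityTheory.beta (k + 1 / 2) (1 / 2) :=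
    ProbabilityTheory.beta_pos (by positivity) (by norm_num)
  have hGamma : 0 < Real.Gamma (n * k) := Real.Gamma_pos_of_pos (mul_pos hn' hk)
  rw [DihedralBessel.normConst, div_self (mul_pos (mul_pos hn' hbeta) hGamma).ne', one_mul]
  exact DihedralBessel.genBessel_eq_tsum_hornPhi hn hk ρ r φ θ

theorem corollary1 (n : ℕ) (hn : 3 ≤ n) (k : ℝ) (hk : 0 < k) :
    (∀ y : ℂ, DihedralBessel.genBessel n k 0 y = 1) ∧
    ∀ ρ r φ θ : ℝ, 0 ≤ ρ → 0 ≤ r → φ ∈ Set.Icc 0 (Real.pi / n) → θ ∈ Set.Icc 0 (Real.pi / n) →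
      (∀ j : ℕ, Summable (DihedralBessel.hornTerm (fun _ : Fin n => k + j) (n * k + n * j)
        (fun s => ρ * r * DihedralBessel.bcos n (θ - φ) s))) ∧
      Summable (fun j : ℕ =>
        DihedralBessel.poch k j * DihedralBessel.poch k j /
            (DihedralBessel.poch (2 * k) j * DihedralBessel.poch (n * k) (n * j) * j.factorial) *
          (-4 * (ρ * r / 2) ^ n * Real.sin (n * θ) * Real.sin (n * φ)) ^ j *
          DihedralBessel.hornPhi (fun _ : Fin n => k + j) (n * k + n * j)
            (fun s => ρ * r * DihedralBessel.bcos n (θ - φ) s)) ∧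
      DihedralBessel.genBessel n k (ρ * Complex.exp (Complex.I * φ))
          (r * Complex.exp (Complex.I * θ)) =
        DihedralBessel.normConst n k /
            (n * ProbabilityTheory.beta (k + 1 / 2) (1 / 2) * Real.Gamma (n * k)) *
          ∑' j : ℕ,
            DihedralBessel.poch k j * DihedralBessel.poch k j /
                (DihedralBessel.poch (2 * k) j * DihedralBessel.poch (n * k) (n * j) *
                  j.factorial) *
              (-4 * (ρ * r / 2) ^ n * Real.sin (n * θ) * Real.sin (n * φ)) ^ j *
              DihedralBessel.hornPhi (fun _ : Fin n => k + j) (n * k + n * j)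
                (fun s => ρ * r * DihedralBessel.bcos n (θ - φ) s) := by
  obtain ⟨hzero, hexpansion⟩ := corollary1_general n (by lia) k hk
  exact ⟨hzero, fun ρ r φ θ _ _ _ _ => hexpansion ρ r φ θ⟩
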